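/- Let $k$ be a commutative ring with unit. A dg category is a category enriched in complexes of $k$-modules (graded cohomologically, differentials of degree $+1$); a zero object of it is an object $z$ such that the complexes $\mathrm{Hom}(z,X)$ and $\mathrm{Hom}(X,z)$ vanish for all $X$. Let $\mathrm{DCAT}$ be the category of small dg categories and dg functors, and let $\mathrm{DCATp}$ be the category of small dg categories with a distinguished zero object and dg functors preserving the distinguished zero object. Let $\mathbf I:\mathrm{DCAT}\to\mathrm{DCATp}$ be the functor that adds a new zero object, which is taken as the distinguished one. A dg functor $G:\mathcal C\to\mathcal D$ is a quasi-equivalence if $\mathrm{Hom}_{\mathcal C}(X,Y)\to\mathrm{Hom}_{\mathcal D}(GX,GY)$ is a quasi-isomorphism for all objects $X,Y$ and $H^0(G):H^0(\mathcal C)\to H^0(\mathcal D)$ is an equivalence of categories. Consider the following dg categories. - $\mathcal A$ has one object, with endomorphism complex $k$ (in degree $0$). - $\mathcal B$ has two objects $4,5$, with $\mathrm{Hom}(4,4)=\mathrm{Hom}(5,5)=k$ and $\mathrm{Hom}(4,5)=\mathrm{Hom}(5,4)=0$. - For $n\in\mathbb Z$ let $S^{n-1}=k[n-1]$ (that is,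 $k$ in cohomological degree $1-n$) and let $D^n$ be the mapping cone of the identity of $S^{n-1}$. Then $\mathcal C(n)$ (respectively $\mathcal P(n)$) has two objects $8,9$ (respectively $6,7$), each with endomorphism complex $k$, with $\mathrm{Hom}(9,8)=0$ and $\mathrm{Hom}(8,9)=S^{n-1}$ (respectively $\mathrm{Hom}(7,6)=0$ and $\mathrm{Hom}(6,7)=D^n$), and composition is multiplication. - $\mathcal K$ has two objects $1,2$ and is generated as a dg category by $f\in\mathrm{Hom}^0(1,2)$, $g\in\mathrm{Hom}^0(2,1)$, $r_1\in\mathrm{Hom}^{-1}(1,1)$, $r_2\in\mathrm{Hom}^{-1}(2,2)$, $r_{12}\in\mathrm{Hom}^{-2}(1,2)$ subject to $df=dg=0$, $dr_1=gf-1_1$, $dr_2=fg-1_2$, $dr_{12}=fr_1-r_2f$. Let $F:\mathcal A\to\mathcal K$ be the dg functor that sends the object of $\mathcal A$ to $1$; let $R(n):\mathcal B\to\mathcal P(n)$ be the dg functor with $4\mapsto6$, $5\mapsto7$; let $S(n):\mathcal C(n)\to\mathcal P(n)$ be the dg functor with $8\mapsto 6$, $9\mapsto 7$ given by the canonical inclusion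 $S^{n-1}\to D^n$; let $Q:\mathcal O\to\mathbf I\mathcal A$ be the unique morphism of $\mathrm{DCATp}$ from the initial object $\mathcal O$. Let $W$ be the class of quasi-equivalences in $\mathrm{DCATp}$, let $I=\{Q\}\cup\{\mathbf IS(n):n\in\mathbb Z\}$ and $J=\{\mathbf IF\}\cup\{\mathbf IR(n):n\in\mathbb Z\}$. For a set $V$ of morphisms, write $V$-inj for the class of morphisms with the right lifting property with respect to $V$, $V$-cof for the class of morphisms with the left lifting property with respect to $V$-inj, and $V$-cell for the class of transfinite compositions of pushouts of elements of $V$. An object $A$ is small relative to a class $D$ of morphisms if there is a cardinal $\kappa$ such that, for every limit ordinal $\lambda$ in which every subset of cardinality at most $\kappa$ is bounded, $\mathrm{Hom}(A,-)$ commutes with the colimit of every colimit-preserving functor $X$ from $\lambda$ all of whose maps $X_\beta\to X_{\beta+1}$ are in $D$. **Theorem.** The category $\mathrm{DCATp}$ and $W$, $I$, $J$ satisfy the hypotheses of the recognition theorem for cofibrantly generated model categories (Hovey, *Model Categories*, Theorem 2.1.19): 0. $\mathrm{DCATp}$ has all small limits and colimits, $W$ is a subcategory (it contains the identities and is closed under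 composition), and $I$ and $J$ are sets; 1. $W$ has the two-out-of-three property and is closed under retracts; 2. the domains of the elements of $I$ are small relative to $I$-cell; 3. the domains of the elements of $J$ are small relative to $J$-cell; 4. $J\text{-cell}\subseteq W\cap I\text{-cof}$; 5. $I\text{-inj}\subseteq W\cap J\text{-inj}$; 6. $W\cap I\text{-cof}\subseteq J\text{-cof}$ or $W\cap J\text{-inj}\subseteq I\text{-inj}$. Moreover, $\mathrm{DCATp}$ has a Quillen model structure, with functorial factorizations, whose weak equivalences are the quasi-equivalences, and which is cofibrantly generated with $I$ as set of generating cofibrations and $J$ as set of generating trivial cofibrations: the fibrations are the $J$-injective morphisms, the trivial fibrations are the $I$-injective morphisms, and conditions 2 and 3 hold. -/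

import Mathlib

open CategoryTheory CategoryTheory.Limits HomotopicalAlgebra

universe w v u

noncomputable section

/-! ## Differential graded categories -/

/-- A small differential graded category over `k`, with cohomological grading: `Hom X Y` is a
complex of `k`-modules with differential of degree `+1`, and composition is a morphism of complexes
`Hom Y Z ⊗ Hom X Y ⟶ Hom X Z`. Composition is written in the order of functions,
`comp _ g f = g ∘ f`. Equalities between degrees are carried as arguments. -/
structure DGCat (k : Type u) [CommRing k] : Type (u + 1) where
  Obj : Type u
  Hom : Obj → Obj → ℤ → Type u
  [addCommGroup : ∀ X Y p, AddCommGroup (Hom X Y p)]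
  [module : ∀ X Y p, Module k (Hom X Y p)]
  d : ∀ {X Y : Obj} (p q : ℤ), p + 1 = q → (Hom X Y p →ₗ[k] Hom X Y q)
  id : ∀ X : Obj, Hom X X 0
  comp : ∀ {X Y Z : Obj} {q p n : ℤ}, q + p = n →
    (Hom Y Z q →ₗ[k] Hom X Y p →ₗ[k] Hom X Z n)
  d_d : ∀ {X Y : Obj} (p q r : ℤ) (h : p + 1 = q) (h' : q + 1 = r) (f : Hom X Y p),
    d q r h' (d p q h f) = 0
  leibniz : ∀ {X Y Z : Obj} {q p n q' p' n' : ℤ} (h : q + p = n) (hq : q + 1 = q')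
    (hp : p + 1 = p') (hn : n + 1 = n') (g : Hom Y Z q) (f : Hom X Y p),
    d n n' hn (comp h g f) =
      comp (show q' + p = n' by lia) (d q q' hq g) f +
        q.negOnePow • comp (show q + p' = n' by lia) g (d p p' hp f)
  id_comp : ∀ {X Y : Obj} {p : ℤ} (f : Hom X Y p), comp (zero_add p) (id Y) f = f
  comp_id : ∀ {X Y : Obj} {p : ℤ} (f : Hom X Y p), comp (add_zero p) f (id X) = f
  assoc : ∀ {X Y Z T : Obj} {r q p rq qp n : ℤ} (h₁ : r + q = rq) (h₂ : q + p = qp)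
    (h₃ : rq + p = n) (h₄ : r + qp = n) (c : Hom Z T r) (g : Hom Y Z q) (f : Hom X Y p),
    comp h₃ (comp h₁ c g) f = comp h₄ c (comp h₂ g f)

attribute [instance] DGCat.addCommGroup DGCat.module

/-- A dg functor. -/
@[ext]
structure DGFunctor {k : Type u} [CommRing k] (C D : DGCat k) : Type u where
  obj : C.Obj → D.Obj
  map : ∀ {X Y : C.Obj} {p : ℤ}, C.Hom X Y p →ₗ[k] D.Hom (obj X) (obj Y) p
  map_d : ∀ {X Y : C.Obj} (p q : ℤ) (h : p + 1 = q) (f : C.Hom X Y p),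
    map (C.d p q h f) = D.d p q h (map f)
  map_id : ∀ X : C.Obj, map (C.id X) = D.id (obj X)
  map_comp : ∀ {X Y Z : C.Obj} {q p n : ℤ} (h : q + p = n) (g : C.Hom Y Z q) (f : C.Hom X Y p),
    map (C.comp h g f) = D.comp h (map g) (map f)

section

variable {k : Type u} [CommRing k]

theorem DGFunctor.ext_of_heq {C D : DGCat k} {F G : DGFunctor C D}
    (hobj : ∀ X, F.obj X = G.obj X)
    (hmap : ∀ (X Y : C.Obj) (p : ℤ) (f : C.Hom X Y p), F.map f ≍ G.map f) : F = G := by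
  obtain ⟨Fo, Fm, _, _, _⟩ := F
  obtain ⟨Go, Gm, _, _, _⟩ := G
  obtain rfl : Fo = Go := funext hobj
  obtain rfl : @Fm = @Gm := by
    funext X Y p
    exact LinearMap.ext fun f => eq_of_heq (hmap X Y p f)
  rfl

/-- The identity dg functor. -/
def DGFunctor.idFunctor (C : DGCat k) : DGFunctor C C where
  obj X := X
  map := LinearMap.id
  map_d _ _ _ _ := rfl
  map_id _ := rfl
  map_comp _ _ _ := rfl

/-- The composite of two dg functors. -/
def DGFunctor.compFunctor {C D E : DGCat k} (F : DGFunctor C D) (G : DGFunctor D E) :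
    DGFunctor C E where
  obj X := G.obj (F.obj X)
  map := G.map.comp F.map
  map_d p q h f := by simp [F.map_d, G.map_d]
  map_id X := by simp [F.map_id, G.map_id]
  map_comp h g f := by simp [F.map_comp, G.map_comp]

/-- The category of small dg categories. -/
instance : Category.{u} (DGCat k) where
  Hom C D := DGFunctor C D
  id C := DGFunctor.idFunctor C
  comp F G := DGFunctor.compFunctor F G

namespace DGCat

variable (C : DGCat k)

theorem d_id (X : C.Obj) (q : ℤ) (h : 0 + 1 = q) : C.d 0 q h (C.id X) = 0 := by
  subst h
  have e := C.leibniz (add_zero 0) rfl rfl rfl (C.id X) (C.id X)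
  rw [C.comp_id, C.comp_id, C.id_comp] at e
  simpa using e

/-! ### Cohomology of the morphism complexes -/

/-- The cocycles of degree `n` in the complex `Hom X Y`. -/
def cocycles (X Y : C.Obj) (n : ℤ) : Submodule k (C.Hom X Y n) :=
  LinearMap.ker (C.d n (n + 1) rfl)

/-- The coboundaries of degree `n` in the complex `Hom X Y`, inside the cocycles. -/
def coboundaries (X Y : C.Obj) (n : ℤ) : Submodule k (C.cocycles X Y n) :=
  (LinearMap.range (C.d (X := X) (Y := Y) (n - 1) n (by lia))).submoduleOf (C.cocycles X Y n)

/-- The cohomology `Hⁿ(Hom X Y)`. -/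
abbrev Cohomology (X Y : C.Obj) (n : ℤ) : Type u :=
  C.cocycles X Y n ⧸ C.coboundaries X Y n

variable {C}

theorem mem_cocycles {X Y : C.Obj} {n : ℤ} {f : C.Hom X Y n} :
    f ∈ C.cocycles X Y n ↔ C.d n (n + 1) rfl f = 0 := Iff.rfl

theorem mem_coboundaries {X Y : C.Obj} {n : ℤ} {f : C.cocycles X Y n} :
    f ∈ C.coboundaries X Y n ↔ ∃ e : C.Hom X Y (n - 1), C.d (n - 1) n (by lia) e = f.1 := Iff.rfl

/-- Composition of closed morphisms of degree `0`. -/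
def cocyclesComp {X Y Z : C.Obj} (g : C.cocycles Y Z 0) (f : C.cocycles X Y 0) :
    C.cocycles X Z 0 :=
  ⟨C.comp (add_zero 0) g.1 f.1, by
    rw [mem_cocycles, C.leibniz (add_zero 0) rfl rfl rfl, mem_cocycles.1 g.2, mem_cocycles.1 f.2]
    simp⟩

/-- The identity as a closed morphism. -/
def cocyclesId (X : C.Obj) : C.cocycles X X 0 := ⟨C.id X, C.d_id X _ rfl⟩

theorem cocyclesComp_congr {X Y Z : C.Obj} {g g' : C.cocycles Y Z 0} {f f' : C.cocycles X Y 0}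
    (hg : g - g' ∈ C.coboundaries Y Z 0) (hf : f - f' ∈ C.coboundaries X Y 0) :
    cocyclesComp g f - cocyclesComp g' f' ∈ C.coboundaries X Z 0 := by
  obtain ⟨a, ha⟩ := mem_coboundaries.1 hg
  obtain ⟨b, hb⟩ := mem_coboundaries.1 hf
  refine mem_coboundaries.2
    ⟨C.comp (add_zero _) a f.1 + C.comp (zero_add _) g'.1 b, ?_⟩
  have hf0 := mem_cocycles.1 f.2
  have hg0 := mem_cocycles.1 g'.2
  rw [map_add, C.leibniz (add_zero (0 - 1)) (show (0 : ℤ) - 1 + 1 = 0 by lia) rfl,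
    C.leibniz (zero_add (0 - 1)) rfl (show (0 : ℤ) - 1 + 1 = 0 by lia), ha, hb, hf0, hg0]
  simp [cocyclesComp]

variable (C) in
/-- The objects of the homotopy category `H⁰(C)`. -/
def H0 : Type u := C.Obj

/-- The category `H⁰(C)`: its morphisms are the classes in `H⁰(Hom X Y)`. -/
instance : Category.{u} C.H0 where
  Hom X Y := C.Cohomology X Y 0
  id X := Submodule.Quotient.mk (cocyclesId X)
  comp f g := Quotient.map₂ (fun g f => cocyclesComp g f)
    (fun _ _ hg _ _ hf => (Submodule.quotientRel_def _).2 (cocyclesComp_congr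
      ((Submodule.quotientRel_def _).1 hg) ((Submodule.quotientRel_def _).1 hf))) g f
  id_comp f := by
    induction f using Quotient.inductionOn with
    | h f => exact congrArg (Submodule.Quotient.mk (p := C.coboundaries _ _ 0))
              (Subtype.ext (C.comp_id f.1))
  comp_id f := by
    induction f using Quotient.inductionOn with
    | h f => exact congrArg (Submodule.Quotient.mk (p := C.coboundaries _ _ 0))
              (Subtype.ext (C.id_comp f.1))
  assoc f g h := by
    induction f using Quotient.inductionOn with
    | h f =>
    induction g using Quotient.inductionOn with
    | h g =>
    induction h using Quotient.inductionOn with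
    | h h => exact congrArg (Submodule.Quotient.mk (p := C.coboundaries _ _ 0))
              (Subtype.ext (C.assoc _ _ _ _ h.1 g.1 f.1).symm)

end DGCat

namespace DGFunctor

variable {C D : DGCat k} (F : DGFunctor C D)

/-- The action of a dg functor on cocycles. -/
def mapCocycles (X Y : C.Obj) (n : ℤ) :
    C.cocycles X Y n →ₗ[k] D.cocycles (F.obj X) (F.obj Y) n :=
  F.map.restrict (fun f hf => by
    rw [DGCat.mem_cocycles] at hf ⊢
    rw [← F.map_d, hf, map_zero])

theorem coboundaries_le_comap (X Y : C.Obj) (n : ℤ) :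
    C.coboundaries X Y n ≤ (D.coboundaries (F.obj X) (F.obj Y) n).comap (F.mapCocycles X Y n) := by
  intro f hf
  obtain ⟨e, he⟩ := DGCat.mem_coboundaries.1 hf
  refine Submodule.mem_comap.2 (DGCat.mem_coboundaries.2 ⟨F.map e, ?_⟩)
  rw [← F.map_d, he]
  rfl

/-- The map `Hⁿ(Hom X Y) ⟶ Hⁿ(Hom (F X) (F Y))` induced by a dg functor `F`. -/
def mapCohomology (X Y : C.Obj) (n : ℤ) :
    C.Cohomology X Y n →ₗ[k] D.Cohomology (F.obj X) (F.obj Y) n :=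
  Submodule.mapQ _ _ (F.mapCocycles X Y n) (F.coboundaries_le_comap X Y n)

/-- The functor `H⁰(F) : H⁰(C) ⥤ H⁰(D)` induced by a dg functor `F`. -/
def mapH0 : C.H0 ⥤ D.H0 where
  obj X := F.obj X
  map {X Y} f := F.mapCohomology X Y 0 f
  map_id X := congrArg (Submodule.Quotient.mk (p := D.coboundaries _ _ 0))
    (Subtype.ext (F.map_id X))
  map_comp f g := by
    induction f using Quotient.inductionOn with
    | h f =>
    induction g using Quotient.inductionOn with
    | h g => exact congrArg (Submodule.Quotient.mk (p := D.coboundaries _ _ 0))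
              (Subtype.ext (F.map_comp _ g.1 f.1))

/-- A quasi-equivalence: a dg functor that induces quasi-isomorphisms between the complexes of
morphisms and an equivalence between the homotopy categories `H⁰`. -/
def IsQuasiEquivalence : Prop :=
  (∀ (X Y : C.Obj) (n : ℤ), Function.Bijective (F.mapCohomology X Y n)) ∧
    F.mapH0.IsEquivalence

end DGFunctor

/-! ## Dg categories with a distinguished zero object -/

/-- A zero object of a dg category: all morphisms to and from it are zero. -/
def DGCat.IsZeroObject (C : DGCat k) (z : C.Obj) : Prop :=
  ∀ (X : C.Obj) (p : ℤ), Subsingleton (C.Hom z X p) ∧ Subsingleton (C.Hom X z p)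

variable (k) in
/-- A small dg category with a distinguished zero object. -/
structure DGCatp : Type (u + 1) where
  cat : DGCat k
  pt : cat.Obj
  isZeroObject : cat.IsZeroObject pt

/-- A dg functor that respects the distinguished zero objects. -/
@[ext]
structure DGCatp.Functor (C D : DGCatp k) : Type u where
  functor : DGFunctor C.cat D.cat
  obj_pt : functor.obj C.pt = D.pt

/-- The category of small dg categories with a distinguished zero object. -/
instance : Category.{u} (DGCatp k) where
  Hom C D := DGCatp.Functor C D
  id C := ⟨DGFunctor.idFunctor C.cat, rfl⟩
  comp F G := ⟨DGFunctor.compFunctor F.functor G.functor,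
    (congrArg G.functor.obj F.obj_pt).trans G.obj_pt⟩

/-- The class of quasi-equivalences between dg categories with a distinguished zero object. -/
def quasiEquivalences (k : Type u) [CommRing k] : MorphismProperty (DGCatp k) :=
  fun _ _ F => F.functor.IsQuasiEquivalence

/-! ### Adding a zero object -/

namespace AdjoinZero

variable (C : DGCat k)

/-- The morphisms of the dg category obtained from `C` by adding a zero object `none`. -/
def Hom : Option C.Obj → Option C.Obj → ℤ → Type u
  | some X, some Y, p => C.Hom X Y p
  | some _, none, _ => PUnit
  | none, _, _ => PUnit

instance : ∀ X Y p, AddCommGroup (Hom C X Y p)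
  | some X, some Y, p => C.addCommGroup X Y p
  | some _, none, _ => (inferInstance : AddCommGroup PUnit.{u + 1})
  | none, _, _ => (inferInstance : AddCommGroup PUnit.{u + 1})

instance : ∀ X Y p, Module k (Hom C X Y p)
  | some X, some Y, p => C.module X Y p
  | some _, none, _ => (inferInstance : Module k PUnit.{u + 1})
  | none, _, _ => (inferInstance : Module k PUnit.{u + 1})

instance subsingleton_left (Y : Option C.Obj) (p : ℤ) : Subsingleton (Hom C none Y p) :=
  inferInstanceAs (Subsingleton PUnit)

instance subsingleton_right : ∀ (X : Option C.Obj) (p : ℤ), Subsingleton (Hom C X none p)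
  | some _, _ => inferInstanceAs (Subsingleton PUnit)
  | none, _ => inferInstanceAs (Subsingleton PUnit)

/-- The dg category obtained from `C` by adding a zero object. -/
def cat : DGCat k where
  Obj := Option C.Obj
  Hom := Hom C
  d {X Y} p q h := match X, Y with
    | some X, some Y => C.d (X := X) (Y := Y) p q h
    | some _, none => 0
    | none, _ => 0
  id X := match X with
    | some X => C.id X
    | none => 0
  comp {X Y Z} {q p n} h := match X, Y, Z with
    | some X, some Y, some Z => C.comp (X := X) (Y := Y) (Z := Z) h
    | some _, some _, none => 0
    | some _, none, _ => 0
    | none, _, _ => 0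
  d_d {X Y} p q r h h' f := match X, Y with
    | some X, some Y => C.d_d (X := X) (Y := Y) p q r h h' f
    | some _, none => Subsingleton.elim _ _
    | none, _ => Subsingleton.elim _ _
  leibniz {X Y Z} {q p n q' p' n'} h hq hp hn g f := match X, Y, Z with
    | some X, some Y, some Z => C.leibniz (X := X) (Y := Y) (Z := Z) h hq hp hn g f
    | some _, some _, none => Subsingleton.elim _ _
    | some _, none, none => Subsingleton.elim _ _
    | some X, none, some Z => by
        simp only [LinearMap.zero_apply, smul_zero, add_zero]
        exact map_zero (C.d (X := X) (Y := Z) n n' hn)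
    | none, _, _ => Subsingleton.elim _ _
  id_comp {X Y} {p} f := match X, Y with
    | some X, some Y => C.id_comp (X := X) (Y := Y) f
    | some _, none => Subsingleton.elim _ _
    | none, _ => Subsingleton.elim _ _
  comp_id {X Y} {p} f := match X, Y with
    | some X, some Y => C.comp_id (X := X) (Y := Y) f
    | some _, none => Subsingleton.elim _ _
    | none, _ => Subsingleton.elim _ _
  assoc {X Y Z T} {r q p rq qp n} h₁ h₂ h₃ h₄ c g f := match X, Y, Z, T with
    | some X, some Y, some Z, some T =>
        C.assoc (X := X) (Y := Y) (Z := Z) (T := T) h₁ h₂ h₃ h₄ c g f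
    | some _, some _, some _, none => Subsingleton.elim _ _
    | some _, some _, none, none => Subsingleton.elim _ _
    | some _, none, _, none => Subsingleton.elim _ _
    | some X, some Y, none, some T => by
        simp only [LinearMap.zero_apply]
        exact LinearMap.congr_fun (map_zero (C.comp (X := X) (Y := Y) (Z := T) h₃)) f
    | some _, none, none, some _ => by simp
    | some _, none, some _, some _ => by simp
    | none, _, _, _ => Subsingleton.elim _ _

/-- The extension of a dg functor to the dg categories with an added zero object. -/
def map {C D : DGCat k} (F : DGFunctor C D) : DGFunctor (cat C) (cat D) where
  obj := Option.map F.obj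
  map {X Y} {p} := match X, Y with
    | some X, some Y => F.map (X := X) (Y := Y) (p := p)
    | some _, none => 0
    | none, _ => 0
  map_d {X Y} p q h f := match X, Y with
    | some X, some Y => F.map_d (X := X) (Y := Y) p q h f
    | some X, none => (subsingleton_right D (some (F.obj X)) q).elim _ _
    | none, Y => (subsingleton_left D (Y.map F.obj) q).elim _ _
  map_id X := match X with
    | some X => F.map_id X
    | none => (subsingleton_right D none 0).elim _ _
  map_comp {X Y Z} {_ _ n} h g f := match X, Y, Z with
    | some X, some Y, some Z => F.map_comp (X := X) (Y := Y) (Z := Z) h g f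
    | some X, some _, none =>
        (subsingleton_right D (some (F.obj X)) n).elim _ _
    | some X, none, none =>
        (subsingleton_right D (some (F.obj X)) n).elim _ _
    | some X, none, some Z => map_zero (F.map (X := X) (Y := Z) (p := n))
    | none, _, Z => (subsingleton_left D (Z.map F.obj) n).elim _ _

end AdjoinZero

variable (k) in
/-- The functor from dg categories to dg categories with a distinguished zero object that adds a
zero object. -/
def adjoinZero : DGCat k ⥤ DGCatp k where
  obj C := ⟨AdjoinZero.cat C, none, fun X p =>
    ⟨AdjoinZero.subsingleton_left C X p, AdjoinZero.subsingleton_right C X p⟩⟩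
  map F := ⟨AdjoinZero.map F, rfl⟩
  map_id C := by
    refine DGCatp.Functor.ext (DGFunctor.ext_of_heq (fun X => ?_) (fun X Y p f => ?_))
    · cases X <;> rfl
    · cases X <;> cases Y <;> rfl
  map_comp F G := by
    refine DGCatp.Functor.ext (DGFunctor.ext_of_heq (fun X => ?_) (fun X Y p f => ?_))
    · cases X <;> rfl
    · cases X <;> cases Y <;> rfl

/-! ### The initial object -/

namespace PointCat

variable (k) in
/-- The dg category with one object, whose morphisms are all zero. -/
def cat : DGCat k where
  Obj := PUnit
  Hom _ _ _ := PUnit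
  d _ _ _ := 0
  id _ := PUnit.unit
  comp _ := 0
  d_d _ _ _ _ _ _ := rfl
  leibniz _ _ _ _ _ _ := rfl
  id_comp _ := rfl
  comp_id _ := rfl
  assoc _ _ _ _ _ _ _ := rfl

end PointCat

variable (k) in
/-- The dg category `O` that consists of the distinguished zero object only. -/
def initialDGCatp : DGCatp k :=
  ⟨PointCat.cat k, PUnit.unit, fun _ _ =>
    ⟨inferInstanceAs (Subsingleton PUnit), inferInstanceAs (Subsingleton PUnit)⟩⟩

/-- The unique morphism from `O` to a dg category with a distinguished zero object. -/
def fromInitial (C : DGCatp k) : initialDGCatp k ⟶ C where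
  functor :=
    { obj := fun _ => C.pt
      map := 0
      map_d := fun _ _ _ _ => (map_zero _).symm
      map_id := fun _ => (C.isZeroObject C.pt 0).1.elim _ _
      map_comp := fun _ _ _ => (map_zero _).symm }
  obj_pt := rfl

variable (k) in
/-- `O` is an initial object. -/
def isInitialInitialDGCatp : IsInitial (initialDGCatp k) :=
  IsInitial.ofUniqueHom fromInitial fun C F => by
    have h : ∀ X, F.functor.obj X = C.pt := fun _ => F.obj_pt
    refine DGCatp.Functor.ext (DGFunctor.ext_of_heq h fun X Y p f => ?_)
    have hs : ∀ {a b : C.cat.Obj}, a = C.pt → b = C.pt →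
        ∀ (x : C.cat.Hom a b p) (y : C.cat.Hom C.pt C.pt p), x ≍ y := by
      rintro _ _ rfl rfl x y
      exact heq_of_eq ((C.isZeroObject C.pt p).1.elim _ _)
    exact hs (h X) (h Y) _ _

/-! ## The dg categories `A`, `B`, `C(n)`, `P(n)` -/

/-- Data for a dg category all of whose complexes of morphisms consist, in each degree, of `k` or
`0`: the complex `Hom X Y` is `k` in the degrees that belong to `supp X Y`, and its differential is
the identity of `k` between two consecutive such degrees. Composition is multiplication in `k`. -/
structure ScalarData (O : Type u) where
  supp : O → O → Set ℤ
  zero_mem : ∀ X, 0 ∈ supp X X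
  add_mem : ∀ {X Y Z q p}, q ∈ supp Y Z → p ∈ supp X Y → q + p ∈ supp X Z
  sq_zero : ∀ {X Y p}, p ∈ supp X Y → p + 1 ∈ supp X Y → p + 1 + 1 ∉ supp X Y
  leibniz : ∀ {X Y Z q p}, q ∈ supp Y Z → p ∈ supp X Y →
    (supp X Z).indicator (1 : ℤ → ℤ) (q + p + 1) =
      (supp Y Z).indicator (1 : ℤ → ℤ) (q + 1) +
        q.negOnePow • (supp X Y).indicator (1 : ℤ → ℤ) (p + 1)

namespace ScalarData

variable {O : Type u} (S : ScalarData O)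

variable (k) in
/-- The submodule of `k` that is `k` if the degree `p` belongs to `supp X Y` and `0` otherwise. -/
def hom (X Y : O) (p : ℤ) : Submodule k k where
  carrier := {x | p ∉ S.supp X Y → x = 0}
  zero_mem' _ := rfl
  add_mem' ha hb h := by rw [ha h, hb h, add_zero]
  smul_mem' c _ ha h := by rw [ha h, smul_zero]

variable (k) in
open Classical in
/-- The differential `k ⟶ k` into degree `q`: the identity if `q` belongs to `supp X Y`. -/
def diff (X Y : O) (p q : ℤ) : S.hom k X Y p →ₗ[k] S.hom k X Y q where
  toFun x := ⟨if q ∈ S.supp X Y then x.1 else 0, fun h => if_neg h⟩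
  map_add' x y := by ext; by_cases h : q ∈ S.supp X Y <;> simp [h]
  map_smul' a x := by ext; by_cases h : q ∈ S.supp X Y <;> simp [h]

variable (k) in
/-- Multiplication in `k`. -/
def mul {X Y Z : O} {q p n : ℤ} (h : q + p = n) :
    S.hom k Y Z q →ₗ[k] S.hom k X Y p →ₗ[k] S.hom k X Z n :=
  LinearMap.mk₂ k
    (fun x y => ⟨x.1 * y.1, fun hn => by
      by_cases hq : q ∈ S.supp Y Z
      · by_cases hp : p ∈ S.supp X Y
        · exact absurd (h ▸ S.add_mem hq hp) hn
        · rw [y.2 hp, mul_zero]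
      · rw [x.2 hq, zero_mul]⟩)
    (fun _ _ _ => Subtype.ext (add_mul _ _ _)) (fun _ _ _ => Subtype.ext (mul_assoc _ _ _))
    (fun _ _ _ => Subtype.ext (mul_add _ _ _)) (fun _ _ _ => Subtype.ext (mul_left_comm _ _ _))

variable (k) in
/-- The dg category defined by `S`. -/
def cat : DGCat k where
  Obj := O
  Hom X Y p := S.hom k X Y p
  d p q _ := S.diff k _ _ p q
  id X := ⟨1, fun h => absurd (S.zero_mem X) h⟩
  comp h := S.mul k h
  d_d {X Y} p q r h h' x := by
    subst h h'
    apply Subtype.ext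
    by_cases h0 : p ∈ S.supp X Y
    · by_cases h1 : p + 1 ∈ S.supp X Y
      · simp [diff, S.sq_zero h0 h1]
      · simp [diff, h1]
    · simp [diff, x.2 h0]
  leibniz {X Y Z q p n q' p' n'} h hq hp hn g f := by
    subst h hq hp hn
    apply Subtype.ext
    by_cases h0 : q ∈ S.supp Y Z
    · by_cases h1 : p ∈ S.supp X Y
      · classical
        have e := congrArg (fun m : ℤ => (m : k) * (g.1 * f.1)) (S.leibniz h0 h1)
        simp only [Set.indicator_apply, Units.smul_def, Pi.one_apply] at e
        change (if q + p + 1 ∈ S.supp X Z then g.1 * f.1 else 0) =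
          (if q + 1 ∈ S.supp Y Z then g.1 else 0) * f.1 +
            q.negOnePow • (g.1 * if p + 1 ∈ S.supp X Y then f.1 else 0)
        rw [Units.smul_def]
        split_ifs at e ⊢ <;> first | simp; done | simpa [add_mul] using e
      · simp [diff, mul, f.2 h1]
    · simp [diff, mul, g.2 h0]
  id_comp _ := Subtype.ext (one_mul _)
  comp_id _ := Subtype.ext (mul_one _)
  assoc _ _ _ _ _ _ _ := Subtype.ext (mul_assoc _ _ _)

/-- The dg functor that is the identity on objects and the inclusion on morphisms. -/
def incl {S T : ScalarData O} (hle : ∀ {X Y p}, p ∈ S.supp X Y → p ∈ T.supp X Y)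
    (hd : ∀ {X Y p}, p ∈ S.supp X Y → p + 1 ∈ T.supp X Y → p + 1 ∈ S.supp X Y) :
    DGFunctor (S.cat k) (T.cat k) where
  obj X := X
  map := Submodule.inclusion fun _ hx h => hx fun h' => h (hle h')
  map_d {X Y} p q h x := by
    subst h
    classical
    apply Subtype.ext
    change (if p + 1 ∈ S.supp X Y then x.1 else 0) = if p + 1 ∈ T.supp X Y then x.1 else 0
    by_cases h0 : p ∈ S.supp X Y
    · by_cases h1 : p + 1 ∈ S.supp X Y
      · rw [if_pos h1, if_pos (hle h1)]
      · rw [if_neg h1, if_neg fun h => h1 (hd h0 h)]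
    · rw [show x.1 = 0 from x.2 h0, ite_self, ite_self]
  map_id _ := rfl
  map_comp _ _ _ := rfl

end ScalarData

/-- The index type of two objects. -/
inductive TwoObj : Type u
  | src
  | tgt

/-- The dg category with two objects such that `Hom src src = Hom tgt tgt = k`, in degree `0`,
`Hom tgt src = 0`, and `Hom src tgt` is `k` in the degrees that belong to `s`, with the identity
as differential between consecutive degrees in `s`. -/
def arrowData (s : Set ℤ) (hs : ∀ p ∈ s, p + 1 ∈ s → p + 1 + 1 ∉ s) :
    ScalarData TwoObj.{u} where
  supp
    | .src, .src => {0}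
    | .tgt, .tgt => {0}
    | .src, .tgt => s
    | .tgt, .src => ∅
  zero_mem X := by cases X <;> rfl
  add_mem {X Y Z q p} hq hp := by
    cases X <;> cases Y <;> cases Z <;> simp_all
  sq_zero {X Y p} h0 h1 := by
    cases X <;> cases Y <;> simp_all
  leibniz {X Y Z q p} hq hp := by
    cases X <;> cases Y <;> cases Z <;> simp_all

variable (k)

/-- The dg category `A` with one object whose endomorphism complex is `k`. -/
def catA : DGCat k :=
  ScalarData.cat k (O := PUnit)
    { supp := fun _ _ => {0}
      zero_mem := fun _ => rfl
      add_mem := fun hq hp => by simp_all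
      sq_zero := fun h0 h1 => by simp_all
      leibniz := fun hq hp => by simp_all }

/-- The dg category `B` with two objects whose endomorphism complexes are `k`, and no other nonzero
morphism. -/
def catB : DGCat k := (arrowData ∅ (by simp)).cat k

/-- The dg category `C(n)`, with `Hom src tgt = S^{n-1} = k[n-1]`: this is `k` in
cohomological degree `1 - n`. -/
def catC (n : ℤ) : DGCat k := (arrowData {1 - n} (by simp)).cat k

/-- The dg category `P(n)`, with `Hom src tgt = Dⁿ`, the cone on the identity of `k[n-1]`:
this is `k` in the cohomological degrees `-n` and `1 - n`, with the identity as differential. -/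
def catP (n : ℤ) : DGCat k := (arrowData {-n, 1 - n} (by simp; lia)).cat k

/-- The dg functor `R(n) : B ⟶ P(n)`. -/
def functorR (n : ℤ) : catB k ⟶ catP k n :=
  ScalarData.incl (fun {X Y p} h => by cases X <;> cases Y <;> simp_all [arrowData])
    (fun {X Y p} h h' => by cases X <;> cases Y <;> simp_all [arrowData])

/-- The dg functor `S(n) : C(n) ⟶ P(n)`. -/
def functorS (n : ℤ) : catC k n ⟶ catP k n :=
  ScalarData.incl (fun {X Y p} h => by cases X <;> cases Y <;> simp_all [arrowData])
    (fun {X Y p} h h' => by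
      cases X <;> cases Y <;> simp_all [arrowData]
      lia)

variable {k}

/-- The linear map from the degree `p` part of the complex `k` to `Hom X X p` that sends `1` to the
identity of `X`. -/
def DGCat.unitMap (D : DGCat k) (X : D.Obj) (a b : (catA k).Obj) (p : ℤ) :
    (catA k).Hom a b p →ₗ[k] D.Hom X X p :=
  if h : p = 0 then
    (LinearMap.toSpanSingleton k (D.Hom X X p) (h ▸ D.id X)).comp (Submodule.subtype _)
  else 0

theorem DGCat.unitMap_zero (D : DGCat k) (X : D.Obj) (a b : (catA k).Obj)
    (x : (catA k).Hom a b 0) : D.unitMap X a b 0 x = x.1 • D.id X := rfl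

theorem catA_eq_zero {a b : (catA k).Obj} {p : ℤ} (hp : p ≠ 0) (x : (catA k).Hom a b p) :
    x = 0 := Subtype.ext (x.2 hp)

/-- The dg functor from `A` to `D` that picks out an object `X` of `D`. -/
def DGCat.pick (D : DGCat k) (X : D.Obj) : catA k ⟶ D where
  obj _ := X
  map {a b p} := D.unitMap X a b p
  map_d p q h x := by
    subst h
    by_cases h0 : p = 0
    · subst h0
      rw [catA_eq_zero (by simp) ((catA k).d 0 (0 + 1) rfl x), D.unitMap_zero, map_zero, map_smul,
        D.d_id, smul_zero]
    · rw [catA_eq_zero h0 x, map_zero, map_zero, map_zero, map_zero]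
  map_id _ := by
    rw [D.unitMap_zero]
    exact one_smul k (D.id X)
  map_comp {_ _ _ q p n} h g f := by
    by_cases hq : q = 0
    · by_cases hp : p = 0
      · subst hq hp
        obtain rfl : n = 0 := by lia
        rw [D.unitMap_zero, D.unitMap_zero, D.unitMap_zero, map_smul, LinearMap.map_smul₂,
          D.id_comp, smul_smul, mul_comm]
        rfl
      · rw [catA_eq_zero hp f]
        simp only [map_zero]
    · rw [catA_eq_zero hq g]
      simp only [map_zero, LinearMap.zero_apply]

/-! ## Dg categories given by generators and relations -/

namespace Presentation

variable {O : Type u}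

variable (k) in
/-- The formal expressions of bidegree `(X, Y, p)` built from a graded quiver `V` by the operations
of a dg category over `k`. -/
inductive Term (V : O → O → ℤ → Type u) : O → O → ℤ → Type u
  | of {X Y : O} {p : ℤ} (v : V X Y p) : Term V X Y p
  | id (X : O) : Term V X X 0
  | comp {X Y Z : O} {q p n : ℤ} (h : q + p = n) (g : Term V Y Z q) (f : Term V X Y p) :
      Term V X Z n
  | d {X Y : O} (p q : ℤ) (h : p + 1 = q) (f : Term V X Y p) : Term V X Y q
  | zero {X Y : O} {p : ℤ} : Term V X Y p
  | add {X Y : O} {p : ℤ} (f g : Term V X Y p) : Term V X Y p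
  | neg {X Y : O} {p : ℤ} (f : Term V X Y p) : Term V X Y p
  | smul {X Y : O} {p : ℤ} (a : k) (f : Term V X Y p) : Term V X Y p

/-- The smallest relation on expressions that contains `R`, is a congruence, and makes the axioms of
a dg category hold. -/
inductive Rel {V : O → O → ℤ → Type u}
    (R : ∀ (X Y : O) (p : ℤ), Term k V X Y p → Term k V X Y p → Prop) :
    ∀ {X Y : O} {p : ℤ}, Term k V X Y p → Term k V X Y p → Prop
  | of {X Y : O} {p : ℤ} {f g : Term k V X Y p} (h : R X Y p f g) : Rel R f g
  | refl {X Y : O} {p : ℤ} (f : Term k V X Y p) : Rel R f f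
  | symm {X Y : O} {p : ℤ} {f g : Term k V X Y p} (h : Rel R f g) : Rel R g f
  | trans {X Y : O} {p : ℤ} {f g e : Term k V X Y p} (h : Rel R f g) (h' : Rel R g e) : Rel R f e
  | comp_congr {X Y Z : O} {q p n : ℤ} (h : q + p = n) {g g' : Term k V Y Z q}
      {f f' : Term k V X Y p} (hg : Rel R g g') (hf : Rel R f f') :
      Rel R (.comp h g f) (.comp h g' f')
  | d_congr {X Y : O} (p q : ℤ) (h : p + 1 = q) {f f' : Term k V X Y p} (hf : Rel R f f') :
      Rel R (.d p q h f) (.d p q h f')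
  | add_congr {X Y : O} {p : ℤ} {f f' g g' : Term k V X Y p} (hf : Rel R f f') (hg : Rel R g g') :
      Rel R (.add f g) (.add f' g')
  | neg_congr {X Y : O} {p : ℤ} {f f' : Term k V X Y p} (hf : Rel R f f') :
      Rel R (.neg f) (.neg f')
  | smul_congr {X Y : O} {p : ℤ} (a : k) {f f' : Term k V X Y p} (hf : Rel R f f') :
      Rel R (.smul a f) (.smul a f')
  | add_assoc {X Y : O} {p : ℤ} (f g e : Term k V X Y p) :
      Rel R (.add (.add f g) e) (.add f (.add g e))
  | add_comm {X Y : O} {p : ℤ} (f g : Term k V X Y p) : Rel R (.add f g) (.add g f)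
  | zero_add {X Y : O} {p : ℤ} (f : Term k V X Y p) : Rel R (.add .zero f) f
  | neg_add {X Y : O} {p : ℤ} (f : Term k V X Y p) : Rel R (.add (.neg f) f) .zero
  | smul_add {X Y : O} {p : ℤ} (a : k) (f g : Term k V X Y p) :
      Rel R (.smul a (.add f g)) (.add (.smul a f) (.smul a g))
  | add_smul {X Y : O} {p : ℤ} (a b : k) (f : Term k V X Y p) :
      Rel R (.smul (a + b) f) (.add (.smul a f) (.smul b f))
  | mul_smul {X Y : O} {p : ℤ} (a b : k) (f : Term k V X Y p) :
      Rel R (.smul (a * b) f) (.smul a (.smul b f))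
  | one_smul {X Y : O} {p : ℤ} (f : Term k V X Y p) : Rel R (.smul 1 f) f
  | d_add {X Y : O} (p q : ℤ) (h : p + 1 = q) (f g : Term k V X Y p) :
      Rel R (.d p q h (.add f g)) (.add (.d p q h f) (.d p q h g))
  | d_smul {X Y : O} (p q : ℤ) (h : p + 1 = q) (a : k) (f : Term k V X Y p) :
      Rel R (.d p q h (.smul a f)) (.smul a (.d p q h f))
  | add_comp {X Y Z : O} {q p n : ℤ} (h : q + p = n) (g g' : Term k V Y Z q) (f : Term k V X Y p) :
      Rel R (.comp h (.add g g') f) (.add (.comp h g f) (.comp h g' f))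
  | smul_comp {X Y Z : O} {q p n : ℤ} (h : q + p = n) (a : k) (g : Term k V Y Z q)
      (f : Term k V X Y p) : Rel R (.comp h (.smul a g) f) (.smul a (.comp h g f))
  | comp_add {X Y Z : O} {q p n : ℤ} (h : q + p = n) (g : Term k V Y Z q) (f f' : Term k V X Y p) :
      Rel R (.comp h g (.add f f')) (.add (.comp h g f) (.comp h g f'))
  | comp_smul {X Y Z : O} {q p n : ℤ} (h : q + p = n) (a : k) (g : Term k V Y Z q)
      (f : Term k V X Y p) : Rel R (.comp h g (.smul a f)) (.smul a (.comp h g f))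
  | d_d {X Y : O} (p q r : ℤ) (h : p + 1 = q) (h' : q + 1 = r) (f : Term k V X Y p) :
      Rel R (.d q r h' (.d p q h f)) .zero
  | leibniz {X Y Z : O} {q p n q' p' n' : ℤ} (h : q + p = n) (hq : q + 1 = q') (hp : p + 1 = p')
      (hn : n + 1 = n') (h₁ : q' + p = n') (h₂ : q + p' = n') (g : Term k V Y Z q)
      (f : Term k V X Y p) :
      Rel R (.d n n' hn (.comp h g f))
        (.add (.comp h₁ (.d q q' hq g) f)
          (.smul ((q.negOnePow : ℤ) : k) (.comp h₂ g (.d p p' hp f))))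
  | id_comp {X Y : O} {p : ℤ} (h : 0 + p = p) (f : Term k V X Y p) : Rel R (.comp h (.id Y) f) f
  | comp_id {X Y : O} {p : ℤ} (h : p + 0 = p) (f : Term k V X Y p) : Rel R (.comp h f (.id X)) f
  | assoc {X Y Z T : O} {r q p rq qp n : ℤ} (h₁ : r + q = rq) (h₂ : q + p = qp)
      (h₃ : rq + p = n) (h₄ : r + qp = n) (c : Term k V Z T r) (g : Term k V Y Z q)
      (f : Term k V X Y p) : Rel R (.comp h₃ (.comp h₁ c g) f) (.comp h₄ c (.comp h₂ g f))

section

variable {V : O → O → ℤ → Type u}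
  (R : ∀ (X Y : O) (p : ℤ), Term k V X Y p → Term k V X Y p → Prop)

/-- The equivalence relation `Rel R` as a setoid. -/
def relSetoid (X Y : O) (p : ℤ) : Setoid (Term k V X Y p) where
  r := Rel R
  iseqv := ⟨.refl, .symm, .trans⟩

/-- The morphisms of degree `p` from `X` to `Y`: expressions modulo `Rel R`. -/
def Hom (X Y : O) (p : ℤ) : Type u := Quotient (relSetoid R X Y p)

variable {R} in
/-- The morphism given by an expression. -/
def mk {X Y : O} {p : ℤ} (f : Term k V X Y p) : Hom R X Y p := Quotient.mk _ f

variable {R} in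
theorem mk_eq {X Y : O} {p : ℤ} {f g : Term k V X Y p} (h : Rel R f g) :
    mk (R := R) f = mk g := Quotient.sound h

variable {R} in
theorem ind {X Y : O} {p : ℤ} {P : Hom R X Y p → Prop} (h : ∀ f, P (mk f)) (x : Hom R X Y p) :
    P x := Quotient.ind h x

instance (X Y : O) (p : ℤ) : Zero (Hom R X Y p) := ⟨mk .zero⟩

instance (X Y : O) (p : ℤ) : Add (Hom R X Y p) :=
  ⟨Quotient.map₂ .add fun _ _ h _ _ h' => .add_congr h h'⟩

instance (X Y : O) (p : ℤ) : Neg (Hom R X Y p) := ⟨Quotient.map .neg fun _ _ h => .neg_congr h⟩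

instance (X Y : O) (p : ℤ) : SMul k (Hom R X Y p) :=
  ⟨fun a => Quotient.map (.smul a) fun _ _ h => .smul_congr a h⟩

instance (X Y : O) (p : ℤ) : AddCommGroup (Hom R X Y p) where
  add_assoc := ind fun f => ind fun g => ind fun e => mk_eq (.add_assoc f g e)
  zero_add := ind fun f => mk_eq (.zero_add f)
  add_zero := ind fun f => mk_eq (.trans (.add_comm _ _) (.zero_add f))
  neg_add_cancel := ind fun f => mk_eq (.neg_add f)
  add_comm := ind fun f => ind fun g => mk_eq (.add_comm f g)
  nsmul := nsmulRec
  zsmul := zsmulRec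

instance (X Y : O) (p : ℤ) : Module k (Hom R X Y p) :=
  Module.ofMinimalAxioms
    (fun a => ind fun f => ind fun g => mk_eq (.smul_add a f g))
    (fun a b => ind fun f => mk_eq (.add_smul a b f))
    (fun a b => ind fun f => mk_eq (.mul_smul a b f))
    (ind fun f => mk_eq (.one_smul f))

/-- The differential. -/
def diff {X Y : O} (p q : ℤ) (h : p + 1 = q) : Hom R X Y p →ₗ[k] Hom R X Y q where
  toFun := Quotient.map (.d p q h) fun _ _ e => .d_congr p q h e
  map_add' := ind fun f => ind fun g => mk_eq (.d_add p q h f g)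
  map_smul' a := ind fun f => mk_eq (.d_smul p q h a f)

/-- The composition. -/
def comp {X Y Z : O} {q p n : ℤ} (h : q + p = n) :
    Hom R Y Z q →ₗ[k] Hom R X Y p →ₗ[k] Hom R X Z n :=
  LinearMap.mk₂ k (Quotient.map₂ (.comp h) fun _ _ e _ _ e' => .comp_congr h e e')
    (ind fun g => ind fun g' => ind fun f => mk_eq (.add_comp h g g' f))
    (fun a => ind fun g => ind fun f => mk_eq (.smul_comp h a g f))
    (ind fun g => ind fun f => ind fun f' => mk_eq (.comp_add h g f f'))
    (fun a => ind fun g => ind fun f => mk_eq (.comp_smul h a g f))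

/-- The dg category generated by the graded quiver `V` subject to the relations `R`. -/
def cat : DGCat k where
  Obj := O
  Hom := Hom R
  d := diff R
  id X := mk (.id X)
  comp := comp R
  d_d p q r h h' := ind fun f => mk_eq (.d_d p q r h h' f)
  leibniz {X Y Z q p n q' p' n'} h hq hp hn := ind fun g => ind fun f => by
    rw [Units.smul_def, ← Int.cast_smul_eq_zsmul k]
    exact mk_eq (.leibniz h hq hp hn _ _ g f)
  id_comp := ind fun f => mk_eq (.id_comp _ f)
  comp_id := ind fun f => mk_eq (.comp_id _ f)
  assoc h₁ h₂ h₃ h₄ := ind fun c => ind fun g => ind fun f => mk_eq (.assoc h₁ h₂ h₃ h₄ c g f)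

end

end Presentation

/-! ### The dg category `K` -/

/-- The generators `f : 1 ⟶ 2` and `g : 2 ⟶ 1` of degree `0`, `r₁ : 1 ⟶ 1` and `r₂ : 2 ⟶ 2` of
degree `-1`, and `r₁₂ : 1 ⟶ 2` of degree `-2`; here `1` is `src` and `2` is `tgt`. -/
inductive KGen : TwoObj.{u} → TwoObj.{u} → ℤ → Type u
  | f : KGen .src .tgt 0
  | g : KGen .tgt .src 0
  | r₁ : KGen .src .src (-1)
  | r₂ : KGen .tgt .tgt (-1)
  | r₁₂ : KGen .src .tgt (-2)

open Presentation in
/-- The relations `df = 0`, `dg = 0`, `dr₁ = gf - 1`, `dr₂ = fg - 1`, `dr₁₂ = f r₁ - r₂ f`. -/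
inductive KRel : ∀ (X Y : TwoObj.{u}) (p : ℤ),
    Term k KGen X Y p → Term k KGen X Y p → Prop
  | d_f : KRel .src .tgt 1 (.d 0 1 (by lia) (.of .f)) .zero
  | d_g : KRel .tgt .src 1 (.d 0 1 (by lia) (.of .g)) .zero
  | d_r₁ : KRel .src .src 0 (.d (-1) 0 (by lia) (.of .r₁))
      (.add (.comp (add_zero 0) (.of .g) (.of .f)) (.neg (.id TwoObj.src)))
  | d_r₂ : KRel .tgt .tgt 0 (.d (-1) 0 (by lia) (.of .r₂))
      (.add (.comp (add_zero 0) (.of .f) (.of .g)) (.neg (.id TwoObj.tgt)))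
  | d_r₁₂ : KRel .src .tgt (-1) (.d (-2) (-1) (by lia) (.of .r₁₂))
      (.add (.comp (zero_add (-1)) (.of .f) (.of .r₁))
        (.neg (.comp (add_zero (-1)) (.of .r₂) (.of .f))))

variable (k)

/-- The dg category `K`. -/
def catK : DGCat k := Presentation.cat (KRel (k := k))

/-- The dg functor `F : A ⟶ K` that sends the object of `A` to the object `1` of `K`. -/
def functorF : catA k ⟶ catK k := (catK k).pick TwoObj.src

/-! ## Generating cofibrations and generating trivial cofibrations -/

/-- The morphism `Q` from the initial object `O` to the dg category obtained from `A` by adding a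
zero object. -/
def morphismQ : initialDGCatp k ⟶ (adjoinZero k).obj (catA k) :=
  (isInitialInitialDGCatp k).to _

/-- The set `I`, which consists of `Q` and the images of the dg functors `S(n)`, `n ∈ ℤ`, in
`DGCatp k`. -/
def generatingCofibrations : MorphismProperty (DGCatp k) :=
  MorphismProperty.ofHoms (fun _ : Unit => morphismQ k) ⊔
    MorphismProperty.ofHoms (fun n : ℤ => (adjoinZero k).map (functorS k n))

/-- The set `J`, which consists of the images of the dg functors `F` and `R(n)`, `n ∈ ℤ`, in
`DGCatp k`. -/
def generatingTrivialCofibrations : MorphismProperty (DGCatp k) :=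
  MorphismProperty.ofHoms (fun _ : Unit => (adjoinZero k).map (functorF k)) ⊔
    MorphismProperty.ofHoms (fun n : ℤ => (adjoinZero k).map (functorR k n))

end

/-! ## The recognition theorem and cofibrantly generated model structures -/

section

variable {C : Type u} [Category.{v} C]

/-- The relative `I`-cell complexes: the transfinite compositions of pushouts of elements of `I`. -/
def relativeCells (I : MorphismProperty C) : MorphismProperty C :=
  MorphismProperty.transfiniteCompositions.{w} I.pushouts

/-- An object `A` is small relative to a class `D` of morphisms if there is a cardinal `κ` such that
`Hom(A, -)` commutes with the colimit of every `l`-sequence all of whose successor morphisms are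
in `D`, for every limit ordinal `l` in which all subsets of cardinality at most `κ` are bounded. -/
def IsSmallRelativeTo (A : C) (D : MorphismProperty C) : Prop :=
  ∃ κ : Cardinal.{w}, ∀ (l : Type w) [LinearOrder l] [SuccOrder l] [OrderBot l] [WellFoundedLT l]
    [NoMaxOrder l], (∀ s : Set l, Cardinal.mk s ≤ κ → BddAbove s) →
    ∀ (X : l ⥤ C) [X.IsWellOrderContinuous],
      (∀ j : l, D (X.map (homOfLE (Order.le_succ j)))) →
      PreservesColimit X (coyoneda.obj (Opposite.op A))

/-- The hypotheses of the recognition theorem for cofibrantly generated model structures, for a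
category `C`, a class `W` of morphisms and two sets `I` and `J` of morphisms. Here `I.rlp` is the
class of `I`-injective morphisms and `I.rlp.llp` is the class of `I`-cofibrations. -/
structure RecognitionConditions (W I J : MorphismProperty C) : Prop where
  hasLimits : HasLimitsOfSize.{w, w} C
  hasColimits : HasColimitsOfSize.{w, w} C
  isSubcategory : W.IsMultiplicative
  isSmall_I : MorphismProperty.IsSmall.{w} I
  isSmall_J : MorphismProperty.IsSmall.{w} J
  twoOutOfThree : W.HasTwoOutOfThreeProperty
  retracts : W.IsStableUnderRetracts
  small_I : ∀ ⦃A B : C⦄ (i : A ⟶ B), I i → IsSmallRelativeTo.{w} A (relativeCells.{w} I)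
  small_J : ∀ ⦃A B : C⦄ (j : A ⟶ B), J j → IsSmallRelativeTo.{w} A (relativeCells.{w} J)
  cell_J : relativeCells.{w} J ≤ W ⊓ I.rlp.llp
  inj_I : I.rlp ≤ W ⊓ J.rlp
  last : W ⊓ I.rlp.llp ≤ J.rlp.llp ∨ W ⊓ J.rlp ≤ I.rlp

/-- A model structure with functorial factorizations is cofibrantly generated by `I` and `J` if `I`
and `J` are sets of morphisms that permit the small object argument, the fibrations are the
`J`-injective morphisms and the trivial fibrations are the `I`-injective morphisms. -/
structure IsCofibrantlyGeneratedBy (C : Type u) [Category.{v} C] [ModelCategory C]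
    (I J : MorphismProperty C) : Prop where
  functorialFactorization₁ :
    MorphismProperty.HasFunctorialFactorization (cofibrations C) (trivialFibrations C)
  functorialFactorization₂ :
    MorphismProperty.HasFunctorialFactorization (trivialCofibrations C) (fibrations C)
  isSmall_I : MorphismProperty.IsSmall.{w} I
  isSmall_J : MorphismProperty.IsSmall.{w} J
  small_I : ∀ ⦃A B : C⦄ (i : A ⟶ B), I i → IsSmallRelativeTo.{w} A (relativeCells.{w} I)
  small_J : ∀ ⦃A B : C⦄ (j : A ⟶ B), J j → IsSmallRelativeTo.{w} A (relativeCells.{w} J)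
  fibrations_eq : fibrations C = J.rlp
  trivialFibrations_eq : trivialFibrations C = I.rlp

end

end

/-! Adding a zero object is left adjoint to forgetting the distinguished one, so lifting against `I`
and `J` is a condition on the underlying dg functor `P`. It is `I`-injective exactly when it is
surjective on objects and solves every problem `d x = c`, `P x = e` with `c` closed, that is, when
it is a surjective quasi-isomorphism on morphism complexes. It is `J`-injective exactly when it is
surjective on morphisms and lifts data `(f, g, r₁, r₂, r₁₂)` whose first object is already lifted.

The usefulness of `K` rests on two facts. A closed `f` with a homotopy inverse `g` always extends to
such data (`KData.exists_of_areInverse`). Two data with the same `f` differ by a perturbation whose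
parameters are arbitrary morphisms (`KData.eq_perturb`): the data itself contracts the complex of
deviations. The first fact, together with lifting the generators of `K` one after the other, gives
`I`-inj = `W` ∩ `J`-inj (`rlp_generatingCofibrations`). Both facts together show that a dg functor
surjective on morphisms lifts `K`-data as soon as it lifts homotopy equivalences
(`DGFunctor.SurjectiveOnHoms.liftsKData`).

That `J`-cofibrations are quasi-equivalences is not proved by analysing pushouts, but by Quillen's
path object argument. Every object is `J`-fibrant, and `B` has a path object whose objects are the
homotopy invertible morphisms of `B` and whose morphisms are squares with a homotopy; its map to `B
× B` is `J`-injective and its evaluations are quasi-equivalences. A `J`-cofibration `j` then has a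
retraction `r` such that `r ≫ j` is right homotopic to the identity, so `r ≫ j` is in `W`, and `j`
is a retract of `r ≫ j`. The retract argument turns this into `W` ∩ `I`-cof = `J`-cof
(`quasiEquivalences_inf_llp_rlp_generatingCofibrations`).

Colimits are built by generators and relations, which says little about their elements. For directed
colimits, mapping into a dg category of germs shows that elements identified in the colimit are
identified at some stage, and a dg subcategory argument shows that every element comes from a stage
(`stage_surjective`). Hence the domains of `I` and `J` are finitely presented, which gives smallness
and the small object argument at `ℵ₀`. -/

noncomputable section

variable {k : Type u} [CommRing k]

/-! ## Transport of morphisms along equalities of objects -/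

namespace DGCat

/-- The transport of morphisms along equalities of objects. -/
def castHom (C : DGCat k) {X X' Y Y' : C.Obj} (hX : X = X') (hY : Y = Y') (p : ℤ) :
    C.Hom X Y p ≃ₗ[k] C.Hom X' Y' p :=
  match X', Y', hX, hY with
  | _, _, rfl, rfl => LinearEquiv.refl k _

variable (C : DGCat k)

theorem castHom_heq {X X' Y Y' : C.Obj} (hX : X = X') (hY : Y = Y') {p : ℤ} (f : C.Hom X Y p) :
    C.castHom hX hY p f ≍ f := by
  subst hX hY; rfl

theorem castHom_zero {X X' Y Y' : C.Obj} (hX : X = X') (hY : Y = Y') (p : ℤ) :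
    C.castHom hX hY p 0 = 0 := map_zero _

@[simp]
theorem castHom_castHom {X X' X'' Y Y' Y'' : C.Obj} (hX : X = X') (hX' : X' = X'') (hY : Y = Y')
    (hY' : Y' = Y'') {p : ℤ} (f : C.Hom X Y p) :
    C.castHom hX' hY' p (C.castHom hX hY p f) = C.castHom (hX.trans hX') (hY.trans hY') p f := by
  subst hX hX' hY hY'; rfl

theorem castHom_d {X X' Y Y' : C.Obj} (hX : X = X') (hY : Y = Y') (p q : ℤ) (h : p + 1 = q)
    (f : C.Hom X Y p) :
    C.castHom hX hY q (C.d p q h f) = C.d p q h (C.castHom hX hY p f) := by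
  subst hX hY; rfl

theorem castHom_id {X X' : C.Obj} (hX : X = X') :
    C.castHom hX hX 0 (C.id X) = C.id X' := by
  subst hX; rfl

theorem castHom_comp {X X' Y Y' Z Z' : C.Obj} (hX : X = X') (hY : Y = Y') (hZ : Z = Z')
    {q p n : ℤ} (h : q + p = n) (g : C.Hom Y Z q) (f : C.Hom X Y p) :
    C.castHom hX hZ n (C.comp h g f) = C.comp h (C.castHom hY hZ q g) (C.castHom hX hY p f) := by
  subst hX hY hZ; rfl

end DGCat

namespace DGFunctor

variable {C D E : DGCat k}

theorem map_zero (F : DGFunctor C D) (X Y : C.Obj) (p : ℤ) :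
    F.map (0 : C.Hom X Y p) = 0 := _root_.map_zero _

theorem map_add (F : DGFunctor C D) {X Y : C.Obj} {p : ℤ} (f g : C.Hom X Y p) :
    F.map (f + g) = F.map f + F.map g := _root_.map_add _ _ _

theorem map_neg (F : DGFunctor C D) {X Y : C.Obj} {p : ℤ} (f : C.Hom X Y p) :
    F.map (-f) = -F.map f := _root_.map_neg _ _

theorem map_smul (F : DGFunctor C D) {X Y : C.Obj} {p : ℤ} (a : k) (f : C.Hom X Y p) :
    F.map (a • f) = a • F.map f := _root_.map_smul _ _ _

theorem map_castHom (F : DGFunctor C D) {X X' Y Y' : C.Obj} (hX : X = X') (hY : Y = Y') {p : ℤ}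
    (f : C.Hom X Y p) :
    F.map (C.castHom hX hY p f) = D.castHom (congrArg F.obj hX) (congrArg F.obj hY) p (F.map f) := by
  subst hX hY; rfl

theorem obj_of_eq {F G : DGFunctor C D} (h : F = G) (X : C.Obj) : F.obj X = G.obj X := by rw [h]

/-- Equal dg functors have equal values on objects only propositionally. An equation of dg functors
is therefore always used through this transported form, and proved through its converse
`ext_of_castHom`. -/
theorem map_of_eq {F G : DGFunctor C D} (h : F = G) {X Y : C.Obj} {p : ℤ} (f : C.Hom X Y p) :
    D.castHom (obj_of_eq h X) (obj_of_eq h Y) p (F.map f) = G.map f := by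
  subst h; rfl

theorem ext_of_castHom {F G : DGFunctor C D} (hobj : ∀ X, F.obj X = G.obj X)
    (hmap : ∀ (X Y : C.Obj) (p : ℤ) (f : C.Hom X Y p),
      D.castHom (hobj X) (hobj Y) p (F.map f) = G.map f) : F = G :=
  ext_of_heq hobj fun X Y p f => (D.castHom_heq (hobj X) (hobj Y) _).symm.trans
    (heq_of_eq (hmap X Y p f))

end DGFunctor

/-! ## Adding a zero object is left adjoint to forgetting the distinguished object -/

namespace DGCatp

/-- The equation `h` is an argument so that the lemma applies to objects, such as images of the
distinguished object, that are not syntactically `D.pt`. -/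
theorem hom_zero_left (D : DGCatp k) {X Y : D.cat.Obj} (h : X = D.pt) {p : ℤ} (f g : D.cat.Hom X Y p) :
    f = g := by
  subst h
  exact (D.isZeroObject _ _).1.elim _ _

theorem hom_zero_right (D : DGCatp k) {X Y : D.cat.Obj} (h : Y = D.pt) {p : ℤ} (f g : D.cat.Hom X Y p) :
    f = g := by
  subst h
  exact (D.isZeroObject _ _).2.elim _ _

variable (k) in
/-- The functor that forgets the distinguished zero object. -/
def forget : DGCatp k ⥤ DGCat k where
  obj C := C.cat
  map F := F.functor

theorem hom_ext {C D : DGCatp k} {F G : C ⟶ D} (h : F.functor = G.functor) : F = G :=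
  DGCatp.Functor.ext h

end DGCatp

namespace AdjoinZero

/-- The inclusion of a dg category into the dg category with an added zero object. -/
def inclusion (C : DGCat k) : C ⟶ cat C where
  obj := some
  map := LinearMap.id
  map_d _ _ _ _ := rfl
  map_id _ := rfl
  map_comp _ _ _ := rfl

/-- The extension of a dg functor to the dg category with an added zero object. -/
def extend {C : DGCat k} {D : DGCatp k} (F : C ⟶ D.cat) : (adjoinZero k).obj C ⟶ D where
  functor :=
    { obj := fun X => match X with
        | some X => F.obj X
        | none => D.pt
      map := fun {X Y} {p} => match X, Y with
        | some X, some Y => F.map (X := X) (Y := Y) (p := p)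
        | some _, none => 0
        | none, _ => 0
      map_d := fun {X Y} p q h f => match X, Y with
        | some X, some Y => F.map_d (X := X) (Y := Y) p q h f
        | some _, none => D.hom_zero_right rfl _ _
        | none, _ => D.hom_zero_left rfl _ _
      map_id := fun X => match X with
        | some X => F.map_id X
        | none => D.hom_zero_right rfl _ _
      map_comp := fun {X Y Z} {_ _ n} h g f => match X, Y, Z with
        | some X, some Y, some Z => F.map_comp (X := X) (Y := Y) (Z := Z) h g f
        | some X, some _, none => D.hom_zero_right rfl _ _
        | some X, none, none => D.hom_zero_right rfl _ _
        | some X, none, some Z => by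
            change F.map (0 : C.Hom X Z n) = D.cat.comp h 0 0
            simp
        | none, _, Z => D.hom_zero_left rfl _ _ }
  obj_pt := rfl

/-- The added object has a forced image, and morphisms to or from it have values in zero modules, so
a morphism is determined by its restriction to `C`. -/
theorem ext_inclusion {C : DGCat k} {D : DGCatp k} {F G : (adjoinZero k).obj C ⟶ D}
    (h : inclusion C ≫ (DGCatp.forget k).map F = inclusion C ≫ (DGCatp.forget k).map G) : F = G := by
  have hpt : F.functor.obj none = G.functor.obj none := F.obj_pt.trans G.obj_pt.symm
  have hobj : ∀ X, F.functor.obj X = G.functor.obj X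
    | some X => DGFunctor.obj_of_eq h X
    | none => hpt
  refine DGCatp.hom_ext (DGFunctor.ext_of_castHom hobj fun X Y p f => ?_)
  match X, Y with
  | some X, some Y => exact DGFunctor.map_of_eq h f
  | some X, none => exact D.hom_zero_right G.obj_pt _ _
  | none, _ => exact D.hom_zero_left G.obj_pt _ _

variable (k) in
/-- Adding a zero object is left adjoint to the forgetful functor. -/
def adjunction : adjoinZero k ⊣ DGCatp.forget k :=
  Adjunction.mkOfHomEquiv
    { homEquiv := fun C _ =>
        { toFun := fun F => inclusion C ≫ (DGCatp.forget k).map F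
          invFun := extend
          left_inv := fun _ => ext_inclusion rfl
          right_inv := fun _ => rfl }
      homEquiv_naturality_left_symm := fun _ _ => ext_inclusion rfl
      homEquiv_naturality_right := fun _ _ => rfl }

end AdjoinZero

/-! ## Dg subcategories -/

/-- Objects and submodules of morphisms of a dg category that form a dg subcategory. -/
structure DGCat.Sub (C : DGCat k) : Type u where
  obj : Set C.Obj
  hom : ∀ (X Y : C.Obj) (p : ℤ), Submodule k (C.Hom X Y p)
  d_mem : ∀ {X Y : C.Obj} (p q : ℤ) (h : p + 1 = q) (f : C.Hom X Y p), f ∈ hom X Y p →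
    C.d p q h f ∈ hom X Y q
  id_mem : ∀ X ∈ obj, C.id X ∈ hom X X 0
  -- The submodules are given for all pairs of objects, but closure under composition is required
  -- only when the middle object belongs to `obj`: in `limitSub` and `stageSub` the two factors are
  -- compared through that object.
  comp_mem : ∀ {X Y Z : C.Obj} {q p n : ℤ} (h : q + p = n) (g : C.Hom Y Z q) (f : C.Hom X Y p),
    Y ∈ obj → g ∈ hom Y Z q → f ∈ hom X Y p → C.comp h g f ∈ hom X Z n

namespace DGCat.Sub

variable {C : DGCat k} (S : C.Sub)

/-- The dg subcategory as a dg category. -/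
def cat : DGCat k where
  Obj := S.obj
  Hom X Y p := S.hom X Y p
  d p q h := (C.d p q h).restrict (S.d_mem p q h)
  id X := ⟨C.id X, S.id_mem X X.2⟩
  comp {X Y Z} {q p n} h := LinearMap.mk₂ k
    (fun g f => ⟨C.comp h g.1 f.1, S.comp_mem h g.1 f.1 Y.2 g.2 f.2⟩)
    (fun _ _ _ => Subtype.ext (by simp)) (fun _ _ _ => Subtype.ext (by simp))
    (fun _ _ _ => Subtype.ext (by simp)) (fun _ _ _ => Subtype.ext (by simp))
  d_d p q r h h' f := Subtype.ext (C.d_d p q r h h' f.1)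
  leibniz h hq hp hn g f := Subtype.ext (C.leibniz h hq hp hn g.1 f.1)
  id_comp f := Subtype.ext (C.id_comp f.1)
  comp_id f := Subtype.ext (C.comp_id f.1)
  assoc h₁ h₂ h₃ h₄ c g f := Subtype.ext (C.assoc h₁ h₂ h₃ h₄ c.1 g.1 f.1)

/-- The inclusion of a dg subcategory. -/
def ι : S.cat ⟶ C where
  obj X := X.1
  map := Submodule.subtype _
  map_d _ _ _ _ := rfl
  map_id _ := rfl
  map_comp _ _ _ := rfl

/-- A dg functor with values in a dg subcategory. -/
def lift {D : DGCat k} (F : D ⟶ C) (hobj : ∀ X, F.obj X ∈ S.obj)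
    (hmap : ∀ {X Y : D.Obj} {p : ℤ} (f : D.Hom X Y p), F.map f ∈ S.hom _ _ p) : D ⟶ S.cat where
  obj X := ⟨F.obj X, hobj X⟩
  map := F.map.codRestrict _ hmap
  map_d p q h f := Subtype.ext (F.map_d p q h f)
  map_id X := Subtype.ext (F.map_id X)
  map_comp h g f := Subtype.ext (F.map_comp h g f)

theorem hom_ext {D : DGCat k} {F G : D ⟶ S.cat} (h : F ≫ S.ι = G ≫ S.ι) : F = G := by
  refine DGFunctor.ext_of_castHom (fun X => Subtype.ext (DGFunctor.obj_of_eq h X))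
    fun X Y p f => Subtype.ext ?_
  exact (S.ι.map_castHom _ _ (F.map f)).trans (DGFunctor.map_of_eq h f)

end DGCat.Sub

/-- A dg subcategory that contains the distinguished zero object, as a dg category with a
distinguished zero object. -/
def DGCatp.sub (C : DGCatp k) (S : C.cat.Sub) (h : C.pt ∈ S.obj) : DGCatp k :=
  ⟨S.cat, ⟨C.pt, h⟩, fun _ _ => ⟨⟨fun _ _ => Subtype.ext (C.hom_zero_left rfl _ _)⟩,
    ⟨fun _ _ => Subtype.ext (C.hom_zero_right rfl _ _)⟩⟩⟩

/-! ## The universal property of a dg category given by generators and relations -/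

namespace Presentation

variable {O : Type u} {V : O → O → ℤ → Type u}

/-- The value of an expression in a dg category `D`, given the values of the generators. -/
def Term.eval (D : DGCat k) (o : O → D.Obj) (v : ∀ {X Y : O} {p : ℤ}, V X Y p → D.Hom (o X) (o Y) p) :
    ∀ {X Y : O} {p : ℤ}, Term k V X Y p → D.Hom (o X) (o Y) p
  | _, _, _, .of w => v w
  | _, _, _, .id X => D.id (o X)
  | _, _, _, .comp h g f => D.comp h (eval D o v g) (eval D o v f)
  | _, _, _, .d p q h f => D.d p q h (eval D o v f)
  | _, _, _, .zero => 0
  | _, _, _, .add f g => eval D o v f + eval D o v g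
  | _, _, _, .neg f => - eval D o v f
  | _, _, _, .smul a f => a • eval D o v f

variable {R : ∀ (X Y : O) (p : ℤ), Term k V X Y p → Term k V X Y p → Prop}

theorem Rel.eval_eq {D : DGCat k} {o : O → D.Obj}
    {v : ∀ {X Y : O} {p : ℤ}, V X Y p → D.Hom (o X) (o Y) p}
    (hR : ∀ {X Y : O} {p : ℤ} {f g : Term k V X Y p}, R X Y p f g → f.eval D o v = g.eval D o v)
    {X Y : O} {p : ℤ} {f g : Term k V X Y p} (h : Rel R f g) : f.eval D o v = g.eval D o v := by
  induction h with
  | of h => exact hR h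
  | refl f => rfl
  | symm _ ih => exact ih.symm
  | trans _ _ ih ih' => exact ih.trans ih'
  | comp_congr h _ _ ih ih' => simp only [Term.eval, ih, ih']
  | d_congr p q h _ ih => simp only [Term.eval, ih]
  | add_congr _ _ ih ih' => simp only [Term.eval, ih, ih']
  | neg_congr _ ih => simp only [Term.eval, ih]
  | smul_congr a _ ih => simp only [Term.eval, ih]
  | add_assoc f g e => exact _root_.add_assoc _ _ _
  | add_comm f g => exact _root_.add_comm _ _
  | zero_add f => exact _root_.zero_add _
  | neg_add f => exact neg_add_cancel _
  | smul_add a f g => exact _root_.smul_add _ _ _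
  | add_smul a b f => exact _root_.add_smul _ _ _
  | mul_smul a b f => exact SemigroupAction.mul_smul _ _ _
  | one_smul f => exact _root_.one_smul _ _
  | d_add p q h f g => exact map_add _ _ _
  | d_smul p q h a f => exact map_smul _ _ _
  | add_comp h g g' f => simp only [Term.eval, map_add, LinearMap.add_apply]
  | smul_comp h a g f => simp only [Term.eval, map_smul, LinearMap.smul_apply]
  | comp_add h g f f' => exact map_add _ _ _
  | comp_smul h a g f => exact map_smul _ _ _
  | d_d p q r h h' f => exact D.d_d p q r h h' _
  | leibniz h hq hp hn h₁ h₂ g f =>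
    refine (D.leibniz h hq hp hn _ _).trans ?_
    simp only [Term.eval, Units.smul_def, Int.cast_smul_eq_zsmul]
  | id_comp h f => exact D.id_comp _
  | comp_id h f => exact D.comp_id _
  | assoc h₁ h₂ h₃ h₄ c g f => exact D.assoc h₁ h₂ h₃ h₄ _ _ _

/-- The dg functor on a presented dg category with given values on the generators. -/
def lift {D : DGCat k} (o : O → D.Obj) (v : ∀ {X Y : O} {p : ℤ}, V X Y p → D.Hom (o X) (o Y) p)
    (hR : ∀ {X Y : O} {p : ℤ} {f g : Term k V X Y p}, R X Y p f g → f.eval D o v = g.eval D o v) :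
    cat R ⟶ D where
  obj := o
  map {X Y p} :=
    { toFun := Quotient.lift (fun f : Term k V X Y p => f.eval D o v) fun _ _ h => Rel.eval_eq hR h
      map_add' := ind fun _ => ind fun _ => rfl
      map_smul' := fun _ => ind fun _ => rfl }
  map_d _ _ _ := ind fun _ => rfl
  map_id _ := rfl
  map_comp _ := ind fun _ => ind fun _ => rfl

variable (R) in
/-- The morphism given by an expression, in the presented dg category. -/
def homMk {X Y : O} {p : ℤ} (f : Term k V X Y p) : (cat R).Hom X Y p := mk f

theorem hom_ext {D : DGCat k} {F G : cat R ⟶ D} (hobj : ∀ X : O, F.obj X = G.obj X)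
    (hmap : ∀ {X Y : O} {p : ℤ} (w : V X Y p),
      D.castHom (hobj X) (hobj Y) p (F.map (homMk R (.of w))) = G.map (homMk R (.of w))) :
    F = G := by
  suffices h : ∀ {X Y : O} {p : ℤ} (f : Term k V X Y p),
      D.castHom (hobj X) (hobj Y) p (F.map (homMk R f)) = G.map (homMk R f) from
    DGFunctor.ext_of_castHom hobj fun X Y p => ind fun f => h f
  intro X Y p f
  induction f with
  | of w => exact hmap w
  | id X =>
    exact (congrArg _ (F.map_id X)).trans ((D.castHom_id _).trans (G.map_id X).symm)
  | comp h g f ihg ihf =>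
    exact (congrArg _ (F.map_comp h (homMk R g) (homMk R f))).trans
      ((D.castHom_comp _ (hobj _) _ h _ _).trans ((congrArg₂ (fun a b => D.comp h a b) ihg ihf).trans
        (G.map_comp h (homMk R g) (homMk R f)).symm))
  | d p q h f ih =>
    exact (congrArg _ (F.map_d p q h (homMk R f))).trans ((D.castHom_d _ _ p q h _).trans
      ((congrArg (D.d p q h) ih).trans (G.map_d p q h (homMk R f)).symm))
  | zero =>
    exact (congrArg _ (F.map_zero _ _ _)).trans ((map_zero _).trans (G.map_zero _ _ _).symm)
  | add f g ihf ihg =>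
    exact (congrArg _ (F.map_add (homMk R f) (homMk R g))).trans ((map_add _ _ _).trans
      ((congrArg₂ (· + ·) ihf ihg).trans (G.map_add (homMk R f) (homMk R g)).symm))
  | neg f ih =>
    exact (congrArg _ (F.map_neg (homMk R f))).trans ((map_neg _ _).trans
      ((congrArg (- ·) ih).trans (G.map_neg (homMk R f)).symm))
  | smul a f ih =>
    exact (congrArg _ (F.map_smul a (homMk R f))).trans ((map_smul _ _ _).trans
      ((congrArg (a • ·) ih).trans (G.map_smul a (homMk R f)).symm))

end Presentation

/-! ## Dg functors on the dg categories `A`, `B`, `C(n)`, `P(n)` -/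

namespace ScalarData

variable {O : Type u} (S : ScalarData O)

variable (k) in
/-- An object of the dg category defined by `S`. -/
def mkObj (X : O) : (S.cat k).Obj := X

variable (k) in
/-- The morphism `1` in a degree of the support. -/
def one {X Y : O} {p : ℤ} (h : p ∈ S.supp X Y) : (S.cat k).Hom (S.mkObj k X) (S.mkObj k Y) p := ⟨1, fun h' => absurd h h'⟩

open Classical in
theorem d_one {X Y : O} {p q : ℤ} (h : p + 1 = q) (hp : p ∈ S.supp X Y) :
    (S.cat k).d p q h (S.one k hp) = if hq : q ∈ S.supp X Y then S.one k hq else 0 := by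
  apply Subtype.ext
  by_cases hq : q ∈ S.supp X Y
  · rw [dif_pos hq]
    exact if_pos hq
  · rw [dif_neg hq]
    exact if_neg hq

open Classical in
/-- The dg functor given by the images of the objects and of the morphisms `1`. -/
def functor {D : DGCat k} (o : O → D.Obj) (e : ∀ (X Y : O) (p : ℤ), D.Hom (o X) (o Y) p)
    (he_id : ∀ X, e X X 0 = D.id (o X))
    (he_d : ∀ {X Y : O} {p : ℤ} (q : ℤ) (h : p + 1 = q), p ∈ S.supp X Y →
      D.d p q h (e X Y p) = if q ∈ S.supp X Y then e X Y q else 0)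
    (he_comp : ∀ {X Y Z : O} {q p : ℤ}, q ∈ S.supp Y Z → p ∈ S.supp X Y →
      D.comp rfl (e Y Z q) (e X Y p) = e X Z (q + p)) : S.cat k ⟶ D where
  obj := o
  map {X Y p} := (LinearMap.toSpanSingleton k _ (e X Y p)).comp (Submodule.subtype _)
  map_d {X Y} p q h f := by
    change (if q ∈ S.supp X Y then f.1 else 0) • e X Y q = D.d p q h (f.1 • e X Y p)
    by_cases hp : p ∈ S.supp X Y
    · rw [map_smul, he_d q h hp]
      split_ifs <;> simp
    · rw [f.2 hp]
      simp
  map_id X := (one_smul k _).trans (he_id X)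
  map_comp {X Y Z q p n} h g f := by
    subst h
    change (g.1 * f.1) • e X Z (q + p) = D.comp rfl (g.1 • e Y Z q) (f.1 • e X Y p)
    by_cases hq : q ∈ S.supp Y Z
    · by_cases hp : p ∈ S.supp X Y
      · rw [map_smul, LinearMap.map_smul₂, he_comp hq hp, smul_smul, mul_comm]
      · rw [f.2 hp]
        simp
    · rw [g.2 hq]
      simp

/-- In each degree the module of morphisms is zero or free on the morphism `1`. -/
theorem hom_ext {D : DGCat k} {F G : S.cat k ⟶ D} (hobj : ∀ X : O, F.obj (S.mkObj k X) = G.obj (S.mkObj k X))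
    (hmap : ∀ {X Y : O} {p : ℤ} (h : p ∈ S.supp X Y),
      D.castHom (hobj X) (hobj Y) p (F.map (S.one k h)) = G.map (S.one k h)) : F = G := by
  suffices h : ∀ (X Y : O) (p : ℤ) (f : (S.cat k).Hom (S.mkObj k X) (S.mkObj k Y) p),
      D.castHom (hobj X) (hobj Y) p (F.map f) = G.map f from
    DGFunctor.ext_of_castHom hobj h
  intro X Y p f
  by_cases hp : p ∈ S.supp X Y
  · have hf : f = (f.1 : k) • S.one k hp := Subtype.ext (mul_one f.1).symm
    rw [hf, F.map_smul, G.map_smul, map_smul, hmap hp]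
  · have hf : f = 0 := Subtype.ext (f.2 hp)
    rw [hf, F.map_zero, G.map_zero, map_zero]

end ScalarData

namespace DGCat

/-- The family of morphisms that is `f` in one degree and zero in the others. -/
def single (D : DGCat k) {X Y : D.Obj} {m : ℤ} (f : D.Hom X Y m) (p : ℤ) : D.Hom X Y p :=
  if h : m = p then h ▸ f else 0

@[simp]
theorem single_self (D : DGCat k) {X Y : D.Obj} {m : ℤ} (f : D.Hom X Y m) : D.single f m = f := by
  simp [single]

end DGCat

theorem catA_hom_ext {D : DGCat k} {F G : catA k ⟶ D} (h : F.obj PUnit.unit = G.obj PUnit.unit) :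
    F = G := by
  refine ScalarData.hom_ext _ (fun _ => h) fun {X Y p} hp => ?_
  obtain rfl : p = 0 := hp
  exact (congrArg _ (F.map_id PUnit.unit)).trans ((D.castHom_id h).trans
    (G.map_id PUnit.unit).symm)

namespace ArrowCat

variable {s : Set ℤ} {hs : ∀ p ∈ s, p + 1 ∈ s → p + 1 + 1 ∉ s}

/-- The function on the two objects with values `X` and `Y`. -/
def obj {α : Type*} (X Y : α) : TwoObj.{u} → α
  | .src => X
  | .tgt => Y

/-- The morphisms that are the images of `1` under a dg functor on the dg category with two
objects. -/
def homFamily {D : DGCat k} {X Y : D.Obj} (e : ∀ p, D.Hom X Y p) :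
    ∀ (a b : TwoObj.{u}) (p : ℤ), D.Hom (obj X Y a) (obj X Y b) p
  | .src, .src, p => D.single (D.id X) p
  | .tgt, .tgt, p => D.single (D.id Y) p
  | .src, .tgt, p => e p
  | .tgt, .src, _ => 0

open Classical in
/-- The dg functor given by a family of morphisms from `X` to `Y`. -/
def functor {D : DGCat k} (X Y : D.Obj) (e : ∀ p, D.Hom X Y p)
    (he : ∀ {p : ℤ} (q : ℤ) (h : p + 1 = q), p ∈ s → D.d p q h (e p) = if q ∈ s then e q else 0) :
    (arrowData.{u} s hs).cat k ⟶ D :=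
  (arrowData s hs).functor (obj X Y) (homFamily e)
    (fun a => by cases a <;> exact D.single_self _)
    (fun {a b p} q h hp => by
      cases a <;> cases b
      · obtain rfl : p = 0 := hp
        subst h
        refine ((congrArg _ (D.single_self _)).trans (D.d_id _ _ _)).trans (if_neg ?_).symm
        exact one_ne_zero (α := ℤ)
      · exact he q h hp
      · exact hp.elim
      · obtain rfl : p = 0 := hp
        subst h
        refine ((congrArg _ (D.single_self _)).trans (D.d_id _ _ _)).trans (if_neg ?_).symm
        exact one_ne_zero (α := ℤ))
    (fun {a b c q p} hq hp => by
      have key : ∀ (T : D.Obj) {Z : D.Obj} (x : ∀ p, D.Hom Z T p) (p : ℤ),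
          D.comp rfl (D.single (D.id T) 0) (x p) = x (0 + p) := by
        intro T Z x p
        rw [D.single_self]
        -- The degrees `0 + p` and `p` are not definitionally equal, so the target degree is
        -- generalised before it is identified with `p`.
        have : ∀ (m : ℤ) (h : 0 + p = m), D.comp h (D.id T) (x p) = x m := by
          intro m h
          obtain rfl : p = m := by lia
          exact D.id_comp _
        exact this _ _
      have key' : ∀ (T : D.Obj) {Z : D.Obj} (x : ∀ p, D.Hom T Z p) (p : ℤ),
          D.comp rfl (x p) (D.single (D.id T) 0) = x (p + 0) := by
        intro T Z x p
        rw [D.single_self]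
        have : ∀ (m : ℤ) (h : p + 0 = m), D.comp h (x p) (D.id T) = x m := by
          intro m h
          obtain rfl : p = m := by lia
          exact D.comp_id _
        exact this _ _
      cases a <;> cases b <;> cases c
      · obtain rfl : q = 0 := hq
        exact key X (D.single (D.id X)) p
      · obtain rfl : p = 0 := hp
        exact key' X e q
      · exact hq.elim
      · obtain rfl : q = 0 := hq
        exact key Y e p
      · exact hp.elim
      · exact hp.elim
      · exact hq.elim
      · obtain rfl : q = 0 := hq
        exact key Y (D.single (D.id Y)) p)

/-- The first object. -/
def src : ((arrowData.{u} s hs).cat k).Obj := TwoObj.src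

/-- The second object. -/
def tgt : ((arrowData.{u} s hs).cat k).Obj := TwoObj.tgt

/-- The morphism `1` from the first object to the second one. -/
def one {p : ℤ} (h : p ∈ s) : ((arrowData.{u} s hs).cat k).Hom src tgt p :=
  (arrowData s hs).one k (X := .src) (Y := .tgt) h

theorem hom_ext {D : DGCat k} {F G : (arrowData.{u} s hs).cat k ⟶ D}
    (h₁ : F.obj src = G.obj src) (h₂ : F.obj tgt = G.obj tgt)
    (h : ∀ {p : ℤ} (hp : p ∈ s), D.castHom h₁ h₂ p (F.map (one hp)) = G.map (one hp)) : F = G := by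
  have hobj : ∀ X : TwoObj, F.obj ((arrowData s hs).mkObj k X) = G.obj ((arrowData s hs).mkObj k X) :=
    fun X => by cases X <;> assumption
  have hid : ∀ (X : ((arrowData.{u} s hs).cat k).Obj) (h : F.obj X = G.obj X),
      D.castHom h h 0 (F.map (((arrowData.{u} s hs).cat k).id X)) =
        G.map (((arrowData.{u} s hs).cat k).id X) := fun X h => by
    rw [F.map_id, G.map_id, D.castHom_id]
  refine ScalarData.hom_ext _ hobj fun {X Y p} hp => ?_
  cases X <;> cases Y
  · obtain rfl : p = 0 := hp
    exact hid _ h₁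
  · exact h hp
  · exact hp.elim
  · obtain rfl : p = 0 := hp
    exact hid _ h₂

end ArrowCat

/-- The first object of `B`. -/
def catB.src : (catB k).Obj := TwoObj.src

/-- The second object of `B`. -/
def catB.tgt : (catB k).Obj := TwoObj.tgt

/-- The dg functor on `B` given by two objects. -/
def catB.functor {D : DGCat k} (X Y : D.Obj) : catB k ⟶ D :=
  ArrowCat.functor X Y 0 fun _ _ h => h.elim

theorem catB.hom_ext {D : DGCat k} {F G : catB k ⟶ D}
    (h₁ : F.obj catB.src = G.obj catB.src) (h₂ : F.obj catB.tgt = G.obj catB.tgt) : F = G :=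
  ArrowCat.hom_ext h₁ h₂ fun hp => hp.elim

/-- The first object of `C(n)`. -/
def catC.src (n : ℤ) : (catC k n).Obj := TwoObj.src

/-- The second object of `C(n)`. -/
def catC.tgt (n : ℤ) : (catC k n).Obj := TwoObj.tgt

/-- The generating morphism of `C(n)`. -/
def catC.gen (n : ℤ) : (catC k n).Hom (catC.src n) (catC.tgt n) (1 - n) := ArrowCat.one rfl

theorem catC.d_gen (n q : ℤ) (h : 1 - n + 1 = q) : (catC k n).d (1 - n) q h (catC.gen n) = 0 := by
  classical
  refine (ScalarData.d_one (arrowData {1 - n} (by simp)) (X := .src) (Y := .tgt) h rfl).trans (dif_neg ?_)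
  change q ∉ ({1 - n} : Set ℤ)
  rw [Set.mem_singleton_iff]
  lia

/-- The dg functor on `C(n)` given by a cocycle. -/
def catC.functor {D : DGCat k} {X Y : D.Obj} {n : ℤ} (c : D.Hom X Y (1 - n))
    (hc : D.d (1 - n) (1 - n + 1) rfl c = 0) : catC k n ⟶ D :=
  ArrowCat.functor X Y (D.single c) (by
    intro p q h hp
    obtain rfl : p = 1 - n := hp
    subst h
    rw [D.single_self, hc, if_neg]
    rw [Set.mem_singleton_iff]
    lia)

theorem catC.functor_map_gen {D : DGCat k} {X Y : D.Obj} {n : ℤ} (c : D.Hom X Y (1 - n))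
    (hc : D.d (1 - n) (1 - n + 1) rfl c = 0) :
    DGFunctor.map (catC.functor c hc) (catC.gen n) = c :=
  (one_smul k (D.single c (1 - n))).trans (D.single_self c)

theorem catC.hom_ext {D : DGCat k} {n : ℤ} {F G : catC k n ⟶ D}
    (h₁ : F.obj (catC.src n) = G.obj (catC.src n)) (h₂ : F.obj (catC.tgt n) = G.obj (catC.tgt n))
    (h : D.castHom h₁ h₂ _ (F.map (catC.gen n)) = G.map (catC.gen n)) : F = G :=
  ArrowCat.hom_ext h₁ h₂ fun {p} hp => by
    obtain rfl : p = 1 - n := hp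
    exact h

/-- The first object of `P(n)`. -/
def catP.src (n : ℤ) : (catP k n).Obj := TwoObj.src

/-- The second object of `P(n)`. -/
def catP.tgt (n : ℤ) : (catP k n).Obj := TwoObj.tgt

/-- The generating morphism of `P(n)`. -/
def catP.gen (n : ℤ) : (catP k n).Hom (catP.src n) (catP.tgt n) (-n) := ArrowCat.one (Or.inl rfl)

/-- The dg functor on `P(n)` given by a morphism. -/
def catP.functor {D : DGCat k} {X Y : D.Obj} {n : ℤ} (e : D.Hom X Y (-n)) : catP k n ⟶ D :=
  ArrowCat.functor X Y
    -- The image of the contractible complex `Dⁿ` is `e` in degree `-n` and `d e` in degree `1 - n`.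
    (fun p => D.single e p + if h : -n + 1 = p then D.d (-n) p h e else 0) fun {p} q h hp => by
    have h1 : ∀ p, -n ≠ p → D.single e p = 0 := fun p hp => dif_neg hp
    rcases hp with hp | hp
    · subst hp h
      have hm : -n + 1 ∈ ({-n, 1 - n} : Set ℤ) := Or.inr (by simp; lia)
      rw [D.single_self, dif_neg (by lia), add_zero, if_pos hm, dif_pos rfl, h1 _ (by lia),
        zero_add]
    · obtain rfl : p = 1 - n := hp
      have hm : q ∉ ({-n, 1 - n} : Set ℤ) := by simp; lia
      rw [h1 _ (by lia), zero_add, dif_pos (by lia), D.d_d, if_neg hm]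

theorem catP.functor_map_gen {D : DGCat k} {X Y : D.Obj} {n : ℤ} (e : D.Hom X Y (-n)) :
    DGFunctor.map (catP.functor e) (catP.gen n) = e := by
  refine (one_smul k (D.single e (-n) + if h : -n + 1 = -n then D.d (-n) (-n) h e else 0)).trans ?_
  rw [D.single_self, dif_neg (by lia), add_zero]

theorem catP.d_gen (n : ℤ) : (catP k n).d (-n) (1 - n) (by lia) (catP.gen n) =
    DGFunctor.map (functorS k n) (catC.gen n) := by
  classical
  exact (ScalarData.d_one _ _ (Or.inl rfl)).trans (dif_pos (Or.inr rfl))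

/-- The morphism `1` of degree `1 - n` is the differential of the one of degree `-n`, so agreement
on the latter suffices. -/
theorem catP.hom_ext {D : DGCat k} {n : ℤ} {F G : catP k n ⟶ D}
    (h₁ : F.obj (catP.src n) = G.obj (catP.src n)) (h₂ : F.obj (catP.tgt n) = G.obj (catP.tgt n))
    (h : D.castHom h₁ h₂ _ (F.map (catP.gen n)) = G.map (catP.gen n)) : F = G :=
  ArrowCat.hom_ext h₁ h₂ fun {p} hp => by
    rcases hp with hp | hp
    · subst hp
      exact h
    · obtain rfl : p = 1 - n := hp
      have e : D.castHom h₁ h₂ _ (F.map ((catP k n).d (-n) (1 - n) (by lia) (catP.gen n))) =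
          G.map ((catP k n).d (-n) (1 - n) (by lia) (catP.gen n)) := by
        rw [F.map_d, G.map_d, D.castHom_d, h]
      rw [catP.d_gen] at e
      exact e

/-! ## Dg functors on the dg category `K` -/

/-- The data in a dg category that correspond to a dg functor on `K`. -/
@[ext]
structure KData (D : DGCat k) (X Y : D.Obj) : Type u where
  f : D.Hom X Y 0
  g : D.Hom Y X 0
  r₁ : D.Hom X X (-1)
  r₂ : D.Hom Y Y (-1)
  r₁₂ : D.Hom X Y (-2)
  d_f : D.d 0 1 (by lia) f = 0
  d_g : D.d 0 1 (by lia) g = 0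
  d_r₁ : D.d (-1) 0 (by lia) r₁ = D.comp (add_zero 0) g f + -D.id X
  d_r₂ : D.d (-1) 0 (by lia) r₂ = D.comp (add_zero 0) f g + -D.id Y
  d_r₁₂ : D.d (-2) (-1) (by lia) r₁₂ =
    D.comp (zero_add (-1)) f r₁ + -D.comp (add_zero (-1)) r₂ f

namespace KData

variable {C D : DGCat k}

/-- The image under a dg functor. -/
def map (F : DGFunctor C D) {X Y : C.Obj} (a : KData C X Y) : KData D (F.obj X) (F.obj Y) where
  f := F.map a.f
  g := F.map a.g
  r₁ := F.map a.r₁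
  r₂ := F.map a.r₂
  r₁₂ := F.map a.r₁₂
  d_f := by rw [← F.map_d, a.d_f, F.map_zero]
  d_g := by rw [← F.map_d, a.d_g, F.map_zero]
  d_r₁ := by rw [← F.map_d, a.d_r₁, F.map_add, F.map_neg, F.map_comp, F.map_id]
  d_r₂ := by rw [← F.map_d, a.d_r₂, F.map_add, F.map_neg, F.map_comp, F.map_id]
  d_r₁₂ := by rw [← F.map_d, a.d_r₁₂, F.map_add, F.map_neg, F.map_comp, F.map_comp]

/-- Transport along equalities of objects. -/
def cast {X X' Y Y' : D.Obj} (hX : X = X') (hY : Y = Y') (a : KData D X Y) : KData D X' Y' :=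
  match X', Y', hX, hY with
  | _, _, rfl, rfl => a

/-- The data given by the identity of an object. -/
def refl (X : D.Obj) : KData D X X where
  f := D.id X
  g := D.id X
  r₁ := 0
  r₂ := 0
  r₁₂ := 0
  d_f := D.d_id X _ _
  d_g := D.d_id X _ _
  d_r₁ := by rw [D.id_comp, map_zero, add_neg_cancel]
  d_r₂ := by rw [D.id_comp, map_zero, add_neg_cancel]
  d_r₁₂ := by simp

variable (k) in
/-- The first object of `K`. -/
def src : (catK k).Obj := TwoObj.src

variable (k) in
/-- The second object of `K`. -/
def tgt : (catK k).Obj := TwoObj.tgt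

variable (k) in
/-- The universal data, in `K`. -/
def univ : KData (catK k) (src k) (tgt k) where
  f := Presentation.homMk _ (.of .f)
  g := Presentation.homMk _ (.of .g)
  r₁ := Presentation.homMk _ (.of .r₁)
  r₂ := Presentation.homMk _ (.of .r₂)
  r₁₂ := Presentation.homMk _ (.of .r₁₂)
  d_f := Presentation.mk_eq (.of .d_f)
  d_g := Presentation.mk_eq (.of .d_g)
  d_r₁ := Presentation.mk_eq (.of .d_r₁)
  d_r₂ := Presentation.mk_eq (.of .d_r₂)
  d_r₁₂ := Presentation.mk_eq (.of .d_r₁₂)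

/-- The images of the generators of `K`. -/
def gens {X Y : D.Obj} (a : KData D X Y) : ∀ {s t : TwoObj.{u}} {p : ℤ},
    KGen s t p → D.Hom (ArrowCat.obj X Y s) (ArrowCat.obj X Y t) p
  | _, _, _, .f => a.f
  | _, _, _, .g => a.g
  | _, _, _, .r₁ => a.r₁
  | _, _, _, .r₂ => a.r₂
  | _, _, _, .r₁₂ => a.r₁₂

/-- The dg functor on `K` given by the images of the generators. -/
def functor {X Y : D.Obj} (a : KData D X Y) : catK k ⟶ D :=
  Presentation.lift (ArrowCat.obj X Y) a.gens fun h => by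
    cases h
    · exact a.d_f
    · exact a.d_g
    · exact a.d_r₁
    · exact a.d_r₂
    · exact a.d_r₁₂

theorem hom_ext {F G : catK k ⟶ D} (h₁ : F.obj (src k) = G.obj (src k))
    (h₂ : F.obj (tgt k) = G.obj (tgt k))
    (h : ((univ k).map F).cast h₁ h₂ = (univ k).map G) : F = G := by
  have key : ∀ {X X' Y Y' : D.Obj} (hX : X = X') (hY : Y = Y') (a : KData D X Y) (b : KData D X' Y'),
      a.cast hX hY = b → D.castHom hX hY _ a.f = b.f ∧ D.castHom hY hX _ a.g = b.g ∧
        D.castHom hX hX _ a.r₁ = b.r₁ ∧ D.castHom hY hY _ a.r₂ = b.r₂ ∧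
        D.castHom hX hY _ a.r₁₂ = b.r₁₂ := by
    rintro X _ Y _ rfl rfl a _ rfl
    exact ⟨rfl, rfl, rfl, rfl, rfl⟩
  obtain ⟨hf, hg, hr₁, hr₂, hr₁₂⟩ := key _ _ _ _ h
  refine Presentation.hom_ext (fun X => by cases X <;> assumption) fun w => ?_
  cases w
  · exact hf
  · exact hg
  · exact hr₁
  · exact hr₂
  · exact hr₁₂

end KData

/-! ## Limits -/

namespace DGCat

variable {ι : Type u} (D : ι → DGCat k)

/-- The product of a family of dg categories. -/
def pi : DGCat k where
  Obj := ∀ i, (D i).Obj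
  Hom X Y p := ∀ i, (D i).Hom (X i) (Y i) p
  d p q h := LinearMap.pi fun i => ((D i).d p q h).comp (LinearMap.proj i)
  id X i := (D i).id (X i)
  comp h := LinearMap.mk₂ k (fun g f i => (D i).comp h (g i) (f i))
    (fun _ _ _ => funext fun _ => by simp) (fun _ _ _ => funext fun _ => by simp)
    (fun _ _ _ => funext fun _ => by simp) (fun _ _ _ => funext fun _ => by simp)
  d_d p q r h h' f := funext fun i => (D i).d_d p q r h h' (f i)
  leibniz h hq hp hn g f := funext fun i => (D i).leibniz h hq hp hn (g i) (f i)
  id_comp f := funext fun i => (D i).id_comp (f i)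
  comp_id f := funext fun i => (D i).comp_id (f i)
  assoc h₁ h₂ h₃ h₄ c g f := funext fun i => (D i).assoc h₁ h₂ h₃ h₄ (c i) (g i) (f i)

/-- The projections of the product. -/
def piProj (i : ι) : pi D ⟶ D i where
  obj X := X i
  map :=
    { toFun := fun f => f i
      map_add' := fun _ _ => rfl
      map_smul' := fun _ _ => rfl }
  map_d _ _ _ _ := rfl
  map_id _ := rfl
  map_comp _ _ _ := rfl

variable {D}

/-- The dg functor to the product given by its components. -/
def piLift {C : DGCat k} (F : ∀ i, C ⟶ D i) : C ⟶ pi D where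
  obj X i := (F i).obj X
  map := LinearMap.pi fun i => (F i).map
  map_d p q h f := funext fun i => (F i).map_d p q h f
  map_id X := funext fun i => (F i).map_id X
  map_comp h g f := funext fun i => (F i).map_comp h g f

variable (D) in
theorem castHom_pi {X X' Y Y' : (pi D).Obj} (hX : X = X') (hY : Y = Y') {p : ℤ}
    (f : (pi D).Hom X Y p) (i : ι) :
    (pi D).castHom hX hY p f i = (D i).castHom (congrFun hX i) (congrFun hY i) p (f i) := by
  subst hX hY; rfl

theorem pi_hom_ext {C : DGCat k} {F G : C ⟶ pi D} (h : ∀ i, F ≫ piProj D i = G ≫ piProj D i) :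
    F = G := by
  refine DGFunctor.ext_of_castHom (fun X => funext fun i => DGFunctor.obj_of_eq (h i) X)
    fun X Y p f => funext fun i => ?_
  exact (castHom_pi D _ _ _ i).trans (DGFunctor.map_of_eq (h i) f)

end DGCat

namespace DGCatp

/-- The product of a family of dg categories with a distinguished zero object. -/
def pi {ι : Type u} (D : ι → DGCatp k) : DGCatp k :=
  ⟨DGCat.pi fun i => (D i).cat, fun i => (D i).pt, fun _ _ =>
    ⟨⟨fun _ _ => funext fun i => (D i).hom_zero_left rfl _ _⟩,
      ⟨fun _ _ => funext fun i => (D i).hom_zero_right rfl _ _⟩⟩⟩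

variable {J : Type u} [SmallCategory J] (F : J ⥤ DGCatp k)

/-- The families of objects and of morphisms that are compatible with the maps of a diagram. -/
def limitSub : (pi F.obj).cat.Sub where
  obj := {X : ∀ j, (F.obj j).cat.Obj | ∀ ⦃i j : J⦄ (φ : i ⟶ j),
    (F.map φ).functor.obj (X i) = X j}
  -- Compatibility of morphisms is stated under the equations `hX` and `hY`, so that the submodule
  -- makes sense for all families of objects; for compatible families the equations hold.
  hom X Y p :=
    { carrier := {f : ∀ j, (F.obj j).cat.Hom (X j) (Y j) p | ∀ ⦃i j : J⦄ (φ : i ⟶ j)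
        (hX : (F.map φ).functor.obj (X i) = X j) (hY : (F.map φ).functor.obj (Y i) = Y j),
        (F.obj j).cat.castHom hX hY p ((F.map φ).functor.map (f i)) = f j}
      zero_mem' := fun i j φ hX hY => (congrArg _ (DGFunctor.map_zero _ _ _ _)).trans (map_zero _)
      add_mem' := fun {f g} hf hg i j φ hX hY =>
        (congrArg _ (DGFunctor.map_add _ (f i) (g i))).trans ((map_add _ _ _).trans
          (congrArg₂ (· + ·) (hf φ hX hY) (hg φ hX hY)))
      smul_mem' := fun a f hf i j φ hX hY =>
        (congrArg _ (DGFunctor.map_smul _ a (f i))).trans ((map_smul _ _ _).trans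
          (congrArg (a • ·) (hf φ hX hY))) }
  d_mem p q h f hf i j φ hX hY :=
    (congrArg _ (DGFunctor.map_d _ p q h (f i))).trans ((DGCat.castHom_d _ hX hY p q h _).trans
      (congrArg _ (hf φ hX hY)))
  id_mem X _ i j φ hX hY :=
    (congrArg _ (DGFunctor.map_id _ (X i))).trans (DGCat.castHom_id _ hX)
  comp_mem {X Y Z q p n} h g f hY hg hf i j φ hX hZ :=
    (congrArg _ (DGFunctor.map_comp _ h (g i) (f i))).trans
      ((DGCat.castHom_comp _ hX (hY φ) hZ h _ _).trans
        (congrArg₂ (fun a b => (F.obj j).cat.comp h a b) (hg φ (hY φ) hZ) (hf φ hX (hY φ))))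

/-- The limit of a diagram. -/
def limitObj : DGCatp k := (pi F.obj).sub (limitSub F) fun _ _ φ => (F.map φ).obj_pt

/-- The limit cone of a diagram. -/
def limitCone : Cone F where
  pt := limitObj F
  π :=
    { app := fun j =>
        { functor := (limitSub F).ι ≫ DGCat.piProj (fun i => (F.obj i).cat) j
          obj_pt := by rfl }
      naturality := fun i j φ => hom_ext (DGFunctor.ext_of_castHom (C := (limitSub F).cat)
        (fun X => X.2 φ) fun X Y p f => f.2 φ (X.2 φ) (Y.2 φ)).symm }

/-- The cone `limitCone` is a limit cone. -/
def isLimitLimitCone : IsLimit (limitCone F) where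
  lift s :=
    { functor := (limitSub F).lift
        (DGCat.piLift (D := fun j => (F.obj j).cat) fun j => (s.π.app j).functor)
        (fun X i j φ => DGFunctor.obj_of_eq (congrArg Functor.functor (s.w φ)) X)
        (fun f i j φ _ _ => DGFunctor.map_of_eq (congrArg Functor.functor (s.w φ)) f)
      obj_pt := Subtype.ext (funext fun j => (s.π.app j).obj_pt) }
  fac s j := rfl
  uniq s m hm := hom_ext (DGCat.Sub.hom_ext _ (DGCat.pi_hom_ext fun j =>
    congrArg Functor.functor (hm j)))

instance hasLimits : HasLimitsOfSize.{u, u} (DGCatp k) where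
  has_limits_of_shape _ _ := ⟨fun F => ⟨⟨⟨limitCone F, isLimitLimitCone F⟩⟩⟩⟩

end DGCatp

/-! ## Colimits -/

namespace DGCatp

namespace Colim

open Presentation

variable {J : Type u} [SmallCategory J] (F : J ⥤ DGCatp k)

/-- The identifications between the objects of the dg categories in a diagram; `none` stands for the
distinguished zero object of the colimit. -/
inductive ObjRel : Option (Σ j, (F.obj j).cat.Obj) → Option (Σ j, (F.obj j).cat.Obj) → Prop
  | pt (j : J) : ObjRel none (some ⟨j, (F.obj j).pt⟩)
  | map {i j : J} (φ : i ⟶ j) (a : (F.obj i).cat.Obj) :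
      ObjRel (some ⟨i, a⟩) (some ⟨j, (F.map φ).functor.obj a⟩)

/-- The objects of the colimit. -/
def Obj : Type u := Quot (ObjRel F)

variable {F}

/-- The object of the colimit given by an object of a dg category in the diagram. -/
def cls {j : J} (a : (F.obj j).cat.Obj) : Obj F := Quot.mk _ (some ⟨j, a⟩)

theorem cls_map {i j : J} (φ : i ⟶ j) (a : (F.obj i).cat.Obj) :
    cls ((F.map φ).functor.obj a) = cls a := (Quot.sound (ObjRel.map φ a)).symm

variable (F) in
/-- The generators of the colimit: the morphisms of the dg categories in the diagram. -/
structure Gen (X Y : Obj F) (p : ℤ) : Type u where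
  j : J
  a : (F.obj j).cat.Obj
  b : (F.obj j).cat.Obj
  f : (F.obj j).cat.Hom a b p
  -- The ends enter through equations, so that morphisms from different stages, whose objects become
  -- identified only in the quotient, are generators of one graded quiver.
  ha : cls a = X
  hb : cls b = Y

/-- The generator given by a morphism, as an expression. -/
abbrev tm {X Y : Obj F} {p : ℤ} {j : J} {a b : (F.obj j).cat.Obj} (ha : cls a = X) (hb : cls b = Y)
    (f : (F.obj j).cat.Hom a b p) : Term k (Gen F) X Y p := .of ⟨j, a, b, f, ha, hb⟩

variable (F) in
/-- The relations of the colimit. -/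
inductive Rels : ∀ (X Y : Obj F) (p : ℤ), Term k (Gen F) X Y p → Term k (Gen F) X Y p → Prop
  | add {X Y : Obj F} {p : ℤ} {j : J} {a b : (F.obj j).cat.Obj} (ha : cls a = X) (hb : cls b = Y)
      (f g : (F.obj j).cat.Hom a b p) :
      Rels X Y p (tm ha hb (f + g)) (.add (tm ha hb f) (tm ha hb g))
  | smul {X Y : Obj F} {p : ℤ} {j : J} {a b : (F.obj j).cat.Obj} (ha : cls a = X) (hb : cls b = Y)
      (c : k) (f : (F.obj j).cat.Hom a b p) :
      Rels X Y p (tm ha hb (c • f)) (.smul c (tm ha hb f))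
  | d {X Y : Obj F} {p q : ℤ} (h : p + 1 = q) {j : J} {a b : (F.obj j).cat.Obj} (ha : cls a = X)
      (hb : cls b = Y) (f : (F.obj j).cat.Hom a b p) :
      Rels X Y q (tm ha hb ((F.obj j).cat.d p q h f)) (.d p q h (tm ha hb f))
  | id {X : Obj F} {j : J} {a : (F.obj j).cat.Obj} (ha : cls a = X) :
      Rels X X 0 (tm ha ha ((F.obj j).cat.id a)) (.id X)
  | comp {X Y Z : Obj F} {q p n : ℤ} (h : q + p = n) {j : J} {a b c : (F.obj j).cat.Obj}
      (ha : cls a = X) (hb : cls b = Y) (hc : cls c = Z) (g : (F.obj j).cat.Hom b c q)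
      (f : (F.obj j).cat.Hom a b p) :
      Rels X Z n (tm ha hc ((F.obj j).cat.comp h g f)) (.comp h (tm hb hc g) (tm ha hb f))
  | map {X Y : Obj F} {p : ℤ} {i j : J} (φ : i ⟶ j) {a b : (F.obj i).cat.Obj} (ha : cls a = X)
      (hb : cls b = Y) (f : (F.obj i).cat.Hom a b p) :
      Rels X Y p (tm ((cls_map φ a).trans ha) ((cls_map φ b).trans hb) ((F.map φ).functor.map f))
        (tm ha hb f)
  -- Killing this identity makes `none` a zero object; the extra object provides a distinguished
  -- point even for the empty diagram.
  | pt : Rels (Quot.mk _ none) (Quot.mk _ none) 0 (.id _) .zero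

variable (F) in
/-- The colimit, as a dg category. -/
def cat : DGCat k := Presentation.cat (Rels F)

/-- The object of the colimit given by an object of a dg category in the diagram. -/
def mkObj {j : J} (a : (F.obj j).cat.Obj) : (cat F).Obj := cls a

/-- The morphism of the colimit given by a morphism of a dg category in the diagram. -/
def mkHom {X Y : (cat F).Obj} {p : ℤ} {j : J} {a b : (F.obj j).cat.Obj} (ha : mkObj a = X)
    (hb : mkObj b = Y) (f : (F.obj j).cat.Hom a b p) : (cat F).Hom X Y p :=
  homMk (Rels F) (tm ha hb f)

theorem castHom_mkHom {X X' Y Y' : (cat F).Obj} {p : ℤ} (hX : X = X') (hY : Y = Y') {j : J}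
    {a b : (F.obj j).cat.Obj} (ha : mkObj a = X) (hb : mkObj b = Y)
    (f : (F.obj j).cat.Hom a b p) :
    (cat F).castHom hX hY p (mkHom ha hb f) = mkHom (ha.trans hX) (hb.trans hY) f := by
  subst hX hY; rfl

variable (F) in
/-- The distinguished zero object of the colimit. -/
def catPt : (cat F).Obj := Quot.mk _ none

theorem id_catPt : (cat F).id (catPt F) = 0 :=
  mk_eq (R := Rels F) (Rel.of Rels.pt)

variable (F) in
/-- The colimit. -/
def pt : DGCatp k where
  cat := cat F
  pt := catPt F
  isZeroObject := by
    refine fun X p => ⟨⟨fun f g => ?_⟩, ⟨fun f g => ?_⟩⟩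
    · rw [← (cat F).comp_id f, ← (cat F).comp_id g, id_catPt, map_zero, map_zero]
    · rw [← (cat F).id_comp f, ← (cat F).id_comp g, id_catPt, map_zero]
      rfl

/-- The dg functors from the dg categories in the diagram to the colimit. -/
def ιFunctor (j : J) : (F.obj j).cat ⟶ cat F where
  obj a := mkObj a
  map {a b} p :=
    { toFun := fun f => mkHom rfl rfl f
      map_add' := fun f g => mk_eq (R := Rels F) (Rel.of (Rels.add rfl rfl f g))
      map_smul' := fun c f => mk_eq (R := Rels F) (Rel.of (Rels.smul rfl rfl c f)) }
  map_d p q h f := mk_eq (R := Rels F) (Rel.of (Rels.d h rfl rfl f))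
  map_id a := mk_eq (R := Rels F) (Rel.of (Rels.id rfl))
  map_comp h g f := mk_eq (R := Rels F) (Rel.of (Rels.comp h rfl rfl rfl g f))

/-- The morphisms from the objects of the diagram to the colimit. -/
def ι (j : J) : F.obj j ⟶ pt F where
  functor := ιFunctor j
  obj_pt := (Quot.sound (ObjRel.pt j)).symm

theorem castHom_mkHom_map {i j : J} (φ : i ⟶ j) {a b : (F.obj i).cat.Obj} {p : ℤ}
    (f : (F.obj i).cat.Hom a b p) :
    (cat F).castHom (cls_map φ a) (cls_map φ b) p (mkHom rfl rfl ((F.map φ).functor.map f)) =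
      mkHom rfl rfl f :=
  (castHom_mkHom _ _ rfl rfl _).trans (mk_eq (R := Rels F) (Rel.of (Rels.map φ rfl rfl f)))

variable (F) in
/-- The colimit cocone. -/
def cocone : Cocone F where
  pt := pt F
  ι :=
    { app := ι
      naturality := fun i j φ => hom_ext (DGFunctor.ext_of_castHom (fun a => cls_map φ a)
        fun a b p f => castHom_mkHom_map φ f) }

/-- The action on objects of the dg functor given by a cocone. -/
def descObj (s : Cocone F) : Obj F → s.pt.cat.Obj :=
  Quot.lift (fun x => match x with
    | none => s.pt.pt
    | some x => (s.ι.app x.1).functor.obj x.2) (by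
    rintro _ _ (j | ⟨φ, a⟩)
    · exact (s.ι.app j).obj_pt.symm
    · exact (DGFunctor.obj_of_eq (congrArg Functor.functor (s.w φ)) a).symm)

/-- The action on generators of the dg functor given by a cocone. -/
def descGen (s : Cocone F) {X Y : Obj F} {p : ℤ} (x : Gen F X Y p) :
    s.pt.cat.Hom (descObj s X) (descObj s Y) p :=
  s.pt.cat.castHom (congrArg (descObj s) x.ha) (congrArg (descObj s) x.hb) p
    ((s.ι.app x.j).functor.map x.f)

theorem descGen_rel (s : Cocone F) {X Y : Obj F} {p : ℤ} {f g : Term k (Gen F) X Y p}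
    (h : Rels F X Y p f g) :
    f.eval s.pt.cat (descObj s) (descGen s) = g.eval s.pt.cat (descObj s) (descGen s) := by
  induction h with
  | add ha hb f g => subst ha hb; exact DGFunctor.map_add _ _ _
  | smul ha hb c f => subst ha hb; exact DGFunctor.map_smul _ _ _
  | d h ha hb f => subst ha hb; exact DGFunctor.map_d _ _ _ _ _
  | id ha => subst ha; exact DGFunctor.map_id _ _
  | comp h ha hb hc g f => subst ha hb hc; exact DGFunctor.map_comp _ _ _ _
  | map φ ha hb f =>
    subst ha hb
    exact DGFunctor.map_of_eq (congrArg Functor.functor (s.w φ)) f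
  | pt => exact s.pt.hom_zero_left rfl _ _

variable (F) in
/-- The cocone `cocone` is a colimit cocone. -/
def isColimit : IsColimit (cocone F) where
  desc s :=
    { functor := lift (descObj s) (descGen s) (descGen_rel s)
      obj_pt := rfl }
  fac s j := rfl
  uniq s m hm := by
    have hobj : ∀ X : Obj F, m.functor.obj X = descObj s X := by
      rintro ⟨_ | ⟨j, a⟩⟩
      · exact m.obj_pt
      · exact DGFunctor.obj_of_eq (congrArg Functor.functor (hm j)) a
    refine hom_ext (Presentation.hom_ext hobj fun w => ?_)
    obtain ⟨j, a, b, f, rfl, rfl⟩ := w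
    exact DGFunctor.map_of_eq (congrArg Functor.functor (hm j)) f

end Colim

instance hasColimits : HasColimitsOfSize.{u, u} (DGCatp k) where
  has_colimits_of_shape _ _ := ⟨fun F => ⟨⟨⟨Colim.cocone F, Colim.isColimit F⟩⟩⟩⟩

end DGCatp

/-! ## Reduced products -/

namespace DGCat

/-- A dg ideal of a dg category. -/
structure Ideal (C : DGCat k) : Type u where
  hom : ∀ (X Y : C.Obj) (p : ℤ), Submodule k (C.Hom X Y p)
  d_mem : ∀ {X Y : C.Obj} (p q : ℤ) (h : p + 1 = q) (f : C.Hom X Y p), f ∈ hom X Y p →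
    C.d p q h f ∈ hom X Y q
  comp_mem_left : ∀ {X Y Z : C.Obj} {q p n : ℤ} (h : q + p = n) (g : C.Hom Y Z q) (f : C.Hom X Y p),
    g ∈ hom Y Z q → C.comp h g f ∈ hom X Z n
  comp_mem_right : ∀ {X Y Z : C.Obj} {q p n : ℤ} (h : q + p = n) (g : C.Hom Y Z q)
    (f : C.Hom X Y p), f ∈ hom X Y p → C.comp h g f ∈ hom X Z n

namespace Ideal

variable {C : DGCat k} (I : C.Ideal)

/-- The composition in the quotient by a dg ideal. -/
def comp {X Y Z : C.Obj} {q p n : ℤ} (h : q + p = n) :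
    (C.Hom Y Z q ⧸ I.hom Y Z q) →ₗ[k] (C.Hom X Y p ⧸ I.hom X Y p) →ₗ[k]
      (C.Hom X Z n ⧸ I.hom X Z n) :=
  (I.hom Y Z q).liftQ
    { toFun := fun g => Submodule.mapQ _ _ (C.comp h g) fun f hf => I.comp_mem_right h g f hf
      map_add' := fun g g' => Submodule.linearMap_qext _ (LinearMap.ext fun f =>
        congrArg Submodule.Quotient.mk (LinearMap.congr_fun (map_add (C.comp h) g g') f))
      map_smul' := fun a g => Submodule.linearMap_qext _ (LinearMap.ext fun f =>
        congrArg Submodule.Quotient.mk (LinearMap.congr_fun (map_smul (C.comp h) a g) f)) }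
    fun g hg => Submodule.linearMap_qext _ (LinearMap.ext fun f =>
      (Submodule.Quotient.mk_eq_zero _).2 (I.comp_mem_left h g f hg))

/-- The quotient by a dg ideal, pulled back along a map of objects. -/
def quotient {O : Type u} (o : O → C.Obj) : DGCat k where
  Obj := O
  Hom X Y p := C.Hom (o X) (o Y) p ⧸ I.hom (o X) (o Y) p
  d p q h := Submodule.mapQ _ _ (C.d p q h) fun f hf => I.d_mem p q h f hf
  id X := Submodule.Quotient.mk (C.id (o X))
  comp h := I.comp h
  d_d p q r h h' f := by
    obtain ⟨f, rfl⟩ := Submodule.Quotient.mk_surjective _ f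
    exact congrArg Submodule.Quotient.mk (C.d_d p q r h h' f)
  leibniz h hq hp hn g f := by
    obtain ⟨f, rfl⟩ := Submodule.Quotient.mk_surjective _ f
    obtain ⟨g, rfl⟩ := Submodule.Quotient.mk_surjective _ g
    refine (congrArg Submodule.Quotient.mk (C.leibniz h hq hp hn g f)).trans ?_
    rw [Units.smul_def, Units.smul_def, Submodule.Quotient.mk_add]
    rfl
  id_comp f := by
    obtain ⟨f, rfl⟩ := Submodule.Quotient.mk_surjective _ f
    exact congrArg Submodule.Quotient.mk (C.id_comp f)
  comp_id f := by
    obtain ⟨f, rfl⟩ := Submodule.Quotient.mk_surjective _ f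
    exact congrArg Submodule.Quotient.mk (C.comp_id f)
  assoc h₁ h₂ h₃ h₄ c g f := by
    obtain ⟨f, rfl⟩ := Submodule.Quotient.mk_surjective _ f
    obtain ⟨g, rfl⟩ := Submodule.Quotient.mk_surjective _ g
    obtain ⟨c, rfl⟩ := Submodule.Quotient.mk_surjective _ c
    exact congrArg Submodule.Quotient.mk (C.assoc h₁ h₂ h₃ h₄ c g f)

variable {O : Type u} {o : O → C.Obj}

/-- The class of a morphism in the quotient. -/
def homMk {X Y : O} {p : ℤ} (f : C.Hom (o X) (o Y) p) : (I.quotient o).Hom X Y p :=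
  Submodule.Quotient.mk f

theorem homMk_surjective {X Y : O} {p : ℤ} (f : (I.quotient o).Hom X Y p) :
    ∃ f', I.homMk f' = f := Submodule.Quotient.mk_surjective _ f

theorem homMk_eq_iff {X Y : O} {p : ℤ} {f g : C.Hom (o X) (o Y) p} :
    I.homMk f = I.homMk g ↔ f - g ∈ I.hom (o X) (o Y) p := Submodule.Quotient.eq _

end Ideal

/-- The dg ideal of the families of morphisms that are eventually zero. -/
def eventuallyZero {ι : Type u} (φ : Filter ι) (D : ι → DGCat k) : (pi D).Ideal where
  hom X Y p :=
    { carrier := {f : ∀ i, (D i).Hom (X i) (Y i) p | ∀ᶠ i in φ, f i = 0}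
      zero_mem' := Filter.Eventually.of_forall fun _ => rfl
      add_mem' := fun {f g} hf hg => by
        filter_upwards [hf, hg] with i hi hi'
        exact (congrArg₂ (· + ·) hi hi').trans (add_zero 0)
      smul_mem' := fun a f hf => by
        filter_upwards [hf] with i hi
        exact (congrArg (a • ·) hi).trans (smul_zero a) }
  d_mem p q h f hf := by
    filter_upwards [hf] with i hi
    exact (congrArg ((D i).d p q h) hi).trans (map_zero _)
  comp_mem_left h g f hg := by
    filter_upwards [hg] with i hi
    exact (congrArg (fun x => (D i).comp h x (f i)) hi).trans (by simp)
  comp_mem_right h g f hf := by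
    filter_upwards [hf] with i hi
    exact (congrArg (fun x => (D i).comp h (g i) x) hi).trans (map_zero _)

end DGCat

namespace DGCatp

namespace Germ

variable {l : Type u} [Preorder l] (X : l ⥤ DGCatp k)

/-- The transition functors of a diagram indexed by a preorder. -/
abbrev tr {i j : l} (h : i ≤ j) : (X.obj i).cat ⟶ (X.obj j).cat := (X.map (homOfLE h)).functor

theorem tr_tr {i j m : l} (h : i ≤ j) (h' : j ≤ m) : tr X h ≫ tr X h' = tr X (h.trans h') := by
  have : X.map (homOfLE (h.trans h')) = X.map (homOfLE h) ≫ X.map (homOfLE h') := by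
    rw [← X.map_comp]; rfl
  exact (congrArg Functor.functor this).symm

theorem tr_obj_tr {i j m : l} (h : i ≤ j) (h' : j ≤ m) (a : (X.obj i).cat.Obj) :
    (tr X h').obj ((tr X h).obj a) = (tr X (h.trans h')).obj a :=
  DGFunctor.obj_of_eq (tr_tr X h h') a

theorem tr_obj_pt {i j : l} (h : i ≤ j) : (tr X h).obj (X.obj i).pt = (X.obj j).pt :=
  (X.map (homOfLE h)).obj_pt

/-- The objects of the reduced product: families of objects up to eventual equality. -/
abbrev Obj : Type u := Quotient (Filter.atTop.productSetoid fun j => (X.obj j).cat.Obj)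

/-- The dg category of germs of families of morphisms. -/
def cat : DGCat k :=
  -- A germ of objects has no canonical family behind it, so morphisms are germs between chosen
  -- representatives; any other representative agrees with the chosen one eventually.
  (DGCat.eventuallyZero Filter.atTop fun j => (X.obj j).cat).quotient (O := Obj X)
    (fun x j => x.out j)

variable {X}

/-- The germ of a family of objects. -/
def mkObj (x : ∀ j, (X.obj j).cat.Obj) : (cat X).Obj := Quotient.mk _ x

/-- The chosen representative of a germ of objects. -/
def rep (x : (cat X).Obj) (j : l) : (X.obj j).cat.Obj := Quotient.out (show Obj X from x) j

theorem rep_mkObj (x : ∀ j, (X.obj j).cat.Obj) : ∀ᶠ j in Filter.atTop, rep (mkObj x) j = x j :=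
  Quotient.exact (Quotient.out_eq (show Obj X from mkObj x))

theorem mkObj_eq {x y : ∀ j, (X.obj j).cat.Obj} (h : ∀ᶠ j in Filter.atTop, x j = y j) :
    mkObj x = mkObj y := Quotient.sound h

theorem eventually_of_mkObj_eq {x y : ∀ j, (X.obj j).cat.Obj} (h : mkObj x = mkObj y) :
    ∀ᶠ j in Filter.atTop, x j = y j := Quotient.exact h

/-- The germ of a family of morphisms. -/
def mkHom {x y : (cat X).Obj} {p : ℤ} (f : ∀ j, (X.obj j).cat.Hom (rep x j) (rep y j) p) :
    (cat X).Hom x y p := DGCat.Ideal.homMk _ f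

theorem mkHom_surjective {x y : (cat X).Obj} {p : ℤ} (f : (cat X).Hom x y p) :
    ∃ f', mkHom f' = f := DGCat.Ideal.homMk_surjective _ f

theorem mkHom_eq_iff {x y : (cat X).Obj} {p : ℤ}
    {f g : ∀ j, (X.obj j).cat.Hom (rep x j) (rep y j) p} :
    mkHom f = mkHom g ↔ ∀ᶠ j in Filter.atTop, f j = g j := by
  refine (DGCat.Ideal.homMk_eq_iff _).trans ?_
  refine Filter.eventually_congr (Filter.Eventually.of_forall fun j => ?_)
  exact sub_eq_zero (a := f j)

theorem castHom_mkHom {x x' y y' : (cat X).Obj} (hx : x = x') (hy : y = y') {p : ℤ}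
    (f : ∀ j, (X.obj j).cat.Hom (rep x j) (rep y j) p) :
    (cat X).castHom hx hy p (mkHom f) = mkHom fun j =>
      (X.obj j).cat.castHom (congrArg (rep · j) hx) (congrArg (rep · j) hy) p (f j) := by
  subst hx hy; rfl

variable [IsDirectedOrder l] [Nonempty l]

variable (X) in
/-- The dg category of germs, with its distinguished zero object. -/
def pt : DGCatp k where
  cat := cat X
  pt := mkObj fun j => (X.obj j).pt
  isZeroObject x p := by
    refine ⟨⟨fun f g => ?_⟩, ⟨fun f g => ?_⟩⟩ <;>
    · obtain ⟨f, rfl⟩ := mkHom_surjective f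
      obtain ⟨g, rfl⟩ := mkHom_surjective g
      refine mkHom_eq_iff.2 ?_
      filter_upwards [rep_mkObj fun j => (X.obj j).pt] with j hj
      first
      | exact (X.obj j).hom_zero_left hj _ _
      | exact (X.obj j).hom_zero_right hj _ _

open Classical in
/-- The family of images of an object of a dg category in the diagram. -/
def family {i : l} (a : (X.obj i).cat.Obj) (j : l) : (X.obj j).cat.Obj :=
  if h : i ≤ j then (tr X h).obj a else (X.obj j).pt

theorem family_eq {i j : l} (h : i ≤ j) (a : (X.obj i).cat.Obj) : family a j = (tr X h).obj a :=
  dif_pos h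

theorem rep_family {i : l} (a : (X.obj i).cat.Obj) :
    ∀ᶠ j in Filter.atTop, ∃ h : i ≤ j, (tr X h).obj a = rep (mkObj (family a)) j := by
  filter_upwards [rep_mkObj (family a), Filter.eventually_ge_atTop i] with j hj hij
  exact ⟨hij, (hj.trans (family_eq hij a)).symm⟩

open Classical in
/-- The family of images of a morphism of a dg category in the diagram. -/
def familyHom {i : l} {a b : (X.obj i).cat.Obj} {p : ℤ} (f : (X.obj i).cat.Hom a b p) (j : l) :
    (X.obj j).cat.Hom (rep (mkObj (family a)) j) (rep (mkObj (family b)) j) p :=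
  -- The image of `f` at stage `j` has the right ends only where the chosen representatives agree
  -- with the images of `a` and `b`. This holds eventually, and the default value `0` elsewhere does
  -- not affect the germ.
  if h : ∃ h : i ≤ j, (tr X h).obj a = rep (mkObj (family a)) j ∧
      (tr X h).obj b = rep (mkObj (family b)) j then
    (X.obj j).cat.castHom h.choose_spec.1 h.choose_spec.2 p ((tr X h.choose).map f)
  else 0

theorem familyHom_eq {i j : l} {a b : (X.obj i).cat.Obj} {p : ℤ} (f : (X.obj i).cat.Hom a b p)
    (h : i ≤ j) (ha : (tr X h).obj a = rep (mkObj (family a)) j)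
    (hb : (tr X h).obj b = rep (mkObj (family b)) j) :
    familyHom f j = (X.obj j).cat.castHom ha hb p ((tr X h).map f) :=
  dif_pos ⟨h, ha, hb⟩

/-- The dg functors from the dg categories in the diagram to the dg category of germs. -/
def ιFunctor (i : l) : (X.obj i).cat ⟶ cat X where
  obj a := mkObj (family a)
  map {a b} p :=
    { toFun := fun f => mkHom (familyHom f)
      map_add' := fun f g => by
        refine (mkHom_eq_iff (g := fun j => familyHom f j + familyHom g j)).2 ?_
        filter_upwards [rep_family a, rep_family b] with j ⟨h, ha⟩ ⟨_, hb⟩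
        refine Eq.trans ?_ (congrArg₂ (· + ·) (familyHom_eq f h ha hb) (familyHom_eq g h ha hb)).symm
        rw [familyHom_eq _ h ha hb, DGFunctor.map_add, map_add]
      map_smul' := fun c f => by
        refine (mkHom_eq_iff (g := fun j => c • familyHom f j)).2 ?_
        filter_upwards [rep_family a, rep_family b] with j ⟨h, ha⟩ ⟨_, hb⟩
        refine Eq.trans ?_ (congrArg (c • ·) (familyHom_eq f h ha hb)).symm
        rw [familyHom_eq _ h ha hb, DGFunctor.map_smul, map_smul] }
  map_d {a b} p q hpq f := by
    refine mkHom_eq_iff.2 ?_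
    filter_upwards [rep_family a, rep_family b] with j ⟨h, ha⟩ ⟨_, hb⟩
    refine Eq.trans ?_ (congrArg ((X.obj j).cat.d p q hpq) (familyHom_eq f h ha hb)).symm
    rw [familyHom_eq _ h ha hb, DGFunctor.map_d, DGCat.castHom_d]
  map_id a := by
    refine mkHom_eq_iff.2 ?_
    filter_upwards [rep_family a] with j ⟨h, ha⟩
    rw [familyHom_eq _ h ha ha, DGFunctor.map_id, DGCat.castHom_id]
    rfl
  map_comp {a b c q p n} hn g f := by
    refine mkHom_eq_iff.2 ?_
    filter_upwards [rep_family a, rep_family b, rep_family c] with j ⟨h, ha⟩ ⟨_, hb⟩ ⟨_, hc⟩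
    refine Eq.trans ?_ (congrArg₂ (fun x y => (X.obj j).cat.comp hn x y) (familyHom_eq g h hb hc)
      (familyHom_eq f h ha hb)).symm
    rw [familyHom_eq _ h ha hc, DGFunctor.map_comp, DGCat.castHom_comp _ ha hb hc]

theorem mkObj_family_tr {i j : l} (h : i ≤ j) (a : (X.obj i).cat.Obj) :
    mkObj (family ((tr X h).obj a)) = mkObj (family a) := by
  refine mkObj_eq ?_
  filter_upwards [Filter.eventually_ge_atTop j] with m hm
  rw [family_eq hm, family_eq (h.trans hm), tr_obj_tr]

theorem mkObj_family_pt (i : l) : mkObj (family (X.obj i).pt) = mkObj fun j => (X.obj j).pt := by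
  refine mkObj_eq ?_
  filter_upwards [Filter.eventually_ge_atTop i] with m hm
  rw [family_eq hm, tr_obj_pt]

/-- At late stages both sides are the image of the same morphism under the transition functors, and
germs see only late stages. -/
theorem tr_ιFunctor {i j : l} (h : i ≤ j) : tr X h ≫ ιFunctor j = ιFunctor i := by
  refine DGFunctor.ext_of_castHom (mkObj_family_tr h) fun a b p f => ?_
  refine (castHom_mkHom _ _ (familyHom ((tr X h).map f))).trans
    ((mkHom_eq_iff (g := familyHom f)).2 ?_)
  filter_upwards [rep_family a, rep_family b, rep_family ((tr X h).obj a),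
    rep_family ((tr X h).obj b)] with m ⟨hm, ha⟩ ⟨_, hb⟩ ⟨hm', ha'⟩ ⟨_, hb'⟩
  rw [familyHom_eq _ hm ha hb, familyHom_eq _ hm' ha' hb', DGCat.castHom_castHom,
    ← DGFunctor.map_of_eq (tr_tr X h hm') f, DGCat.castHom_castHom]
  rfl

variable (X) in
/-- The dg category of germs as a cocone. -/
def cocone : Cocone X where
  pt := pt X
  ι :=
    { app := fun i => ⟨ιFunctor i, mkObj_family_pt i⟩
      naturality := fun i j φ => hom_ext (tr_ιFunctor (leOfHom φ)) }

end Germ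

end DGCatp

/-! ## Directed colimits -/

namespace DGCatp

namespace Germ

variable {l : Type u} [Preorder l] {X : l ⥤ DGCatp k} (c : Cocone X)

/-- The dg functors that constitute a cocone. -/
abbrev leg (j : l) : (X.obj j).cat ⟶ c.pt.cat := (c.ι.app j).functor

theorem tr_leg {i j : l} (h : i ≤ j) : tr X h ≫ leg c j = leg c i :=
  congrArg Functor.functor (c.w (homOfLE h))

theorem leg_tr_obj {i j : l} (h : i ≤ j) (a : (X.obj i).cat.Obj) :
    (leg c j).obj ((tr X h).obj a) = (leg c i).obj a :=
  DGFunctor.obj_of_eq (tr_leg c h) a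

/-- The property that a morphism comes from a morphism `a ⟶ b` at stage `j`. -/
def AtStage {j : l} {a b : (X.obj j).cat.Obj} {x y : c.pt.cat.Obj} (ha : (leg c j).obj a = x)
    (hb : (leg c j).obj b = y) {p : ℤ} (g : c.pt.cat.Hom x y p) : Prop :=
  ∃ f : (X.obj j).cat.Hom a b p, c.pt.cat.castHom ha hb p ((leg c j).map f) = g

namespace AtStage

variable {c} {j : l} {a b : (X.obj j).cat.Obj} {x y : c.pt.cat.Obj} {ha : (leg c j).obj a = x}
  {hb : (leg c j).obj b = y} {p : ℤ} {g : c.pt.cat.Hom x y p}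

theorem push (h : AtStage c ha hb g) {j' : l} (hj : j ≤ j') {a' b' : (X.obj j').cat.Obj}
    (ha' : (tr X hj).obj a = a') (hb' : (tr X hj).obj b = b') (ha'' : (leg c j').obj a' = x)
    (hb'' : (leg c j').obj b' = y) : AtStage c ha'' hb'' g := by
  subst ha' hb' ha hb
  obtain ⟨f, rfl⟩ := h
  exact ⟨(tr X hj).map f, DGFunctor.map_of_eq (tr_leg c hj) f⟩

theorem add {g' : c.pt.cat.Hom x y p} (h : AtStage c ha hb g) (h' : AtStage c ha hb g') :
    AtStage c ha hb (g + g') := by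
  obtain ⟨f, rfl⟩ := h
  obtain ⟨f', rfl⟩ := h'
  exact ⟨f + f', by rw [DGFunctor.map_add, map_add]⟩

theorem smul (t : k) (h : AtStage c ha hb g) : AtStage c ha hb (t • g) := by
  obtain ⟨f, rfl⟩ := h
  exact ⟨t • f, by rw [DGFunctor.map_smul, map_smul]⟩

theorem d {q : ℤ} (hq : p + 1 = q) (h : AtStage c ha hb g) :
    AtStage c ha hb (c.pt.cat.d p q hq g) := by
  obtain ⟨f, rfl⟩ := h
  exact ⟨(X.obj j).cat.d p q hq f, by rw [DGFunctor.map_d, DGCat.castHom_d]⟩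

theorem comp {b' : (X.obj j).cat.Obj} {z : c.pt.cat.Obj} {hb' : (leg c j).obj b' = z} {q n : ℤ}
    (hn : q + p = n) {g' : c.pt.cat.Hom y z q} (h' : AtStage c hb hb' g')
    (h : AtStage c ha hb g) : AtStage c ha hb' (c.pt.cat.comp hn g' g) := by
  obtain ⟨f, rfl⟩ := h
  obtain ⟨f', rfl⟩ := h'
  exact ⟨(X.obj j).cat.comp hn f' f, by rw [DGFunctor.map_comp, DGCat.castHom_comp _ ha hb hb']⟩

end AtStage

variable [IsDirectedOrder l] [Nonempty l] {c}

/-- The colimit maps to the cocone of germs, where equality of two classes means equality of the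
images at all sufficiently late stages. The proof uses only the universal property of the colimit.
-/
theorem exists_of_obj_eq (hc : IsColimit c) {i : l} {a b : (X.obj i).cat.Obj}
    (h : (leg c i).obj a = (leg c i).obj b) :
    ∃ (j : l) (h : i ≤ j), (tr X h).obj a = (tr X h).obj b := by
  have hfac := congrArg Functor.functor (hc.fac (cocone X) i)
  have e : mkObj (family a) = mkObj (family b) :=
    (DGFunctor.obj_of_eq hfac a).symm.trans
      ((congrArg (hc.desc (cocone X)).functor.obj h).trans (DGFunctor.obj_of_eq hfac b))
  obtain ⟨j, hj, hij⟩ :=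
    ((eventually_of_mkObj_eq e).and (Filter.eventually_ge_atTop i)).exists
  exact ⟨j, hij, by rwa [family_eq hij, family_eq hij] at hj⟩

/-- The same comparison with germs, on morphisms: a germ vanishes only if the family vanishes
eventually. -/
theorem exists_of_map_eq_zero (hc : IsColimit c) {i : l} {a b : (X.obj i).cat.Obj} {p : ℤ}
    {f : (X.obj i).cat.Hom a b p} (h : (leg c i).map f = 0) :
    ∃ (j : l) (h : i ≤ j), (tr X h).map f = 0 := by
  have hfac := congrArg Functor.functor (hc.fac (cocone X) i)
  have e : mkHom (familyHom f) = mkHom 0 := by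
    refine (DGFunctor.map_of_eq hfac f).symm.trans ?_
    refine (congrArg (fun x => (cat X).castHom _ _ p ((hc.desc (cocone X)).functor.map x)) h).trans
      ?_
    refine (congrArg _ (DGFunctor.map_zero _ _ _ _)).trans ?_
    exact (cat X).castHom_zero (DGFunctor.obj_of_eq hfac a) (DGFunctor.obj_of_eq hfac b) p
  obtain ⟨j, hj, ⟨hij, ha⟩, _, hb⟩ :=
    ((mkHom_eq_iff.1 e).and ((rep_family a).and (rep_family b))).exists
  refine ⟨j, hij, ?_⟩
  rw [familyHom_eq f hij ha hb] at hj
  exact ((X.obj j).cat.castHom ha hb p).map_eq_zero_iff.1 hj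

theorem exists_of_leg_eq (hc : IsColimit c) {i i' : l} {a : (X.obj i).cat.Obj}
    {a' : (X.obj i').cat.Obj} (h : (leg c i).obj a = (leg c i').obj a') :
    ∃ (j : l) (hi : i ≤ j) (hi' : i' ≤ j), (tr X hi).obj a = (tr X hi').obj a' := by
  obtain ⟨m, hm, hm'⟩ := exists_ge_ge i i'
  obtain ⟨j, hj, e⟩ := exists_of_obj_eq hc (i := m) (a := (tr X hm).obj a)
    (b := (tr X hm').obj a') (by rw [leg_tr_obj, leg_tr_obj, h])
  exact ⟨j, hm.trans hj, hm'.trans hj, by rwa [tr_obj_tr, tr_obj_tr] at e⟩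

/-- The given representatives of the ends of `f` need not be the images of `a` and `b`, but they
agree with them at a later stage, where the image of `f` is the required morphism. -/
theorem atStage_map (hc : IsColimit c) {i i' : l} {a b : (X.obj i).cat.Obj}
    {a' b' : (X.obj i').cat.Obj} {p : ℤ} (f : (X.obj i).cat.Hom a b p)
    (ha : (leg c i').obj a' = (leg c i).obj a) (hb : (leg c i').obj b' = (leg c i).obj b) :
    ∃ (j : l) (h : i' ≤ j), AtStage c ((leg_tr_obj c h a').trans ha) ((leg_tr_obj c h b').trans hb)
      ((leg c i).map f) := by
  obtain ⟨j₁, h₁, h₁', e₁⟩ := exists_of_leg_eq hc ha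
  obtain ⟨j₂, h₂, h₂', e₂⟩ := exists_of_leg_eq hc hb
  obtain ⟨j, hj₁, hj₂⟩ := exists_ge_ge j₁ j₂
  have h0 : AtStage c rfl rfl ((leg c i).map f) := ⟨f, rfl⟩
  refine ⟨j, h₁.trans hj₁, h0.push (h₁'.trans hj₁) ?_ ?_ _ _⟩
  · rw [← tr_obj_tr X h₁' hj₁, ← e₁, tr_obj_tr]
  · rw [← tr_obj_tr X h₂' hj₂, ← e₂, tr_obj_tr]

/-- The objects and morphisms of a colimit that come from some stage. -/
def stageSub (hc : IsColimit c) : c.pt.cat.Sub where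
  obj := {x | ∃ (j : l) (a : (X.obj j).cat.Obj), (leg c j).obj a = x}
  hom x y p :=
    -- The morphism has to be realised between all representatives of its ends. This strong form
    -- lets the sources and targets of two realisations be matched when morphisms are added or
    -- composed.
    { carrier := {g | ∀ ⦃i : l⦄ (a b : (X.obj i).cat.Obj) (ha : (leg c i).obj a = x)
        (hb : (leg c i).obj b = y), ∃ (j : l) (h : i ≤ j),
          AtStage c ((leg_tr_obj c h a).trans ha) ((leg_tr_obj c h b).trans hb) g}
      zero_mem' := fun i a b ha hb => ⟨i, le_rfl, 0, by rw [DGFunctor.map_zero, map_zero]⟩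
      add_mem' := fun {g g'} hg hg' i a b ha hb => by
        obtain ⟨j₁, h₁, e₁⟩ := hg a b ha hb
        obtain ⟨j₂, h₂, e₂⟩ := hg' a b ha hb
        obtain ⟨j, hj₁, hj₂⟩ := exists_ge_ge j₁ j₂
        exact ⟨j, h₁.trans hj₁, (e₁.push hj₁ (tr_obj_tr ..) (tr_obj_tr ..) _ _).add
          (e₂.push hj₂ (tr_obj_tr ..) (tr_obj_tr ..) _ _)⟩
      smul_mem' := fun t g hg i a b ha hb => by
        obtain ⟨j, h, e⟩ := hg a b ha hb
        exact ⟨j, h, e.smul t⟩ }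
  d_mem p q h f hf i a b ha hb := by
    obtain ⟨j, h, e⟩ := hf a b ha hb
    exact ⟨j, h, e.d _⟩
  id_mem := by
    rintro _ ⟨i, a, rfl⟩ i' a' b' ha hb
    rw [← DGFunctor.map_id]
    exact atStage_map hc _ ha hb
  comp_mem := by
    rintro x y z q p n hn g f ⟨i', b, rfl⟩ hg hf i a a' ha hc
    -- A representative `b` of the middle object is fixed, and both factors are realised with the
    -- image of `b` as their common end.
    obtain ⟨m, hm, hm'⟩ := exists_ge_ge i i'
    obtain ⟨j₁, h₁, e₁⟩ := hg ((tr X hm').obj b) ((tr X hm).obj a') (leg_tr_obj c hm' b)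
      ((leg_tr_obj c hm a').trans hc)
    obtain ⟨j₂, h₂, e₂⟩ := hf ((tr X hm).obj a) ((tr X hm').obj b)
      ((leg_tr_obj c hm a).trans ha) (leg_tr_obj c hm' b)
    obtain ⟨j, hj₁, hj₂⟩ := exists_ge_ge j₁ j₂
    refine ⟨j, hm.trans (h₁.trans hj₁), AtStage.comp
      (hb := leg_tr_obj c (hm'.trans (h₁.trans hj₁)) b) hn (e₁.push hj₁ ?_ ?_ _ _)
      (e₂.push hj₂ ?_ ?_ _ _)⟩ <;> simp only [tr_obj_tr]

/-- The cocone factors through the dg subcategory `stageSub hc`. By uniqueness the induced map from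
the colimit followed by the inclusion is the identity, so the subcategory is everything. -/
theorem stage_surjective (hc : IsColimit c) :
    (∀ x : c.pt.cat.Obj, x ∈ (stageSub hc).obj) ∧
      ∀ {x y : c.pt.cat.Obj} {p : ℤ} (g : c.pt.cat.Hom x y p), g ∈ (stageSub hc).hom x y p := by
  let S := stageSub hc
  have hS : c.pt.pt ∈ S.obj := ⟨Classical.arbitrary l, _, (c.ι.app _).obj_pt⟩
  let s : Cocone X :=
    { pt := c.pt.sub S hS
      ι :=
        { app := fun i => ⟨S.lift (leg c i) (fun a => ⟨i, a, rfl⟩)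
            (fun f i' a' b' ha hb => atStage_map hc f ha hb), Subtype.ext (c.ι.app i).obj_pt⟩
          naturality := fun i j φ => hom_ext (S.hom_ext (tr_leg c (leOfHom φ))) } }
  let ι : s.pt ⟶ c.pt := ⟨S.ι, rfl⟩
  have h : hc.desc s ≫ ι = 𝟙 c.pt := hc.hom_ext fun j => by
    rw [hc.fac_assoc, Category.comp_id]
    rfl
  have h' : (hc.desc s).functor ≫ S.ι = 𝟙 c.pt.cat := congrArg Functor.functor h
  have hmem : ∀ {x x' y y' : c.pt.cat.Obj} (hx : x = x') (hy : y = y') {p : ℤ}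
      (g : c.pt.cat.Hom x y p), g ∈ S.hom x y p → c.pt.cat.castHom hx hy p g ∈ S.hom x' y' p := by
    rintro x _ y _ rfl rfl p g hg
    exact hg
  refine ⟨fun x => ?_, fun {x y p} g => ?_⟩
  · rw [← show S.ι.obj ((hc.desc s).functor.obj x) = x from DGFunctor.obj_of_eq h' x]
    exact ((hc.desc s).functor.obj x).2
  · rw [show g = _ from (DGFunctor.map_of_eq h' g).symm]
    exact hmem _ _ _ ((hc.desc s).functor.map g).2

end Germ

end DGCatp

/-! ## Finitely presented dg categories and smallness -/

open DGCatp DGCatp.Germ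

/-- A dg category is compact if dg functors on it to a directed colimit of dg categories with a
distinguished zero object come from a stage, and dg functors to a stage that become equal in the
colimit become equal at a later stage. -/
structure DGCat.IsCompact (C : DGCat k) : Prop where
  exists_fac : ∀ {l : Type u} [Preorder l] [IsDirectedOrder l] [Nonempty l] {X : l ⥤ DGCatp k}
    {c : Cocone X}, IsColimit c → ∀ f : C ⟶ c.pt.cat, ∃ (j : l) (g : C ⟶ (X.obj j).cat),
      g ≫ leg c j = f
  exists_eq : ∀ {l : Type u} [Preorder l] [IsDirectedOrder l] [Nonempty l] {X : l ⥤ DGCatp k}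
    {c : Cocone X}, IsColimit c → ∀ {i : l} (f g : C ⟶ (X.obj i).cat), f ≫ leg c i = g ≫ leg c i →
      ∃ (j : l) (h : i ≤ j), f ≫ tr X h = g ≫ tr X h

/-- For a directed diagram of sets, a cocone is a colimit if it is jointly surjective and elements
of one stage with the same image become equal at a later stage. -/
theorem preservesColimit_coyoneda {l : Type u} [Preorder l] [IsDirectedOrder l] [Nonempty l]
    {X : l ⥤ DGCatp k} {A : DGCatp k}
    (h₁ : ∀ {c : Cocone X}, IsColimit c → ∀ f : A ⟶ c.pt, ∃ (j : l) (g : A ⟶ X.obj j),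
      g ≫ c.ι.app j = f)
    (h₂ : ∀ {c : Cocone X}, IsColimit c → ∀ {i : l} (f g : A ⟶ X.obj i),
      f ≫ c.ι.app i = g ≫ c.ι.app i →
        ∃ (j : l) (h : i ≤ j), f ≫ X.map (homOfLE h) = g ≫ X.map (homOfLE h)) :
    PreservesColimit X (coyoneda.obj (Opposite.op A)) where
  preserves {c} hc := ⟨Types.FilteredColimit.isColimitOf' _ _
    (fun x => by
      obtain ⟨j, g, hg⟩ := h₁ hc x
      exact ⟨j, g, hg.symm⟩)
    (fun i x y e => by
      obtain ⟨j, h, e'⟩ := h₂ hc (i := i) x y e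
      exact ⟨j, homOfLE h, e'⟩)⟩

theorem isSmallRelativeTo_of_preservesColimit {A : DGCatp k}
    (hA : ∀ {l : Type u} [Preorder l] [IsDirectedOrder l] [Nonempty l] (X : l ⥤ DGCatp k),
      PreservesColimit X (coyoneda.obj (Opposite.op A))) (D : MorphismProperty (DGCatp k)) :
    IsSmallRelativeTo.{u} A D :=
  -- Preservation holds along every nonempty directed preorder, so the cardinal `0` already serves.
  ⟨0, fun l _ _ _ _ _ _ X _ _ => hA X⟩

theorem DGCat.IsCompact.preservesColimit {C : DGCat k} (hC : C.IsCompact) {l : Type u} [Preorder l]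
    [IsDirectedOrder l] [Nonempty l] (X : l ⥤ DGCatp k) :
    PreservesColimit X (coyoneda.obj (Opposite.op ((adjoinZero k).obj C))) :=
  preservesColimit_coyoneda
    (fun hc f => by
      obtain ⟨j, g, hg⟩ := hC.exists_fac hc (AdjoinZero.inclusion C ≫ (DGCatp.forget k).map f)
      exact ⟨j, AdjoinZero.extend g, AdjoinZero.ext_inclusion hg⟩)
    (fun hc i f g e => by
      obtain ⟨j, h, e'⟩ := hC.exists_eq hc (AdjoinZero.inclusion C ≫ (DGCatp.forget k).map f)
        (AdjoinZero.inclusion C ≫ (DGCatp.forget k).map g)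
        (congrArg (fun F => AdjoinZero.inclusion C ≫ (DGCatp.forget k).map F) e)
      exact ⟨j, h, AdjoinZero.ext_inclusion e'⟩)

theorem preservesColimit_initialDGCatp {l : Type u} [Preorder l]
    [IsDirectedOrder l] [Nonempty l] (X : l ⥤ DGCatp k) :
    PreservesColimit X (coyoneda.obj (Opposite.op (initialDGCatp k))) :=
  preservesColimit_coyoneda
    (fun _ f => ⟨Classical.arbitrary l, fromInitial _, (isInitialInitialDGCatp k).hom_ext _ _⟩)
    (fun _ i f g _ => ⟨i, le_rfl, (isInitialInitialDGCatp k).hom_ext _ _⟩)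

theorem catA_isCompact : (catA k).IsCompact where
  exists_fac {l _ _ _ X c} hc f := by
    obtain ⟨j, a, ha⟩ := (stage_surjective hc).1 (f.obj PUnit.unit)
    exact ⟨j, (X.obj j).cat.pick a, catA_hom_ext ha⟩
  exists_eq {l _ _ _ X c} hc i f g e := by
    obtain ⟨j, h, e'⟩ := exists_of_obj_eq hc (DGFunctor.obj_of_eq e PUnit.unit)
    exact ⟨j, h, catA_hom_ext e'⟩

theorem catB_isCompact : (catB k).IsCompact where
  exists_fac {l _ _ _ X c} hc f := by
    obtain ⟨i, a, ha⟩ := (stage_surjective hc).1 (f.obj catB.src)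
    obtain ⟨i', b, hb⟩ := (stage_surjective hc).1 (f.obj catB.tgt)
    obtain ⟨j, hj, hj'⟩ := exists_ge_ge i i'
    exact ⟨j, catB.functor ((tr X hj).obj a) ((tr X hj').obj b),
      catB.hom_ext ((leg_tr_obj c hj a).trans ha) ((leg_tr_obj c hj' b).trans hb)⟩
  exists_eq {l _ _ _ X c} hc i f g e := by
    obtain ⟨j₁, h₁, e₁⟩ := exists_of_obj_eq hc (DGFunctor.obj_of_eq e catB.src)
    obtain ⟨j₂, h₂, e₂⟩ := exists_of_obj_eq hc (DGFunctor.obj_of_eq e catB.tgt)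
    obtain ⟨j, hj₁, hj₂⟩ := exists_ge_ge j₁ j₂
    refine ⟨j, h₁.trans hj₁, catB.hom_ext ?_ ?_⟩
    · exact (tr_obj_tr X h₁ hj₁ _).symm.trans
        ((congrArg (tr X hj₁).obj e₁).trans (tr_obj_tr X h₁ hj₁ _))
    · exact (tr_obj_tr X h₂ hj₂ _).symm.trans
        ((congrArg (tr X hj₂).obj e₂).trans (tr_obj_tr X h₂ hj₂ _))

/-- A dg functor on `C(n)` is a pair of objects with one cocycle: finitely many elements subject to
one equation, all of which are visible at a stage. -/
theorem catC_isCompact (n : ℤ) : (catC k n).IsCompact where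
  exists_fac {l _ _ _ X c} hc f := by
    obtain ⟨i, a, ha⟩ := (stage_surjective hc).1 (f.obj (catC.src n))
    obtain ⟨i', b, hb⟩ := (stage_surjective hc).1 (f.obj (catC.tgt n))
    obtain ⟨j, hj, hj'⟩ := exists_ge_ge i i'
    obtain ⟨j', h, u, hu⟩ := (stage_surjective hc).2 (f.map (catC.gen n)) ((tr X hj).obj a)
      ((tr X hj').obj b) ((leg_tr_obj c hj a).trans ha) ((leg_tr_obj c hj' b).trans hb)
    -- The lift `u` of the cocycle need not be closed, but its differential dies in the colimit,
    -- hence at a later stage.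
    have hd : (leg c j').map ((X.obj j').cat.d (1 - n) (1 - n + 1) rfl u) = 0 := by
      have e := congrArg (c.pt.cat.d (1 - n) (1 - n + 1) rfl) hu
      rw [← f.map_d, catC.d_gen, f.map_zero, ← DGCat.castHom_d, ← DGFunctor.map_d] at e
      exact (c.pt.cat.castHom _ _ _).map_eq_zero_iff.1 e
    obtain ⟨m, hm, hm'⟩ := exists_of_map_eq_zero hc hd
    refine ⟨m, catC.functor ((tr X hm).map u) (by rw [← DGFunctor.map_d]; exact hm'), ?_⟩
    refine catC.hom_ext ((leg_tr_obj c hm _).trans ((leg_tr_obj c h _).trans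
      ((leg_tr_obj c hj a).trans ha))) ((leg_tr_obj c hm _).trans ((leg_tr_obj c h _).trans
        ((leg_tr_obj c hj' b).trans hb))) ?_
    refine (congrArg (fun x => c.pt.cat.castHom _ _ _ ((leg c m).map x))
      (catC.functor_map_gen _ _)).trans ?_
    refine Eq.trans ?_ hu
    rw [← DGFunctor.map_of_eq (tr_leg c hm) u, DGCat.castHom_castHom]
    rfl
  exists_eq {l _ _ _ X c} hc i f g e := by
    obtain ⟨j₁, h₁, e₁⟩ := exists_of_obj_eq hc (DGFunctor.obj_of_eq e (catC.src n))
    obtain ⟨j₂, h₂, e₂⟩ := exists_of_obj_eq hc (DGFunctor.obj_of_eq e (catC.tgt n))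
    obtain ⟨j, hj₁, hj₂⟩ := exists_ge_ge j₁ j₂
    have e₁' : (f ≫ tr X (h₁.trans hj₁)).obj (catC.src n) =
        (g ≫ tr X (h₁.trans hj₁)).obj (catC.src n) :=
      (tr_obj_tr X h₁ hj₁ _).symm.trans
        ((congrArg (tr X hj₁).obj e₁).trans (tr_obj_tr X h₁ hj₁ _))
    have e₂' : (f ≫ tr X (h₁.trans hj₁)).obj (catC.tgt n) =
        (g ≫ tr X (h₁.trans hj₁)).obj (catC.tgt n) :=
      (tr_obj_tr X h₂ hj₂ _).symm.trans
        ((congrArg (tr X hj₂).obj e₂).trans (tr_obj_tr X h₂ hj₂ _))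
    have e' : (f ≫ tr X (h₁.trans hj₁)) ≫ leg c j = (g ≫ tr X (h₁.trans hj₁)) ≫ leg c j := by
      rw [Category.assoc, Category.assoc, tr_leg, e]
    -- Once the objects agree, the two images of the generator have a difference, and it vanishes in
    -- the colimit.
    obtain ⟨m, hm, hm'⟩ := exists_of_map_eq_zero (c := c) hc
      (f := (X.obj j).cat.castHom e₁' e₂' _ (DGFunctor.map (f ≫ tr X (h₁.trans hj₁)) (catC.gen n)) -
        DGFunctor.map (g ≫ tr X (h₁.trans hj₁)) (catC.gen n)) (by
        rw [map_sub, sub_eq_zero, DGFunctor.map_castHom]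
        exact DGFunctor.map_of_eq e' (catC.gen n))
    rw [map_sub, sub_eq_zero, DGFunctor.map_castHom] at hm'
    refine ⟨m, (h₁.trans hj₁).trans hm, ?_⟩
    rw [← tr_tr X (h₁.trans hj₁) hm, ← Category.assoc, ← Category.assoc]
    exact catC.hom_ext (congrArg (tr X hm).obj e₁') (congrArg (tr X hm).obj e₂') hm'

/-! ## Homotopy in dg categories -/

namespace DGCat

variable (C : DGCat k)

/-- A morphism of a dg category is closed if its differential vanishes. -/
def Closed {X Y : C.Obj} {n : ℤ} (f : C.Hom X Y n) : Prop := C.d n (n + 1) rfl f = 0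

/-- Two morphisms of a dg category are homotopic if their difference is a boundary. -/
def Homotopic {X Y : C.Obj} {n : ℤ} (f g : C.Hom X Y n) : Prop :=
  ∃ e : C.Hom X Y (n - 1), C.d (n - 1) n (by lia) e = f - g

variable {C} {X Y Z T : C.Obj} {n : ℤ}

theorem Closed.d_eq_zero {f : C.Hom X Y n} (hf : C.Closed f) (q : ℤ) (h : n + 1 = q) :
    C.d n q h f = 0 := by
  subst h; exact hf

theorem closed_of_d_eq_zero {f : C.Hom X Y n} {q : ℤ} {h : n + 1 = q} (hf : C.d n q h f = 0) :
    C.Closed f := by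
  subst h; exact hf

theorem closed_zero : C.Closed (0 : C.Hom X Y n) := map_zero _

theorem closed_id (X : C.Obj) : C.Closed (C.id X) := C.d_id X _ _

theorem closed_d {m : ℤ} (h : m + 1 = n) (f : C.Hom X Y m) : C.Closed (C.d m n h f) :=
  C.d_d _ _ _ _ _ f

theorem Closed.add {f g : C.Hom X Y n} (hf : C.Closed f) (hg : C.Closed g) : C.Closed (f + g) := by
  rw [Closed, map_add, hf, hg, add_zero]

theorem Closed.neg {f : C.Hom X Y n} (hf : C.Closed f) : C.Closed (-f) := by
  rw [Closed, map_neg, hf, neg_zero]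

theorem Closed.sub {f g : C.Hom X Y n} (hf : C.Closed f) (hg : C.Closed g) : C.Closed (f - g) := by
  rw [Closed, map_sub, hf, hg, sub_zero]

theorem Closed.comp {q p : ℤ} (h : q + p = n) {g : C.Hom Y Z q} {f : C.Hom X Y p} (hg : C.Closed g)
    (hf : C.Closed f) : C.Closed (C.comp h g f) := by
  rw [Closed, C.leibniz h rfl rfl rfl, hg, hf]
  simp

theorem homotopic_of_d_eq {m : ℤ} {h : m + 1 = n} {f g : C.Hom X Y n} {e : C.Hom X Y m}
    (he : C.d m n h e = f - g) : C.Homotopic f g := by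
  obtain rfl : m = n - 1 := by lia
  exact ⟨e, he⟩

namespace Homotopic

theorem exists_d_eq {f g : C.Hom X Y n} (hfg : C.Homotopic f g) (m : ℤ) (h : m + 1 = n) :
    ∃ e : C.Hom X Y m, C.d m n h e = f - g := by
  obtain rfl : m = n - 1 := by lia
  exact hfg

theorem refl (f : C.Hom X Y n) : C.Homotopic f f := ⟨0, by rw [map_zero, sub_self]⟩

theorem symm {f g : C.Hom X Y n} (h : C.Homotopic f g) : C.Homotopic g f := by
  obtain ⟨e, he⟩ := h
  exact ⟨-e, by rw [map_neg, he, neg_sub]⟩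

theorem trans {f g h : C.Hom X Y n} (h₁ : C.Homotopic f g) (h₂ : C.Homotopic g h) :
    C.Homotopic f h := by
  obtain ⟨e, he⟩ := h₁
  obtain ⟨e', he'⟩ := h₂
  exact ⟨e + e', by rw [map_add, he, he', sub_add_sub_cancel]⟩

theorem comp_left {q p : ℤ} (h : q + p = n) {g : C.Hom Y Z q} (hg : C.Closed g)
    {f f' : C.Hom X Y p} (hf : C.Homotopic f f') :
    C.Homotopic (C.comp h g f) (C.comp h g f') := by
  obtain ⟨e, he⟩ := hf
  -- For closed `g` of degree `q`, the Leibniz rule gives `d (g e) = (-1)^q g (d e)`; the factor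
  -- cancels this sign.
  refine ⟨q.negOnePow • C.comp (by lia) g e, ?_⟩
  rw [Units.smul_def, map_zsmul, ← Units.smul_def,
    C.leibniz (by lia) rfl (show p - 1 + 1 = p by lia) (by lia), he, hg, map_zero,
    LinearMap.zero_apply, zero_add, smul_smul, Int.units_mul_self, one_smul, map_sub]

theorem comp_right {q p : ℤ} (h : q + p = n) {g g' : C.Hom Y Z q} (hg : C.Homotopic g g')
    {f : C.Hom X Y p} (hf : C.Closed f) :
    C.Homotopic (C.comp h g f) (C.comp h g' f) := by
  obtain ⟨e, he⟩ := hg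
  refine ⟨C.comp (by lia) e f, ?_⟩
  rw [C.leibniz (by lia) (show q - 1 + 1 = q by lia) rfl (by lia), he, hf, map_zero, smul_zero,
    add_zero, map_sub, LinearMap.sub_apply]

end Homotopic

variable (C) in
/-- Two morphisms of degree `0` are homotopy inverse to each other. -/
structure AreInverse (f : C.Hom X Y 0) (g : C.Hom Y X 0) : Prop where
  closed : C.Closed f
  closed' : C.Closed g
  inv_comp : C.Homotopic (C.comp (add_zero 0) g f) (C.id X)
  comp_inv : C.Homotopic (C.comp (add_zero 0) f g) (C.id Y)

namespace AreInverse

theorem symm {f : C.Hom X Y 0} {g : C.Hom Y X 0} (h : C.AreInverse f g) : C.AreInverse g f :=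
  ⟨h.closed', h.closed, h.comp_inv, h.inv_comp⟩

theorem id (X : C.Obj) : C.AreInverse (C.id X) (C.id X) :=
  ⟨closed_id X, closed_id X, by rw [C.id_comp]; exact .refl _, by rw [C.id_comp]; exact .refl _⟩

theorem inv_comp_comp {f : C.Hom X Y 0} {g : C.Hom Y X 0} (h : C.AreInverse f g)
    {x : C.Hom Z X n} (hx : C.Closed x) :
    C.Homotopic (C.comp (zero_add n) g (C.comp (zero_add n) f x)) x := by
  rw [← C.assoc (add_zero 0) (zero_add n) (zero_add n) (zero_add n)]
  simpa only [C.id_comp] using h.inv_comp.comp_right (zero_add n) hx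

theorem comp_comp_inv {f : C.Hom X Y 0} {g : C.Hom Y X 0} (h : C.AreInverse f g)
    {x : C.Hom Y Z n} (hx : C.Closed x) :
    C.Homotopic (C.comp (add_zero n) (C.comp (add_zero n) x f) g) x := by
  rw [C.assoc (add_zero n) (add_zero 0) (add_zero n) (add_zero n)]
  simpa only [C.comp_id] using h.comp_inv.comp_left (add_zero n) hx

theorem comp {f : C.Hom X Y 0} {g : C.Hom Y X 0} (h : C.AreInverse f g) {f' : C.Hom Y Z 0}
    {g' : C.Hom Z Y 0} (h' : C.AreInverse f' g') :
    C.AreInverse (C.comp (add_zero 0) f' f) (C.comp (add_zero 0) g g') := by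
  refine ⟨h'.closed.comp _ h.closed, h.closed'.comp _ h'.closed', ?_, ?_⟩
  · rw [C.assoc (add_zero 0) (add_zero 0) (add_zero 0) (add_zero 0)]
    exact ((h'.inv_comp_comp h.closed).comp_left _ h.closed').trans h.inv_comp
  · rw [C.assoc (add_zero 0) (add_zero 0) (add_zero 0) (add_zero 0)]
    exact ((h.symm.inv_comp_comp h'.closed').comp_left _ h'.closed).trans h'.comp_inv

end AreInverse

variable (C) in
/-- The equivalence relation on objects given by isomorphism in `H⁰`. -/
def HomotopyEquivalent (X Y : C.Obj) : Prop :=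
  ∃ (f : C.Hom X Y 0) (g : C.Hom Y X 0), C.AreInverse f g

theorem HomotopyEquivalent.trans (h : C.HomotopyEquivalent X Y) (h' : C.HomotopyEquivalent Y Z) :
    C.HomotopyEquivalent X Z := by
  obtain ⟨f, g, h⟩ := h
  obtain ⟨f', g', h'⟩ := h'
  exact ⟨_, _, h.comp h'⟩

theorem HomotopyEquivalent.refl (X : C.Obj) : C.HomotopyEquivalent X X := ⟨_, _, .id X⟩

theorem cohomology_mk_eq_iff {f g : C.cocycles X Y n} :
    (Submodule.Quotient.mk f : C.Cohomology X Y n) = Submodule.Quotient.mk g ↔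
      C.Homotopic f.1 g.1 :=
  (Submodule.Quotient.eq _).trans mem_coboundaries

theorem homotopyEquivalent_iff_nonempty_iso (X Y : C.Obj) :
    C.HomotopyEquivalent X Y ↔ Nonempty ((show C.H0 from X) ≅ (show C.H0 from Y)) := by
  constructor
  · rintro ⟨f, g, h⟩
    exact ⟨⟨Submodule.Quotient.mk ⟨f, h.closed⟩, Submodule.Quotient.mk ⟨g, h.closed'⟩,
      cohomology_mk_eq_iff.2 h.inv_comp, cohomology_mk_eq_iff.2 h.comp_inv⟩⟩
  · rintro ⟨f, g, h, h'⟩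
    obtain ⟨f, rfl⟩ := Submodule.Quotient.mk_surjective _ f
    obtain ⟨g, rfl⟩ := Submodule.Quotient.mk_surjective _ g
    exact ⟨f.1, g.1, f.2, g.2, cohomology_mk_eq_iff.1 h, cohomology_mk_eq_iff.1 h'⟩

end DGCat

namespace DGFunctor

variable {C D E : DGCat k} (F : DGFunctor C D)

variable {F} in
theorem map_closed {X Y : C.Obj} {n : ℤ} {f : C.Hom X Y n} (hf : C.Closed f) :
    D.Closed (F.map f) := by
  rw [DGCat.Closed, ← F.map_d, hf, F.map_zero]

theorem map_homotopic {X Y : C.Obj} {n : ℤ} {f g : C.Hom X Y n} (h : C.Homotopic f g) :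
    D.Homotopic (F.map f) (F.map g) := by
  obtain ⟨e, he⟩ := h
  exact ⟨F.map e, by rw [← F.map_d, he, _root_.map_sub]⟩

theorem map_areInverse {X Y : C.Obj} {f : C.Hom X Y 0} {g : C.Hom Y X 0} (h : C.AreInverse f g) :
    D.AreInverse (F.map f) (F.map g) := by
  refine ⟨map_closed h.closed, map_closed h.closed', ?_, ?_⟩
  · rw [← F.map_comp, ← F.map_id]
    exact F.map_homotopic h.inv_comp
  · rw [← F.map_comp, ← F.map_id]
    exact F.map_homotopic h.comp_inv

/-- A dg functor is quasi-fully faithful at a pair of objects if it induces a quasi-isomorphism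
between the complexes of morphisms. -/
def QuasiIsoAt (X Y : C.Obj) : Prop := ∀ n : ℤ, Function.Bijective (F.mapCohomology X Y n)

theorem quasiIsoAt_iff (X Y : C.Obj) : F.QuasiIsoAt X Y ↔
    (∀ {n : ℤ} {f : C.Hom X Y n}, C.Closed f → D.Homotopic (F.map f) 0 → C.Homotopic f 0) ∧
      ∀ {n : ℤ} {g : D.Hom (F.obj X) (F.obj Y) n}, D.Closed g →
        ∃ f : C.Hom X Y n, C.Closed f ∧ D.Homotopic (F.map f) g := by
  constructor
  · refine fun h => ⟨fun {n f} hf h0 => ?_, fun {n g} hg => ?_⟩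
    · exact (DGCat.cohomology_mk_eq_iff (f := ⟨f, hf⟩) (g := 0)).1
        ((injective_iff_map_eq_zero (F.mapCohomology X Y n)).1 (h n).1
          (Submodule.Quotient.mk ⟨f, hf⟩) ((DGCat.cohomology_mk_eq_iff (g := 0)).2 h0))
    · obtain ⟨f, hf⟩ := (h n).2 (Submodule.Quotient.mk ⟨g, hg⟩)
      obtain ⟨f, rfl⟩ := Submodule.Quotient.mk_surjective _ f
      exact ⟨f.1, f.2, DGCat.cohomology_mk_eq_iff.1 hf⟩
  · refine fun h n => ⟨(injective_iff_map_eq_zero _).2 fun f hf => ?_, fun g => ?_⟩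
    · obtain ⟨f, rfl⟩ := Submodule.Quotient.mk_surjective _ f
      exact DGCat.cohomology_mk_eq_iff.2
        (h.1 f.2 ((DGCat.cohomology_mk_eq_iff (g := 0)).1 hf))
    · obtain ⟨g, rfl⟩ := Submodule.Quotient.mk_surjective _ g
      obtain ⟨f, hf, hfg⟩ := h.2 g.2
      exact ⟨Submodule.Quotient.mk ⟨f, hf⟩, DGCat.cohomology_mk_eq_iff.2 hfg⟩

/-- A dg functor is quasi-essentially surjective if it is essentially surjective on `H⁰`. -/
def QuasiEssSurj : Prop := ∀ Y : D.Obj, ∃ X : C.Obj, D.HomotopyEquivalent (F.obj X) Y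

/-- The quasi-isomorphism condition in degree `0` already says that `H⁰(F)` is full and faithful, so
only essential surjectivity remains. -/
theorem isQuasiEquivalence_iff :
    F.IsQuasiEquivalence ↔ (∀ X Y, F.QuasiIsoAt X Y) ∧ F.QuasiEssSurj := by
  constructor
  · rintro ⟨h, h'⟩
    exact ⟨h, fun Y => ⟨F.mapH0.objPreimage (show D.H0 from Y),
      (DGCat.homotopyEquivalent_iff_nonempty_iso _ _).2 ⟨F.mapH0.objObjPreimageIso _⟩⟩⟩
  · rintro ⟨h, h'⟩
    have : F.mapH0.Faithful := ⟨fun {X Y f g} e => (h X Y 0).1 e⟩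
    have : F.mapH0.Full := ⟨fun {X Y} f => (h X Y 0).2 f⟩
    have : F.mapH0.EssSurj := ⟨fun Y => by
      obtain ⟨X, hX⟩ := h' Y
      exact ⟨X, (DGCat.homotopyEquivalent_iff_nonempty_iso _ _).1 hX⟩⟩
    exact ⟨h, {}⟩

variable {F}

/-- Composition with a homotopy equivalence is invertible up to homotopy, both in `C` and after
applying `F`. This and the left-hand version spread the condition from objects in an essential image
to all objects. -/
theorem QuasiIsoAt.of_homotopyEquivalent_right {X Y Y' : C.Obj} (h : F.QuasiIsoAt X Y)
    (hY : C.HomotopyEquivalent Y Y') : F.QuasiIsoAt X Y' := by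
  obtain ⟨v', v, hv⟩ := hY
  obtain ⟨h₁, h₂⟩ := (F.quasiIsoAt_iff X Y).1 h
  refine (F.quasiIsoAt_iff X Y').2 ⟨fun {n f} hf h0 => ?_, fun {n g} hg => ?_⟩
  · have e := h₁ (hv.closed'.comp (zero_add n) hf) (by
      rw [F.map_comp]
      simpa using h0.comp_left (zero_add n) (map_closed (F := F) hv.closed'))
    exact (hv.symm.inv_comp_comp hf).symm.trans
      (by simpa using e.comp_left (zero_add n) hv.closed)
  · obtain ⟨f, hf, hfg⟩ := h₂ ((map_closed (F := F) hv.closed').comp (zero_add n) hg)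
    refine ⟨C.comp (zero_add n) v' f, hv.closed.comp _ hf, ?_⟩
    rw [F.map_comp]
    exact (hfg.comp_left _ (map_closed hv.closed)).trans
      ((F.map_areInverse hv).symm.inv_comp_comp hg)

theorem QuasiIsoAt.of_homotopyEquivalent_left {X X' Y : C.Obj} (h : F.QuasiIsoAt X Y)
    (hX : C.HomotopyEquivalent X X') : F.QuasiIsoAt X' Y := by
  obtain ⟨u, u', hu⟩ := hX
  obtain ⟨h₁, h₂⟩ := (F.quasiIsoAt_iff X Y).1 h
  refine (F.quasiIsoAt_iff X' Y).2 ⟨fun {n f} hf h0 => ?_, fun {n g} hg => ?_⟩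
  · have e := h₁ (hf.comp (add_zero n) hu.closed) (by
      rw [F.map_comp]
      simpa using h0.comp_right (add_zero n) (map_closed (F := F) hu.closed))
    exact (hu.comp_comp_inv hf).symm.trans
      (by simpa using e.comp_right (add_zero n) hu.closed')
  · obtain ⟨f, hf, hfg⟩ := h₂ (hg.comp (add_zero n) (map_closed (F := F) hu.closed))
    refine ⟨C.comp (add_zero n) f u', hf.comp _ hu.closed', ?_⟩
    rw [F.map_comp]
    exact (hfg.comp_right _ (map_closed hu.closed')).trans
      ((F.map_areInverse hu).comp_comp_inv hg)

/-- A full and faithful functor on `H⁰` reflects isomorphisms: the inverse lifts up to homotopy, and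
the two homotopies are reflected by injectivity on cohomology. -/
theorem exists_areInverse_of_map {X Y : C.Obj} (h : ∀ X Y, F.QuasiIsoAt X Y) {f : C.Hom X Y 0}
    (hf : C.Closed f) {g' : D.Hom (F.obj Y) (F.obj X) 0} (hg' : D.AreInverse (F.map f) g') :
    ∃ g, C.AreInverse f g := by
  obtain ⟨g, hg, hgg'⟩ := ((F.quasiIsoAt_iff Y X).1 (h Y X)).2 hg'.closed'
  have key : ∀ {X : C.Obj} {x : C.Hom X X 0}, C.Closed x →
      D.Homotopic (F.map x) (D.id (F.obj X)) → C.Homotopic x (C.id X) := by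
    intro X x hx hx'
    obtain ⟨e, he⟩ := hx'
    obtain ⟨e', he'⟩ := ((F.quasiIsoAt_iff X X).1 (h X X)).1 (hx.sub (DGCat.closed_id X))
      ⟨e, by rw [he, sub_zero, _root_.map_sub, F.map_id]⟩
    exact ⟨e', by rw [he', sub_zero]⟩
  refine ⟨g, hf, hg, key (hg.comp _ hf) ?_, key (hf.comp _ hg) ?_⟩
  · rw [F.map_comp]
    exact (hgg'.comp_right _ hg'.closed).trans hg'.inv_comp
  · rw [F.map_comp]
    exact (hgg'.comp_left _ hg'.closed).trans hg'.comp_inv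

theorem homotopyEquivalent_of_map {X Y : C.Obj} (h : ∀ X Y, F.QuasiIsoAt X Y)
    (hXY : D.HomotopyEquivalent (F.obj X) (F.obj Y)) : C.HomotopyEquivalent X Y := by
  obtain ⟨f', g', h'⟩ := hXY
  obtain ⟨f, hf, hff'⟩ := ((F.quasiIsoAt_iff X Y).1 (h X Y)).2 h'.closed
  have : D.AreInverse (F.map f) g' := ⟨map_closed hf, h'.closed',
    (hff'.comp_left _ h'.closed').trans h'.inv_comp,
    (hff'.comp_right _ h'.closed').trans h'.comp_inv⟩
  obtain ⟨g, hg⟩ := exists_areInverse_of_map h hf this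
  exact ⟨f, g, hg⟩

theorem map_homotopyEquivalent (F : DGFunctor C D) {X Y : C.Obj} (h : C.HomotopyEquivalent X Y) :
    D.HomotopyEquivalent (F.obj X) (F.obj Y) := by
  obtain ⟨f, g, h⟩ := h
  exact ⟨_, _, F.map_areInverse h⟩

theorem mapCohomology_compFunctor (F : DGFunctor C D) (G : DGFunctor D E) (X Y : C.Obj) (n : ℤ) :
    ⇑((F.compFunctor G).mapCohomology X Y n) =
      G.mapCohomology (F.obj X) (F.obj Y) n ∘ F.mapCohomology X Y n := by
  funext f
  obtain ⟨f, rfl⟩ := Submodule.Quotient.mk_surjective _ f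
  rfl

end DGFunctor

/-! ## Closure properties of quasi-equivalences -/

namespace DGCat

variable {C : DGCat k}

theorem Closed.castHom {X X' Y Y' : C.Obj} (hX : X = X') (hY : Y = Y') {n : ℤ} {f : C.Hom X Y n}
    (hf : C.Closed f) : C.Closed (C.castHom hX hY n f) := by
  subst hX hY; exact hf

theorem Homotopic.castHom {X X' Y Y' : C.Obj} (hX : X = X') (hY : Y = Y') {n : ℤ}
    {f g : C.Hom X Y n} (h : C.Homotopic f g) :
    C.Homotopic (C.castHom hX hY n f) (C.castHom hX hY n g) := by
  subst hX hY; exact h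

end DGCat

namespace DGFunctor

variable {C D E : DGCat k}

theorem isQuasiEquivalence_id (C : DGCat k) : (idFunctor C).IsQuasiEquivalence := by
  refine (isQuasiEquivalence_iff _).2 ⟨fun X Y => (quasiIsoAt_iff _ _ _).2
    ⟨fun hf h => h, fun {n g} hg => ⟨g, hg, .refl _⟩⟩, fun Y => ⟨Y, .refl Y⟩⟩

theorem QuasiIsoAt.compFunctor {F : DGFunctor C D} {G : DGFunctor D E} {X Y : C.Obj}
    (hF : F.QuasiIsoAt X Y) (hG : G.QuasiIsoAt (F.obj X) (F.obj Y)) :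
    (F.compFunctor G).QuasiIsoAt X Y := fun n => by
  rw [mapCohomology_compFunctor]
  exact (hG n).comp (hF n)

theorem QuasiIsoAt.of_postcomp {F : DGFunctor C D} {G : DGFunctor D E} {X Y : C.Obj}
    (h : (F.compFunctor G).QuasiIsoAt X Y) (hG : G.QuasiIsoAt (F.obj X) (F.obj Y)) :
    F.QuasiIsoAt X Y := fun n => by
  have := h n
  rw [mapCohomology_compFunctor] at this
  exact (Function.Bijective.of_comp_iff' (hG n) _).1 this

theorem QuasiIsoAt.of_precomp {F : DGFunctor C D} {G : DGFunctor D E} {X Y : C.Obj}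
    (h : (F.compFunctor G).QuasiIsoAt X Y) (hF : F.QuasiIsoAt X Y) :
    G.QuasiIsoAt (F.obj X) (F.obj Y) := fun n => by
  have := h n
  rw [mapCohomology_compFunctor] at this
  exact (Function.Bijective.of_comp_iff _ (hF n)).1 this

theorem IsQuasiEquivalence.compFunctor {F : DGFunctor C D} {G : DGFunctor D E}
    (hF : F.IsQuasiEquivalence) (hG : G.IsQuasiEquivalence) :
    (F.compFunctor G).IsQuasiEquivalence := by
  rw [isQuasiEquivalence_iff] at *
  refine ⟨fun X Y => (hF.1 X Y).compFunctor (hG.1 _ _), fun Z => ?_⟩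
  obtain ⟨Y, hY⟩ := hG.2 Z
  obtain ⟨X, hX⟩ := hF.2 Y
  exact ⟨X, (G.map_homotopyEquivalent hX).trans hY⟩

theorem IsQuasiEquivalence.of_postcomp {F : DGFunctor C D} {G : DGFunctor D E}
    (hG : G.IsQuasiEquivalence) (h : (F.compFunctor G).IsQuasiEquivalence) :
    F.IsQuasiEquivalence := by
  rw [isQuasiEquivalence_iff] at *
  refine ⟨fun X Y => (h.1 X Y).of_postcomp (hG.1 _ _), fun Y => ?_⟩
  obtain ⟨X, hX⟩ := h.2 (G.obj Y)
  exact ⟨X, homotopyEquivalent_of_map hG.1 hX⟩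

/-- Cancellation gives quasi-isomorphisms only between objects in the image of `F`; every object of
`D` is homotopy equivalent to one of these. -/
theorem IsQuasiEquivalence.of_precomp {F : DGFunctor C D} {G : DGFunctor D E}
    (hF : F.IsQuasiEquivalence) (h : (F.compFunctor G).IsQuasiEquivalence) :
    G.IsQuasiEquivalence := by
  rw [isQuasiEquivalence_iff] at *
  refine ⟨fun Y Y' => ?_, fun Z => ?_⟩
  · obtain ⟨X, hX⟩ := hF.2 Y
    obtain ⟨X', hX'⟩ := hF.2 Y'
    exact (((h.1 X X').of_precomp (hF.1 X X')).of_homotopyEquivalent_right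
      hX').of_homotopyEquivalent_left hX
  · obtain ⟨X, hX⟩ := h.2 Z
    exact ⟨F.obj X, hX⟩

theorem homotopic_of_eq {F G : DGFunctor C D} (h : F = G) {X Y : C.Obj} {n : ℤ}
    {f g : C.Hom X Y n} (hfg : D.Homotopic (F.map f) (F.map g)) :
    D.Homotopic (G.map f) (G.map g) := by
  subst h; exact hfg

/-- Homotopies and preimages are sent along `i` or `i'`, found for `G`, and brought back by `r` or
`r'`. Since the retract equations identify objects only propositionally, the morphisms brought back
are transported. -/
theorem IsQuasiEquivalence.of_retract {C' D' : DGCat k} {F : DGFunctor C D} {G : DGFunctor C' D'}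
    {i : DGFunctor C C'} {r : DGFunctor C' C} {i' : DGFunctor D D'} {r' : DGFunctor D' D}
    (hi : i.compFunctor G = F.compFunctor i') (hr : r.compFunctor F = G.compFunctor r')
    (hir : i.compFunctor r = idFunctor C) (hir' : i'.compFunctor r' = idFunctor D)
    (hG : G.IsQuasiEquivalence) : F.IsQuasiEquivalence := by
  rw [isQuasiEquivalence_iff] at *
  refine ⟨fun X Y => (quasiIsoAt_iff _ _ _).2 ⟨fun {n f} hf h => ?_, fun {n g} hg => ?_⟩,
    fun Y => ?_⟩
  · have h₁ : D'.Homotopic (G.map (i.map f)) (G.map (i.map 0)) := by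
      refine homotopic_of_eq hi.symm (f := f) (g := 0) ?_
      have := i'.map_homotopic h
      rwa [← F.map_zero] at this
    rw [i.map_zero, G.map_zero] at h₁
    have h₂ := ((quasiIsoAt_iff _ _ _).1 (hG.1 _ _)).1 (map_closed (F := i) hf) h₁
    have h₃ := r.map_homotopic h₂
    rw [← i.map_zero] at h₃
    exact homotopic_of_eq hir h₃
  · have hX : ∀ X, G.obj (i.obj X) = i'.obj (F.obj X) := fun X => obj_of_eq hi X
    obtain ⟨f, hf, hfg⟩ := ((quasiIsoAt_iff _ _ _).1 (hG.1 _ _)).2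
      ((map_closed (F := i') hg).castHom (hX X).symm (hX Y).symm)
    have hX' : ∀ X, r.obj (i.obj X) = X := fun X => obj_of_eq hir X
    refine ⟨C.castHom (hX' X) (hX' Y) n (r.map f), (map_closed hf).castHom _ _,
      ?_⟩
    have hX₁ : ∀ Z, F.obj (r.obj Z) = r'.obj (G.obj Z) := fun Z => obj_of_eq hr Z
    have hX₂ : ∀ Z, r'.obj (i'.obj Z) = Z := fun Z => obj_of_eq hir' Z
    have e₁ : D.castHom (hX₁ _) (hX₁ _) n (F.map (r.map f)) = r'.map (G.map f) := map_of_eq hr f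
    have e₂ : D.castHom (hX₂ _) (hX₂ _) n (r'.map (i'.map g)) = g := map_of_eq hir' g
    have h₁ := r'.map_homotopic hfg
    rw [map_castHom, ← e₁] at h₁
    rw [map_castHom]
    have h₂ := h₁.castHom ((congrArg r'.obj (hX X)).trans (hX₂ _))
      ((congrArg r'.obj (hX Y)).trans (hX₂ _))
    simp only [DGCat.castHom_castHom] at h₂
    refine h₂.trans ?_
    rw [e₂]
    exact .refl _
  · obtain ⟨X, hX⟩ := hG.2 (i'.obj Y)
    have h₁ := r'.map_homotopyEquivalent hX
    refine ⟨r.obj X, ?_⟩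
    rw [show F.obj (r.obj X) = r'.obj (G.obj X) from obj_of_eq hr X]
    rwa [show r'.obj (i'.obj Y) = Y from obj_of_eq hir' Y] at h₁

end DGFunctor

namespace DGCatp

instance isMultiplicative_quasiEquivalences : (quasiEquivalences k).IsMultiplicative where
  id_mem C := DGFunctor.isQuasiEquivalence_id C.cat
  comp_mem _ _ hF hG := DGFunctor.IsQuasiEquivalence.compFunctor hF hG

instance hasTwoOutOfThreeProperty_quasiEquivalences :
    (quasiEquivalences k).HasTwoOutOfThreeProperty where
  comp_mem _ _ hF hG := DGFunctor.IsQuasiEquivalence.compFunctor hF hG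
  of_postcomp _ _ hG h := DGFunctor.IsQuasiEquivalence.of_postcomp hG h
  of_precomp _ _ hF h := DGFunctor.IsQuasiEquivalence.of_precomp hF h

instance isStableUnderRetracts_quasiEquivalences :
    (quasiEquivalences k).IsStableUnderRetracts where
  of_retract h hG := DGFunctor.IsQuasiEquivalence.of_retract
    (i := h.i.left.functor) (r := h.r.left.functor) (i' := h.i.right.functor)
    (r' := h.r.right.functor)
    (congrArg Functor.functor h.i.w) (congrArg Functor.functor h.r.w)
    (congrArg Functor.functor h.retract_left) (congrArg Functor.functor h.retract_right) hG

end DGCatp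

/-! ### The classes `I` and `J` are sets -/

instance isSmall_sup {C : Type*} [Category* C] (W W' : MorphismProperty C)
    [MorphismProperty.IsSmall.{w} W] [MorphismProperty.IsSmall.{w} W'] :
    MorphismProperty.IsSmall.{w} (W ⊔ W') where
  small_toSet := (inferInstance : Small.{w} (W.toSet ∪ W'.toSet : Set (Arrow C)))

instance isSmall_generatingCofibrations :
    MorphismProperty.IsSmall.{u} (generatingCofibrations k) :=
  have := MorphismProperty.isSmall_ofHoms.{u} (fun _ : Unit => morphismQ k)
  have := MorphismProperty.isSmall_ofHoms.{u} (fun n : ℤ => (adjoinZero k).map (functorS k n))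
  isSmall_sup _ _

instance isSmall_generatingTrivialCofibrations :
    MorphismProperty.IsSmall.{u} (generatingTrivialCofibrations k) :=
  have := MorphismProperty.isSmall_ofHoms.{u} (fun _ : Unit => (adjoinZero k).map (functorF k))
  have := MorphismProperty.isSmall_ofHoms.{u} (fun n : ℤ => (adjoinZero k).map (functorR k n))
  isSmall_sup _ _

/-! ## Calculations with homotopy equivalences -/

namespace DGCat

variable {C : DGCat k} {X Y Z : C.Obj}

theorem d_comp_of_even {q p n q' p' n' : ℤ} {h : q + p = n} (hq : q + 1 = q') (hp : p + 1 = p')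
    {hn : n + 1 = n'} (hqe : Even q) {g : C.Hom Y Z q} {f : C.Hom X Y p} {g' : C.Hom Y Z q'}
    {f' : C.Hom X Y p'} (hg : C.d q q' hq g = g') (hf : C.d p p' hp f = f') :
    C.d n n' hn (C.comp h g f) = C.comp (by lia) g' f + C.comp (by lia) g f' := by
  rw [C.leibniz h hq hp hn, hg, hf, Int.negOnePow_even _ hqe, one_smul]

theorem d_comp_of_odd {q p n q' p' n' : ℤ} {h : q + p = n} (hq : q + 1 = q') (hp : p + 1 = p')
    {hn : n + 1 = n'} (hqo : Odd q) {g : C.Hom Y Z q} {f : C.Hom X Y p} {g' : C.Hom Y Z q'}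
    {f' : C.Hom X Y p'} (hg : C.d q q' hq g = g') (hf : C.d p p' hp f = f') :
    C.d n n' hn (C.comp h g f) = C.comp (by lia) g' f - C.comp (by lia) g f' := by
  rw [C.leibniz h hq hp hn, hg, hf, Int.negOnePow_odd _ hqo, Units.neg_smul, one_smul, sub_eq_add_neg]

end DGCat

namespace KData

open DGCat

variable {C D : DGCat k} {X Y : C.Obj}

theorem areInverse (a : KData C X Y) : C.AreInverse a.f a.g :=
  ⟨closed_of_d_eq_zero a.d_f, closed_of_d_eq_zero a.d_g,
    homotopic_of_d_eq (a.d_r₁.trans (sub_eq_add_neg _ _).symm),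
    homotopic_of_d_eq (a.d_r₂.trans (sub_eq_add_neg _ _).symm)⟩

/-- The differential is `f (g f - 1) - (f g - 1) f = 0`. So `f r₁ - r₂ f` is a cocycle, the one that
`r₁₂` is required to bound. -/
theorem d_comp_sub_comp {f : C.Hom X Y 0} {g : C.Hom Y X 0} {r₁ : C.Hom X X (-1)}
    {r₂ : C.Hom Y Y (-1)} (d_f : C.d 0 1 (by lia) f = 0)
    (d_r₁ : C.d (-1) 0 (by lia) r₁ = C.comp (add_zero 0) g f + -C.id X)
    (d_r₂ : C.d (-1) 0 (by lia) r₂ = C.comp (add_zero 0) f g + -C.id Y) :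
    C.d (-1) 0 (by lia) (C.comp (zero_add (-1)) f r₁ + -C.comp (add_zero (-1)) r₂ f) = 0 := by
  rw [map_add, map_neg, d_comp_of_even _ _ (by decide) d_f d_r₁,
    d_comp_of_odd _ _ (by decide) d_r₂ d_f]
  simp only [map_zero, LinearMap.zero_apply, map_add, map_neg, LinearMap.add_apply,
    LinearMap.neg_apply, C.assoc (add_zero 0) (add_zero 0) (add_zero 0) (add_zero 0)]
  rw [C.id_comp, C.comp_id]
  abel

/-- For arbitrary homotopies `r₁` and `r₂` the cocycle `w = f r₁ - r₂ f` need not be a boundary.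
Replacing `r₂` by `r₂ + w g` keeps `d r₂` and changes the cocycle to `w - w g f`, which is `d (w
r₁)`. -/
theorem exists_of_areInverse {f : C.Hom X Y 0} {g : C.Hom Y X 0} (h : C.AreInverse f g) :
    ∃ a : KData C X Y, a.f = f ∧ a.g = g := by
  obtain ⟨r₁, d_r₁⟩ := h.inv_comp.exists_d_eq (-1) (by lia)
  obtain ⟨r₂, d_r₂⟩ := h.comp_inv.exists_d_eq (-1) (by lia)
  have d_f := h.closed.d_eq_zero 1 (by lia)
  have d_g := h.closed'.d_eq_zero 1 (by lia)
  rw [sub_eq_add_neg] at d_r₁ d_r₂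
  have d_w := d_comp_sub_comp d_f d_r₁ d_r₂
  set w := C.comp (zero_add (-1)) f r₁ + -C.comp (add_zero (-1)) r₂ f with hw
  refine ⟨⟨f, g, r₁, r₂ + C.comp (add_zero (-1)) w g, C.comp (by lia) w r₁, d_f, d_g, d_r₁, ?_, ?_⟩,
    rfl, rfl⟩
  · rw [map_add, d_r₂, d_comp_of_odd _ _ (by decide) d_w d_g]
    simp
  · rw [d_comp_of_odd _ _ (by decide) d_w d_r₁]
    simp only [map_zero, LinearMap.zero_apply, map_add, map_neg, LinearMap.add_apply]
    rw [C.comp_id, C.assoc (add_zero (-1)) (add_zero 0) (add_zero (-1)) (add_zero (-1)), zero_sub]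
    have hw' : C.comp (zero_add (-1)) f r₁ = w + C.comp (add_zero (-1)) r₂ f := by
      rw [hw]; abel
    rw [hw']
    abel

/-- The modification of a `KData` by morphisms of one degree less. -/
def perturb (a : KData C X Y) (e₂₁ : C.Hom Y X (-1)) (e₁₁ : C.Hom X X (-2)) (e₂₂ : C.Hom Y Y (-2))
    (e₁₂ : C.Hom X Y (-3)) : KData C X Y where
  f := a.f
  -- With `f` fixed, each remaining component moves by the differential of its own parameter, up to
  -- sign, plus the terms needed to absorb the changes of the components in its defining equation.
  g := a.g + C.d (-1) 0 (by lia) e₂₁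
  r₁ := a.r₁ + (C.d (-2) (-1) (by lia) e₁₁ + C.comp (add_zero (-1)) e₂₁ a.f)
  r₂ := a.r₂ + (C.d (-2) (-1) (by lia) e₂₂ + C.comp (zero_add (-1)) a.f e₂₁)
  r₁₂ := a.r₁₂ + (C.comp (zero_add (-2)) a.f e₁₁ - C.comp (add_zero (-2)) e₂₂ a.f -
    C.d (-3) (-2) (by lia) e₁₂)
  d_f := a.d_f
  d_g := by rw [map_add, a.d_g, C.d_d, add_zero]
  d_r₁ := by
    rw [map_add, map_add, C.d_d, a.d_r₁, d_comp_of_odd (q' := 0) (by lia) (by lia) (by decide) rfl a.d_f]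
    simp only [map_zero, map_add, LinearMap.add_apply]
    abel
  d_r₂ := by
    rw [map_add, map_add, C.d_d, a.d_r₂, d_comp_of_even (p' := 0) (by lia) (by lia) (by decide) a.d_f rfl]
    simp only [map_zero, map_add, LinearMap.zero_apply]
    abel
  d_r₁₂ := by
    rw [map_add, map_sub, map_sub, C.d_d (-3) (-2) (-1), a.d_r₁₂,
      d_comp_of_even (q' := 1) (p' := -1) (by lia) (by lia) (by decide) a.d_f rfl,
      d_comp_of_even (q' := -1) (p' := 1) (by lia) (by lia) (by decide) rfl a.d_f]
    simp only [map_zero, map_add, LinearMap.zero_apply, LinearMap.add_apply,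
      C.assoc (zero_add (-1)) (add_zero (-1)) (add_zero (-1)) (zero_add (-1))]
    abel

theorem map_perturb (F : DGFunctor C D) (a : KData C X Y) (e₂₁ : C.Hom Y X (-1))
    (e₁₁ : C.Hom X X (-2)) (e₂₂ : C.Hom Y Y (-2)) (e₁₂ : C.Hom X Y (-3)) :
    (a.perturb e₂₁ e₁₁ e₂₂ e₁₂).map F =
      (a.map F).perturb (F.map e₂₁) (F.map e₁₁) (F.map e₂₂) (F.map e₁₂) := by
  ext <;> simp [map, perturb, F.map_d, F.map_comp]

/-- The deviations of `b` from `a` satisfy linear equations, that is, they form a cocycle of a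
complex. Homotopy invertibility of `f` makes this complex contractible, with a contraction given by
the components of `a`. -/
theorem eq_perturb {a b : KData C X Y} (h : a.f = b.f) :
    ∃ e₂₁ e₁₁ e₂₂ e₁₂, b = a.perturb e₂₁ e₁₁ e₂₂ e₁₂ := by
  obtain ⟨f, g, r₁, r₂, r₁₂, d_f, d_g, d_r₁, d_r₂, d_r₁₂⟩ := a
  obtain ⟨f', g', r₁', r₂', r₁₂', d_f', d_g', d_r₁', d_r₂', d_r₁₂'⟩ := b
  obtain rfl : f = f' := h
  obtain ⟨γ, rfl⟩ : ∃ γ, g' = g + γ := ⟨g' - g, by abel⟩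
  obtain ⟨ρ₁, rfl⟩ : ∃ ρ, r₁' = r₁ + ρ := ⟨r₁' - r₁, by abel⟩
  obtain ⟨ρ₂, rfl⟩ : ∃ ρ, r₂' = r₂ + ρ := ⟨r₂' - r₂, by abel⟩
  obtain ⟨ρ₁₂, rfl⟩ : ∃ ρ, r₁₂' = r₁₂ + ρ := ⟨r₁₂' - r₁₂, by abel⟩
  -- The cocycle equations: `dγ = 0`, `dρ₁ = γ f`, `dρ₂ = f γ`, `dρ₁₂ = f ρ₁ - ρ₂ f`.
  have d_γ : C.d 0 1 (by lia) γ = 0 := by rwa [map_add, d_g, zero_add] at d_g'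
  have d_ρ₁ : C.d (-1) 0 (by lia) ρ₁ = C.comp (add_zero 0) γ f := by
    rw [map_add, d_r₁, map_add, LinearMap.add_apply] at d_r₁'
    rw [← sub_eq_zero] at d_r₁' ⊢
    rw [← d_r₁']; abel
  have d_ρ₂ : C.d (-1) 0 (by lia) ρ₂ = C.comp (add_zero 0) f γ := by
    rw [map_add, d_r₂, map_add] at d_r₂'
    rw [← sub_eq_zero] at d_r₂' ⊢
    rw [← d_r₂']; abel
  have d_ρ₁₂ : C.d (-2) (-1) (by lia) ρ₁₂ =
      C.comp (zero_add (-1)) f ρ₁ - C.comp (add_zero (-1)) ρ₂ f := by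
    rw [map_add, d_r₁₂, map_add, map_add, LinearMap.add_apply] at d_r₁₂'
    rw [← sub_eq_zero] at d_r₁₂' ⊢
    rw [← d_r₁₂']; abel
  -- The contracting homotopy. For example, `d (ρ₁ g - γ r₂) = γ f g - γ (f g - 1) = γ`; the
  -- relation for `r₁₂` enters in the later components.
  refine ⟨C.comp (add_zero (-1)) ρ₁ g - C.comp (zero_add (-1)) γ r₂,
    C.comp (by lia) ρ₁ r₁ - C.comp (zero_add (-2)) γ r₁₂,
    C.comp (by lia) ρ₂ r₂ - C.comp (add_zero (-2)) ρ₁₂ g,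
    C.comp (by lia) ρ₁₂ r₁ - C.comp (by lia) ρ₂ r₁₂, ?_⟩
  ext
  · rfl
  · refine congrArg (g + ·) ?_
    rw [map_sub, d_comp_of_odd _ _ (by decide) d_ρ₁ d_g, d_comp_of_even _ _ (by decide) d_γ d_r₂,
      C.assoc (add_zero 0) (add_zero 0) (add_zero 0) (add_zero 0)]
    simp only [map_zero, LinearMap.zero_apply, map_add, map_neg, C.comp_id]
    abel
  · refine congrArg (r₁ + ·) ?_
    rw [map_sub, d_comp_of_odd _ _ (by decide) d_ρ₁ d_r₁, d_comp_of_even _ _ (by decide) d_γ d_r₁₂]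
    simp only [map_zero, LinearMap.zero_apply, map_add, map_neg, map_sub, LinearMap.sub_apply,
      C.comp_id]
    rw [C.assoc (add_zero 0) (zero_add (-1)) (zero_add (-1)) (zero_add (-1)),
      C.assoc (add_zero (-1)) (add_zero 0) (add_zero (-1)) (add_zero (-1)),
      C.assoc (zero_add (-1)) (add_zero (-1)) (add_zero (-1)) (zero_add (-1))]
    abel
  · refine congrArg (r₂ + ·) ?_
    rw [map_sub, d_comp_of_odd _ _ (by decide) d_ρ₂ d_r₂, d_comp_of_even _ _ (by decide) d_ρ₁₂ d_g]
    simp only [map_zero, LinearMap.sub_apply, map_add, map_neg, map_sub,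
      C.comp_id]
    rw [C.assoc (add_zero 0) (zero_add (-1)) (zero_add (-1)) (zero_add (-1)),
      C.assoc (add_zero (-1)) (add_zero 0) (add_zero (-1)) (add_zero (-1)),
      C.assoc (zero_add (-1)) (add_zero (-1)) (add_zero (-1)) (zero_add (-1))]
    abel
  · refine congrArg (r₁₂ + ·) ?_
    dsimp only
    rw [map_sub (C.d (-3) (-2) (by lia)), d_comp_of_even _ _ (by decide) d_ρ₁₂ d_r₁,
      d_comp_of_odd _ _ (by decide) d_ρ₂ d_r₁₂]
    simp only [LinearMap.sub_apply, map_add, map_neg, map_sub, C.comp_id]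
    rw [C.assoc (zero_add (-1)) (show -1 + -1 = -2 by lia) (show -1 + -1 = -2 by lia) (zero_add (-2)),
      C.assoc (add_zero (-1)) (zero_add (-1)) (show -1 + -1 = -2 by lia) (show -1 + -1 = -2 by lia),
      C.assoc (add_zero 0) (zero_add (-2)) (zero_add (-2)) (zero_add (-2)),
      C.assoc (show -1 + -1 = -2 by lia) (add_zero (-1)) (add_zero (-2)) (show -1 + -1 = -2 by lia),
      C.assoc (add_zero (-2)) (add_zero 0) (add_zero (-2)) (add_zero (-2))]
    abel

end KData

/-! ## Lifting properties of dg functors -/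

namespace DGFunctor

variable {C D : DGCat k} (P : DGFunctor C D)

/-- The lifting property of a dg functor with respect to the dg functors `S(n)`. -/
def LiftsBoundaries : Prop :=
  ∀ {X Y : C.Obj} {n m : ℤ} (h : n + 1 = m) {c : C.Hom X Y m}, C.Closed c →
    ∀ {e : D.Hom (P.obj X) (P.obj Y) n}, D.d n m h e = P.map c →
      ∃ e' : C.Hom X Y n, P.map e' = e ∧ C.d n m h e' = c

/-- A dg functor that is surjective on morphisms. -/
def SurjectiveOnHoms : Prop :=
  ∀ {X Y : C.Obj} {n : ℤ} (e : D.Hom (P.obj X) (P.obj Y) n), ∃ e' : C.Hom X Y n, P.map e' = e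

/-- The lifting property of a dg functor with respect to the dg functor `F`. -/
def LiftsKData : Prop :=
  ∀ {X : C.Obj} {Y' : D.Obj} (a : KData D (P.obj X) Y'), ∃ (Y : C.Obj) (h : P.obj Y = Y')
    (a' : KData C X Y), (a'.map P).cast rfl h = a

variable {P}

/-- The property is used twice: first to lift the cocycle `d e` to a cocycle, then to lift `e` with
this lift as its boundary. -/
theorem LiftsBoundaries.surjectiveOnHoms (hP : P.LiftsBoundaries) : P.SurjectiveOnHoms := by
  intro X Y n e
  obtain ⟨c, hc, hc'⟩ := hP (c := 0) (rfl : n + 1 + 1 = n + 1 + 1) DGCat.closed_zero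
    (e := D.d n (n + 1) rfl e) (by rw [D.d_d, P.map_zero])
  obtain ⟨e', he', -⟩ := hP rfl (c := c) hc' hc.symm
  exact ⟨e', he'⟩

theorem LiftsBoundaries.quasiIsoAt (hP : P.LiftsBoundaries) (X Y : C.Obj) : P.QuasiIsoAt X Y := by
  refine (quasiIsoAt_iff _ _ _).2 ⟨fun {n f} hf h => ?_, fun {n g} hg => ?_⟩
  · obtain ⟨e, he⟩ := h
    rw [sub_zero] at he
    obtain ⟨e', -, he'⟩ := hP _ hf he
    exact ⟨e', by rw [he', sub_zero]⟩
  · obtain ⟨f, hf, hf'⟩ := hP rfl DGCat.closed_zero (e := g) (hg.trans (P.map_zero _ _ _).symm)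
    exact ⟨f, hf', by rw [hf]; exact .refl _⟩

theorem LiftsBoundaries.isQuasiEquivalence (hP : P.LiftsBoundaries)
    (hobj : Function.Surjective P.obj) : P.IsQuasiEquivalence :=
  (isQuasiEquivalence_iff _).2 ⟨hP.quasiIsoAt, fun Y => by
    obtain ⟨X, rfl⟩ := hobj Y
    exact ⟨X, .refl _⟩⟩

/-- The generators of `K` are attached one after the other, each with a prescribed boundary in the
earlier ones, so they lift successively. The boundary of `r₁₂` is closed by `KData.d_comp_sub_comp`.
-/
theorem LiftsBoundaries.liftsKData (hP : P.LiftsBoundaries)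
    (hobj : Function.Surjective P.obj) : P.LiftsKData := by
  intro X Y' a
  obtain ⟨Y, rfl⟩ := hobj Y'
  refine ⟨Y, rfl, ?_⟩
  obtain ⟨f, g, r₁, r₂, r₁₂, d_f, d_g, d_r₁, d_r₂, d_r₁₂⟩ := a
  obtain ⟨f, rfl, hf⟩ := hP _ DGCat.closed_zero (d_f.trans (P.map_zero _ _ _).symm)
  obtain ⟨g, rfl, hg⟩ := hP _ DGCat.closed_zero (d_g.trans (P.map_zero _ _ _).symm)
  have cf : C.Closed f := DGCat.closed_of_d_eq_zero hf
  have cg : C.Closed g := DGCat.closed_of_d_eq_zero hg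
  obtain ⟨r₁, rfl, hr₁⟩ := hP _ (c := C.comp (add_zero 0) g f + -C.id X)
    ((cg.comp _ cf).add (DGCat.closed_id X).neg)
    (d_r₁.trans (by rw [P.map_add, P.map_neg, P.map_comp, P.map_id]))
  obtain ⟨r₂, rfl, hr₂⟩ := hP _ (c := C.comp (add_zero 0) f g + -C.id Y)
    ((cf.comp _ cg).add (DGCat.closed_id Y).neg)
    (d_r₂.trans (by rw [P.map_add, P.map_neg, P.map_comp, P.map_id]))
  obtain ⟨r₁₂, rfl, hr₁₂⟩ := hP _
    (DGCat.closed_of_d_eq_zero (KData.d_comp_sub_comp hf hr₁ hr₂))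
    (d_r₁₂.trans (by rw [P.map_add, P.map_neg, P.map_comp, P.map_comp]))
  exact ⟨⟨f, g, r₁, r₂, r₁₂, hf, hg, hr₁, hr₂, hr₁₂⟩, rfl⟩

/-- A surjective quasi-isomorphism of complexes has the lifting property of a trivial fibration: an
arbitrary lift of `e` is corrected first in its boundary and then in its image. -/
theorem SurjectiveOnHoms.liftsBoundaries (hP : P.SurjectiveOnHoms)
    (h : ∀ X Y, P.QuasiIsoAt X Y) : P.LiftsBoundaries := by
  intro X Y n m hm c hc e he
  obtain ⟨h₁, h₂⟩ := (P.quasiIsoAt_iff X Y).1 (h X Y)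
  obtain ⟨e', rfl⟩ := hP e
  obtain ⟨z, hz⟩ := (h₁ (hc.sub (DGCat.closed_d hm e')) (by
    rw [_root_.map_sub, P.map_d, he, sub_self]
    exact .refl 0)).exists_d_eq n hm
  rw [sub_zero] at hz
  have hPz : D.Closed (P.map z) := DGCat.closed_of_d_eq_zero (h := hm) (by
    rw [← P.map_d, hz, _root_.map_sub, P.map_d, he, sub_self])
  obtain ⟨z', hz', y, hy⟩ := h₂ hPz
  obtain ⟨y, rfl⟩ := hP y
  -- Here `z` corrects the boundary, since `d z = c - d e'`. The cocycle `z'` and the boundary `d y`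
  -- restore the image, since `d (P y) = P z' - P z`.
  refine ⟨e' + z - z' + C.d (n - 1) n (by lia) y, ?_, ?_⟩
  · rw [P.map_add, _root_.map_sub, P.map_add, P.map_d, hy]
    abel
  · rw [_root_.map_add, _root_.map_sub, _root_.map_add, C.d_d, hz, hz'.d_eq_zero]
    abel

/-- A homotopy equivalence from an image object to `Y'` extends to `K`-data, and the lift of this
data has an object lying strictly over `Y'`. -/
theorem LiftsKData.surjective (hP : P.LiftsKData) (h : P.QuasiEssSurj) :
    Function.Surjective P.obj := by
  intro Y'
  obtain ⟨X, f, g, hX⟩ := h Y'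
  obtain ⟨a, -⟩ := KData.exists_of_areInverse hX
  obtain ⟨Y, hY, -⟩ := hP a
  exact ⟨Y, hY⟩

/-- The lifted equivalence extends to `K`-data `b`. The image of `b` has the same `f` as the given
data, so the two differ by a perturbation, and its parameters lift because `P` is surjective on
morphisms. -/
theorem SurjectiveOnHoms.liftsKData (hP : P.SurjectiveOnHoms)
    (h : ∀ {X : C.Obj} {Y' : D.Obj} {f : D.Hom (P.obj X) Y' 0} {g : D.Hom Y' (P.obj X) 0},
      D.AreInverse f g → ∃ (Y : C.Obj) (h : P.obj Y = Y') (f' : C.Hom X Y 0) (g' : C.Hom Y X 0),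
        C.AreInverse f' g' ∧ D.castHom rfl h 0 (P.map f') = f) : P.LiftsKData := by
  intro X Y' a
  obtain ⟨Y, rfl, f, g, hfg, hf⟩ := h a.areInverse
  obtain ⟨b, rfl, -⟩ := KData.exists_of_areInverse hfg
  obtain ⟨e₂₁, e₁₁, e₂₂, e₁₂, rfl⟩ := KData.eq_perturb (a := b.map P) hf
  obtain ⟨e₂₁, rfl⟩ := hP e₂₁
  obtain ⟨e₁₁, rfl⟩ := hP e₁₁
  obtain ⟨e₂₂, rfl⟩ := hP e₂₂
  obtain ⟨e₁₂, rfl⟩ := hP e₁₂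
  exact ⟨Y, rfl, b.perturb e₂₁ e₁₁ e₂₂ e₁₂, KData.map_perturb _ _ _ _ _ _⟩

end DGFunctor

/-! ### Lifting against `S(n)`, `R(n)` and `F`, in terms of morphisms -/

section

variable {C D : DGCat k} (P : C ⟶ D)

theorem catP.functor_map_functorS_gen {X Y : D.Obj} {n : ℤ} (e : D.Hom X Y (-n)) :
    DGFunctor.map (functorS k n ≫ catP.functor e) (catC.gen n) =
      D.d (-n) (1 - n) (by lia) e :=
  (congrArg (fun x : (catP k n).Hom (catP.src n) (catP.tgt n) (1 - n) =>
    DGFunctor.map (catP.functor e) x) (catP.d_gen n).symm).trans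
      ((DGFunctor.map_d _ _ _ _ _).trans (congrArg _ (catP.functor_map_gen e)))

/-- A commutative square from `S(n)` to `P` is a cocycle `c` of degree `1 - n` with a morphism `e`
of degree `-n` such that `d e = P c`, up to transport along equalities of objects. -/
theorem hasLiftingProperty_functorS_iff (n : ℤ) : HasLiftingProperty (functorS k n) P ↔
    ∀ {X Y : C.Obj} {c : C.Hom X Y (1 - n)}, C.Closed c →
      ∀ {e : D.Hom (P.obj X) (P.obj Y) (-n)}, D.d (-n) (1 - n) (by lia) e = P.map c →
        ∃ e' : C.Hom X Y (-n), P.map e' = e ∧ C.d (-n) (1 - n) (by lia) e' = c := by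
  constructor
  · intro h X Y c hc e he
    have sq : CommSq (catC.functor c hc) (functorS k n) P (catP.functor e) := ⟨by
      refine catC.hom_ext rfl rfl ?_
      exact (congrArg P.map (catC.functor_map_gen c hc)).trans
        ((catP.functor_map_functorS_gen e).trans he).symm⟩
    have hX : sq.lift.obj (catP.src n) = X := DGFunctor.obj_of_eq sq.fac_left (catC.src n)
    have hY : sq.lift.obj (catP.tgt n) = Y := DGFunctor.obj_of_eq sq.fac_left (catC.tgt n)
    refine ⟨C.castHom hX hY _ (sq.lift.map (catP.gen n)), ?_, ?_⟩
    · rw [DGFunctor.map_castHom]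
      exact (DGFunctor.map_of_eq sq.fac_right (catP.gen n)).trans (catP.functor_map_gen e)
    · rw [← C.castHom_d, ← DGFunctor.map_d, catP.d_gen]
      exact (DGFunctor.map_of_eq sq.fac_left (catC.gen n)).trans (catC.functor_map_gen c hc)
  · refine fun h => ⟨fun {t b} sq => ?_⟩
    have hX : b.obj (catP.src n) = P.obj (t.obj (catC.src n)) :=
      (DGFunctor.obj_of_eq sq.w (catC.src n)).symm
    have hY : b.obj (catP.tgt n) = P.obj (t.obj (catC.tgt n)) :=
      (DGFunctor.obj_of_eq sq.w (catC.tgt n)).symm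
    have hc : C.Closed (t.map (catC.gen n)) := by
      rw [DGCat.Closed, ← DGFunctor.map_d, catC.d_gen, DGFunctor.map_zero]
    obtain ⟨e, he, hd⟩ := h hc (e := D.castHom hX hY _ (b.map (catP.gen n))) (by
      rw [← D.castHom_d, ← DGFunctor.map_d, catP.d_gen]
      exact DGFunctor.map_of_eq sq.w.symm (catC.gen n))
    refine ⟨⟨⟨catP.functor e, ?_, ?_⟩⟩⟩
    · exact catC.hom_ext rfl rfl ((catP.functor_map_functorS_gen e).trans hd)
    · refine catP.hom_ext hX.symm hY.symm ?_
      have h₁ : DGFunctor.map (catP.functor e ≫ P) (catP.gen n) =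
          D.castHom hX hY _ (b.map (catP.gen n)) :=
        (congrArg P.map (catP.functor_map_gen e)).trans he
      exact (congrArg _ h₁).trans (D.castHom_castHom _ _ _ _ _)

theorem hasLiftingProperty_functorR_iff (n : ℤ) : HasLiftingProperty (functorR k n) P ↔
    ∀ {X Y : C.Obj} (e : D.Hom (P.obj X) (P.obj Y) (-n)), ∃ e' : C.Hom X Y (-n), P.map e' = e := by
  constructor
  · intro h X Y e
    have sq : CommSq (catB.functor X Y) (functorR k n) P (catP.functor e) :=
      ⟨catB.hom_ext rfl rfl⟩
    have hX : sq.lift.obj (catP.src n) = X := DGFunctor.obj_of_eq sq.fac_left catB.src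
    have hY : sq.lift.obj (catP.tgt n) = Y := DGFunctor.obj_of_eq sq.fac_left catB.tgt
    refine ⟨C.castHom hX hY _ (sq.lift.map (catP.gen n)), ?_⟩
    rw [DGFunctor.map_castHom]
    exact (DGFunctor.map_of_eq sq.fac_right (catP.gen n)).trans (catP.functor_map_gen e)
  · refine fun h => ⟨fun {t b} sq => ?_⟩
    have hX : b.obj (catP.src n) = P.obj (t.obj catB.src) :=
      (DGFunctor.obj_of_eq sq.w catB.src).symm
    have hY : b.obj (catP.tgt n) = P.obj (t.obj catB.tgt) :=
      (DGFunctor.obj_of_eq sq.w catB.tgt).symm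
    obtain ⟨e, he⟩ := h (D.castHom hX hY _ (b.map (catP.gen n)))
    refine ⟨⟨⟨catP.functor e, catB.hom_ext rfl rfl, ?_⟩⟩⟩
    refine catP.hom_ext hX.symm hY.symm ?_
    have h₁ : DGFunctor.map (catP.functor e ≫ P) (catP.gen n) =
        D.castHom hX hY _ (b.map (catP.gen n)) :=
      (congrArg P.map (catP.functor_map_gen e)).trans he
    exact (congrArg _ h₁).trans (D.castHom_castHom _ _ _ _ _)

/-- A square from `F` to `P` is an object `X` of `C` together with `K`-data in `D` whose first
object is `P X`. -/
theorem hasLiftingProperty_functorF_iff : HasLiftingProperty (functorF k) P ↔ P.LiftsKData := by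
  have cast_map : ∀ {X X' Y Y' : C.Obj} (hX : X = X') (hY : Y = Y') (a : KData C X Y),
      (a.cast hX hY).map P = (a.map P).cast (congrArg P.obj hX) (congrArg P.obj hY) := by
    rintro X _ Y _ rfl rfl a; rfl
  have cast_cast : ∀ {X X' X'' Y Y' Y'' : D.Obj} (hX : X = X') (hY : Y = Y') (hX' : X' = X'')
      (hY' : Y' = Y'') (a : KData D X Y),
      (a.cast hX hY).cast hX' hY' = a.cast (hX.trans hX') (hY.trans hY') := by
    rintro X _ _ Y _ _ rfl rfl rfl rfl a; rfl
  have map_of_eq : ∀ {F G : catK k ⟶ D} (h : F = G), ((KData.univ k).map F).cast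
      (DGFunctor.obj_of_eq h _) (DGFunctor.obj_of_eq h _) = (KData.univ k).map G := by
    rintro F _ rfl; rfl
  constructor
  · intro h X Y' a
    have sq : CommSq (C.pick X) (functorF k) P a.functor := ⟨catA_hom_ext rfl⟩
    have hX : sq.lift.obj (KData.src k) = X := DGFunctor.obj_of_eq sq.fac_left PUnit.unit
    have hY : P.obj (sq.lift.obj (KData.tgt k)) = Y' :=
      DGFunctor.obj_of_eq sq.fac_right (KData.tgt k)
    refine ⟨sq.lift.obj (KData.tgt k), hY, ((KData.univ k).map sq.lift).cast hX rfl, ?_⟩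
    rw [cast_map, cast_cast]
    exact map_of_eq sq.fac_right
  · refine fun h => ⟨fun {t b} sq => ?_⟩
    have hX : b.obj (KData.src k) = P.obj (t.obj PUnit.unit) :=
      (DGFunctor.obj_of_eq sq.w PUnit.unit).symm
    obtain ⟨Y, hY, a, ha⟩ := h (((KData.univ k).map b).cast hX rfl)
    refine ⟨⟨⟨a.functor, catA_hom_ext rfl, ?_⟩⟩⟩
    refine KData.hom_ext hX.symm hY ?_
    have h₁ := congrArg (KData.cast hX.symm rfl) ha
    rw [cast_cast, cast_cast] at h₁
    exact h₁

end

/-! ### The classes `I`-inj and `J`-inj -/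

section

variable {C D : DGCatp k} (P : C ⟶ D)

theorem hasLiftingProperty_morphismQ_iff :
    HasLiftingProperty (morphismQ k) P ↔ Function.Surjective P.functor.obj := by
  constructor
  · intro h Y
    have sq : CommSq (fromInitial C) (morphismQ k) P
        (AdjoinZero.extend (D := D) (D.cat.pick Y)) :=
      ⟨(isInitialInitialDGCatp k).hom_ext _ _⟩
    refine ⟨sq.lift.functor.obj (some PUnit.unit), ?_⟩
    exact DGFunctor.obj_of_eq (congrArg DGCatp.Functor.functor sq.fac_right) (some PUnit.unit)
  · refine fun h => ⟨fun {t b} sq => ?_⟩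
    obtain ⟨X, hX⟩ := h (b.functor.obj (some PUnit.unit))
    refine ⟨⟨⟨AdjoinZero.extend (D := C) (C.cat.pick X), (isInitialInitialDGCatp k).hom_ext _ _, ?_⟩⟩⟩
    exact AdjoinZero.ext_inclusion (catA_hom_ext hX)

theorem rlp_generatingCofibrations_iff : (generatingCofibrations k).rlp P ↔
    P.functor.LiftsBoundaries ∧ Function.Surjective P.functor.obj := by
  constructor
  · intro h
    refine ⟨fun {X Y n m} hm {c} hc {e} he => ?_,
      (hasLiftingProperty_morphismQ_iff P).1 (h _ (.inl ⟨()⟩))⟩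
    -- The dg functor with index `n` governs morphisms of cohomological degree `-n`.
    obtain ⟨n, rfl⟩ : ∃ n', n = -n' := ⟨-n, by lia⟩
    obtain rfl : m = 1 - n := by lia
    exact (hasLiftingProperty_functorS_iff P.functor n).1
      (((AdjoinZero.adjunction k).hasLiftingProperty_iff _ P).1 (h _ (.inr ⟨n⟩))) hc he
  · rintro ⟨h₁, h₂⟩ A B i (⟨⟨⟩⟩ | ⟨@⟨n⟩⟩)
    · exact (hasLiftingProperty_morphismQ_iff P).2 h₂
    · exact ((AdjoinZero.adjunction k).hasLiftingProperty_iff _ P).2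
        ((hasLiftingProperty_functorS_iff P.functor n).2 fun hc _ he => h₁ _ hc he)

theorem rlp_generatingTrivialCofibrations_iff : (generatingTrivialCofibrations k).rlp P ↔
    P.functor.SurjectiveOnHoms ∧ P.functor.LiftsKData := by
  constructor
  · intro h
    refine ⟨fun {X Y n} e => ?_, (hasLiftingProperty_functorF_iff P.functor).1
      (((AdjoinZero.adjunction k).hasLiftingProperty_iff _ P).1 (h _ (.inl ⟨()⟩)))⟩
    obtain ⟨n, rfl⟩ : ∃ n', n = -n' := ⟨-n, by lia⟩
    exact (hasLiftingProperty_functorR_iff P.functor n).1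
      (((AdjoinZero.adjunction k).hasLiftingProperty_iff _ P).1 (h _ (.inr ⟨n⟩))) e
  · rintro ⟨h₁, h₂⟩ A B i (⟨⟨⟩⟩ | ⟨@⟨n⟩⟩)
    · exact ((AdjoinZero.adjunction k).hasLiftingProperty_iff _ P).2
        ((hasLiftingProperty_functorF_iff P.functor).2 h₂)
    · exact ((AdjoinZero.adjunction k).hasLiftingProperty_iff _ P).2
        ((hasLiftingProperty_functorR_iff P.functor n).2 fun e => h₁ e)

end

/-- On morphisms this is the equivalence between lifting boundaries and being a surjective
quasi-isomorphism. On objects, `K`-data lifting upgrades essential surjectivity on `H⁰` to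
surjectivity. -/
theorem rlp_generatingCofibrations (k : Type u) [CommRing k] : (generatingCofibrations k).rlp =
    quasiEquivalences k ⊓ (generatingTrivialCofibrations k).rlp := by
  ext C D P
  rw [rlp_generatingCofibrations_iff]
  constructor
  · rintro ⟨h₁, h₂⟩
    exact ⟨h₁.isQuasiEquivalence h₂,
      (rlp_generatingTrivialCofibrations_iff P).2 ⟨h₁.surjectiveOnHoms, h₁.liftsKData h₂⟩⟩
  · rintro ⟨h₁, h₂⟩
    obtain ⟨h₂, h₃⟩ := (rlp_generatingTrivialCofibrations_iff P).1 h₂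
    obtain ⟨h₁, h₄⟩ := (DGFunctor.isQuasiEquivalence_iff _).1 h₁
    exact ⟨h₂.liftsBoundaries h₁, h₃.surjective h₄⟩

/-! ## Path objects -/

namespace DGCat

section

variable {C : DGCat k} {X Y Z : C.Obj}

theorem d_comp_of_closed_right {q p n q' n' : ℤ} {h : q + p = n} (hq : q + 1 = q')
    {hn : n + 1 = n'} (g : C.Hom Y Z q) {f : C.Hom X Y p} (hf : C.Closed f) :
    C.d n n' hn (C.comp h g f) = C.comp (by lia) (C.d q q' hq g) f := by
  rw [C.leibniz h hq rfl hn, hf, map_zero, smul_zero, add_zero]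

theorem d_comp_of_closed_left {q p n p' n' : ℤ} {h : q + p = n} (hp : p + 1 = p')
    {hn : n + 1 = n'} {g : C.Hom Y Z q} (f : C.Hom X Y p) (hg : C.Closed g) :
    C.d n n' hn (C.comp h g f) = q.negOnePow • C.comp (by lia) g (C.d p p' hp f) := by
  rw [C.leibniz h rfl hp hn, hg, map_zero, LinearMap.zero_apply, zero_add]

theorem d_comp_of_closed_left_zero {p p' : ℤ} {h : 0 + p = p} {hp : p + 1 = p'} {g : C.Hom Y Z 0}
    (f : C.Hom X Y p) (hg : C.Closed g) :
    C.d p p' hp (C.comp h g f) = C.comp (zero_add p') g (C.d p p' hp f) := by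
  rw [d_comp_of_closed_left hp f hg, Int.negOnePow_zero, one_smul]

end

variable (B : DGCat k)

/-- The objects of the path object: morphisms that are invertible up to homotopy. -/
structure PathObj : Type u where
  src : B.Obj
  tgt : B.Obj
  f : B.Hom src tgt 0
  invertible : ∃ g, B.AreInverse f g

namespace PathObj

variable {B}

theorem closed (x : B.PathObj) : B.Closed x.f := by
  obtain ⟨g, h⟩ := x.invertible
  exact h.closed

/-- The morphisms of the path object: squares that commute up to a specified homotopy. -/
abbrev Hom (x y : B.PathObj) (n : ℤ) : Type u :=
  B.Hom x.src y.src n × B.Hom x.tgt y.tgt n × B.Hom x.src y.tgt (n - 1)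

/-- The differential. -/
def diff {x y : B.PathObj} (p q : ℤ) (h : p + 1 = q) : Hom x y p →ₗ[k] Hom x y q where
  -- The third component compares the defect of commutativity of the square with the differential of
  -- the homotopy; the minus sign before `d` makes the square of the differential vanish.
  toFun a := (B.d p q h a.1, B.d p q h a.2.1,
    B.comp (show 0 + p = q - 1 by lia) y.f a.1 - B.comp (show p + 0 = q - 1 by lia) a.2.1 x.f -
      B.d (p - 1) (q - 1) (by lia) a.2.2)
  map_add' a b := by
    refine Prod.ext (map_add _ _ _) (Prod.ext (map_add _ _ _) ?_)
    simp only [Prod.fst_add, Prod.snd_add, map_add, LinearMap.add_apply]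
    abel
  map_smul' c a := by
    refine Prod.ext (map_smul _ _ _) (Prod.ext (map_smul _ _ _) ?_)
    simp [smul_sub]

/-- The composition. -/
def comp {x y z : B.PathObj} {q p n : ℤ} (h : q + p = n) :
    Hom y z q →ₗ[k] Hom x y p →ₗ[k] Hom x z n :=
  LinearMap.mk₂ k
    (fun b a => (B.comp h b.1 a.1, B.comp h b.2.1 a.2.1,
      q.negOnePow • B.comp (show q + (p - 1) = n - 1 by lia) b.2.1 a.2.2 +
        B.comp (show q - 1 + p = n - 1 by lia) b.2.2 a.1))
    (fun b b' a => by
      refine Prod.ext (by simp) (Prod.ext (by simp) ?_)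
      simp only [Prod.fst_add, Prod.snd_add, map_add, LinearMap.add_apply, smul_add]
      abel)
    (fun c b a => by
      refine Prod.ext (by simp) (Prod.ext (by simp) ?_)
      simp only [Prod.smul_fst, Prod.smul_snd, map_smul, LinearMap.smul_apply, smul_add]
      rw [smul_comm])
    (fun b a a' => by
      refine Prod.ext (by simp) (Prod.ext (by simp) ?_)
      simp only [Prod.fst_add, Prod.snd_add, map_add, smul_add]
      abel)
    (fun c b a => by
      refine Prod.ext (by simp) (Prod.ext (by simp) ?_)
      simp only [Prod.smul_fst, Prod.smul_snd, map_smul, smul_add]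
      rw [smul_comm])

theorem diff_diff {x y : B.PathObj} (p q r : ℤ) (h : p + 1 = q) (h' : q + 1 = r) (a : Hom x y p) :
    diff q r h' (diff p q h a) = 0 := by
  obtain ⟨a, b, e⟩ := a
  refine Prod.ext (B.d_d _ _ _ _ _ _) (Prod.ext (B.d_d _ _ _ _ _ _) ?_)
  change B.comp (show 0 + q = r - 1 by lia) y.f (B.d p q h a) -
    B.comp (show q + 0 = r - 1 by lia) (B.d p q h b) x.f -
    B.d (q - 1) (r - 1) (by lia) (B.comp (show 0 + p = q - 1 by lia) y.f a -
      B.comp (show p + 0 = q - 1 by lia) b x.f - B.d (p - 1) (q - 1) (by lia) e) = 0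
  rw [map_sub, map_sub, B.d_d, d_comp_of_closed_left h _ y.closed, d_comp_of_closed_right h _ x.closed,
    Int.negOnePow_zero, one_smul, sub_zero, sub_self]

theorem leibniz {x y z : B.PathObj} {q p n q' p' n' : ℤ} (h : q + p = n) (hq : q + 1 = q')
    (hp : p + 1 = p') (hn : n + 1 = n') (b : Hom y z q) (a : Hom x y p) :
    diff n n' hn (comp h b a) =
      comp (show q' + p = n' by lia) (diff q q' hq b) a +
        q.negOnePow • comp (show q + p' = n' by lia) b (diff p p' hp a) := by
  obtain ⟨a', b', e'⟩ := b
  obtain ⟨a, b, e⟩ := a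
  refine Prod.ext (B.leibniz _ _ _ _ _ _) (Prod.ext (B.leibniz _ _ _ _ _ _) ?_)
  -- Only the homotopy component needs a calculation. The terms through `y.f` cancel, and the sign
  -- `(-1)^q` in the composition accounts for the degree shift.
  change B.comp (show 0 + n = n' - 1 by lia) z.f (B.comp h a' a) -
      B.comp (show n + 0 = n' - 1 by lia) (B.comp h b' b) x.f -
      B.d (n - 1) (n' - 1) (by lia)
        (q.negOnePow • B.comp (show q + (p - 1) = n - 1 by lia) b' e +
          B.comp (show q - 1 + p = n - 1 by lia) e' a) =
    q'.negOnePow • B.comp (show q' + (p - 1) = n' - 1 by lia) (B.d q q' hq b') e +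
      B.comp (show q' - 1 + p = n' - 1 by lia)
        (B.comp (show 0 + q = q' - 1 by lia) z.f a' -
          B.comp (show q + 0 = q' - 1 by lia) b' y.f - B.d (q - 1) (q' - 1) (by lia) e') a +
      q.negOnePow • (q.negOnePow • B.comp (show q + (p' - 1) = n' - 1 by lia) b'
          (B.comp (show 0 + p = p' - 1 by lia) y.f a -
            B.comp (show p + 0 = p' - 1 by lia) b x.f - B.d (p - 1) (p' - 1) (by lia) e) +
        B.comp (show q - 1 + p' = n' - 1 by lia) e' (B.d p p' hp a))
  obtain rfl : q' = q + 1 := by lia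
  rw [map_add, Units.smul_def, map_zsmul, ← Units.smul_def,
    B.leibniz (show q + (p - 1) = n - 1 by lia) hq (show p - 1 + 1 = p' - 1 by lia) (by lia),
    B.leibniz (show q - 1 + p = n - 1 by lia) (show q - 1 + 1 = q + 1 - 1 by lia) hp (by lia),
    Int.negOnePow_succ, Int.negOnePow_sub, Int.negOnePow_one]
  simp only [map_sub, LinearMap.sub_apply, smul_add, smul_sub, smul_smul, Int.units_mul_self,
    one_smul, mul_neg, mul_one, Units.neg_smul]
  rw [← B.assoc (show 0 + q = q + 1 - 1 by lia) h (show q + 1 - 1 + p = n' - 1 by lia)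
      (show 0 + n = n' - 1 by lia),
    B.assoc (show q + 0 = q + 1 - 1 by lia) (show 0 + p = p' - 1 by lia)
      (show q + 1 - 1 + p = n' - 1 by lia) (show q + (p' - 1) = n' - 1 by lia),
    B.assoc h (show p + 0 = p' - 1 by lia) (show n + 0 = n' - 1 by lia)
      (show q + (p' - 1) = n' - 1 by lia)]
  abel

end PathObj

/-- The path object of a dg category. -/
def path : DGCat k where
  Obj := B.PathObj
  Hom := PathObj.Hom
  d := PathObj.diff
  id x := (B.id x.src, B.id x.tgt, 0)
  comp := PathObj.comp
  d_d := PathObj.diff_diff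
  leibniz := PathObj.leibniz
  id_comp {x y p} a := by
    refine Prod.ext (B.id_comp _) (Prod.ext (B.id_comp _) ?_)
    change (0 : ℤ).negOnePow • B.comp _ (B.id y.tgt) a.2.2 + B.comp _ 0 a.1 = a.2.2
    rw [Int.negOnePow_zero, one_smul, B.id_comp, map_zero, LinearMap.zero_apply, add_zero]
  comp_id {x y p} a := by
    refine Prod.ext (B.comp_id _) (Prod.ext (B.comp_id _) ?_)
    change p.negOnePow • B.comp _ a.2.1 0 + B.comp _ a.2.2 (B.id x.src) = a.2.2
    rw [B.comp_id, map_zero, smul_zero, zero_add]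
  assoc {x y z t r q p rq qp n} h₁ h₂ h₃ h₄ c b a := by
    refine Prod.ext (B.assoc _ _ _ _ _ _ _) (Prod.ext (B.assoc _ _ _ _ _ _ _) ?_)
    change rq.negOnePow • B.comp (show rq + (p - 1) = n - 1 by lia) (B.comp h₁ c.2.1 b.2.1) a.2.2 +
        B.comp (show rq - 1 + p = n - 1 by lia)
          (r.negOnePow • B.comp (show r + (q - 1) = rq - 1 by lia) c.2.1 b.2.2 +
            B.comp (show r - 1 + q = rq - 1 by lia) c.2.2 b.1) a.1 =
      r.negOnePow • B.comp (show r + (qp - 1) = n - 1 by lia) c.2.1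
        (q.negOnePow • B.comp (show q + (p - 1) = qp - 1 by lia) b.2.1 a.2.2 +
          B.comp (show q - 1 + p = qp - 1 by lia) b.2.2 a.1) +
        B.comp (show r - 1 + qp = n - 1 by lia) c.2.2 (B.comp h₂ b.1 a.1)
    subst h₁
    simp only [map_add, LinearMap.add_apply, Units.smul_def, map_zsmul, LinearMap.smul_apply]
    simp only [← Units.smul_def, smul_add, smul_smul, Int.negOnePow_add]
    rw [B.assoc rfl (show q + (p - 1) = qp - 1 by lia) (show r + q + (p - 1) = n - 1 by lia)
        (show r + (qp - 1) = n - 1 by lia),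
      B.assoc (show r + (q - 1) = r + q - 1 by lia) (show q - 1 + p = qp - 1 by lia)
        (show r + q - 1 + p = n - 1 by lia) (show r + (qp - 1) = n - 1 by lia),
      B.assoc (show r - 1 + q = r + q - 1 by lia) h₂
        (show r + q - 1 + p = n - 1 by lia) (show r - 1 + qp = n - 1 by lia), add_assoc]

/-- The evaluation of the path object at the source. -/
def pathSrc : B.path ⟶ B where
  obj x := x.src
  map := LinearMap.fst k _ _
  map_d _ _ _ _ := rfl
  map_id _ := rfl
  map_comp _ _ _ := rfl

/-- The evaluation of the path object at the target. -/
def pathTgt : B.path ⟶ B where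
  obj x := x.tgt
  map := LinearMap.fst k _ _ ∘ₗ LinearMap.snd k _ _
  map_d _ _ _ _ := rfl
  map_id _ := rfl
  map_comp _ _ _ := rfl

/-- The constant path. -/
def PathObj.const {B : DGCat k} (X : B.Obj) : B.PathObj := ⟨X, X, B.id X, _, .id X⟩

/-- The constant paths. -/
def pathConst : B ⟶ B.path where
  obj X := PathObj.const X
  map := LinearMap.prod LinearMap.id (LinearMap.prod LinearMap.id 0)
  map_d {X Y} p q h f := by
    -- The homotopy component lies in degree `q - 1`, equal to `p` only propositionally, so the
    -- degree is generalised.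
    have key : ∀ (r : ℤ) (hr : p = r), (0 : B.Hom X Y r) =
        B.comp (show 0 + p = r by lia) (B.id Y) f - B.comp (show p + 0 = r by lia) f (B.id X) -
          B.d (p - 1) r (by lia) 0 := by
      rintro _ rfl
      rw [B.id_comp, B.comp_id, map_zero, sub_self, sub_zero]
    exact Prod.ext rfl (Prod.ext rfl (key (q - 1) (by lia)))
  map_id _ := rfl
  map_comp {X Y Z q p n} h g f := by
    have key : (0 : B.Hom X Z (n - 1)) =
        q.negOnePow • B.comp (show q + (p - 1) = n - 1 by lia) g 0 +
          B.comp (show q - 1 + p = n - 1 by lia) 0 f := by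
      rw [map_zero, map_zero, LinearMap.zero_apply, smul_zero, add_zero]
    exact Prod.ext rfl (Prod.ext rfl key)

end DGCat

/-! ## The path object is a factorization of the diagonal -/

namespace DGCat

variable {B : DGCat k}

theorem PathObj.closed_iff {x y : B.PathObj} {n : ℤ} {a : B.Hom x.src y.src n}
    {b : B.Hom x.tgt y.tgt n} {h : B.Hom x.src y.tgt (n - 1)} :
    B.path.Closed (X := x) (Y := y) (n := n) (a, b, h) ↔ B.Closed a ∧ B.Closed b ∧
      B.d (n - 1) n (by lia) h =
        B.comp (zero_add n) y.f a - B.comp (add_zero n) b x.f := by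
  have key : ∀ (r : ℤ) (hr : n = r),
      (B.comp (show 0 + n = r by lia) y.f a - B.comp (show n + 0 = r by lia) b x.f -
        B.d (n - 1) r (by lia) h = 0 ↔ B.d (n - 1) n (by lia) h =
        B.comp (zero_add n) y.f a - B.comp (add_zero n) b x.f) := by
    rintro _ rfl
    rw [sub_eq_zero, eq_comm]
  refine Iff.trans ?_ (and_congr_right' (and_congr_right' (key (n + 1 - 1) (by lia))))
  exact Prod.ext_iff.trans (and_congr_right' Prod.ext_iff)

theorem PathObj.homotopic_zero_iff {x y : B.PathObj} {n : ℤ} {a : B.Hom x.src y.src n}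
    {b : B.Hom x.tgt y.tgt n} {h : B.Hom x.src y.tgt (n - 1)} :
    B.path.Homotopic (X := x) (Y := y) (n := n) (a, b, h) (0, 0, 0) ↔
      ∃ (α : B.Hom x.src y.src (n - 1)) (β : B.Hom x.tgt y.tgt (n - 1))
        (γ : B.Hom x.src y.tgt (n - 1 - 1)), B.d (n - 1) n (by lia) α = a ∧
        B.d (n - 1) n (by lia) β = b ∧ B.comp (zero_add (n - 1)) y.f α -
          B.comp (add_zero (n - 1)) β x.f - B.d (n - 1 - 1) (n - 1) (by lia) γ = h := by
  constructor
  · rintro ⟨⟨α, β, γ⟩, e⟩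
    have e' := Prod.ext_iff.1 (Prod.ext_iff.1 e).2
    exact ⟨α, β, γ, (Prod.ext_iff.1 e).1.trans (sub_zero a), e'.1.trans (sub_zero b),
      e'.2.trans (sub_zero h)⟩
  · rintro ⟨α, β, γ, rfl, rfl, rfl⟩
    exact ⟨(α, β, γ), Prod.ext (sub_zero _).symm (Prod.ext (sub_zero _).symm (sub_zero _).symm)⟩

/-- The kernel of evaluation at the source consists of the pairs `(b, h)`; up to shift and signs it
is the cone of precomposition with `x.f` on morphisms into `y.tgt`. It is acyclic because `x.f` is
homotopy invertible; the proof writes out the contraction. -/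
theorem pathSrc_quasiIsoAt (x y : B.PathObj) :
    DGFunctor.QuasiIsoAt (C := B.path) B.pathSrc x y := by
  obtain ⟨g, hg⟩ := x.invertible
  obtain ⟨r₁, hr₁⟩ := hg.inv_comp.exists_d_eq (-1) (by lia)
  obtain ⟨r₂, hr₂⟩ := hg.comp_inv.exists_d_eq (-1) (by lia)
  have hf := PathObj.closed x
  have hf' := PathObj.closed y
  refine (DGFunctor.quasiIsoAt_iff (C := B.path) B.pathSrc x y).2 ⟨?_, ?_⟩
  · rintro n ⟨a, b, h⟩ hc ⟨(α : B.Hom x.src y.src (n - 1)), e⟩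
    obtain ⟨-, hb, hh⟩ := PathObj.closed_iff.1 hc
    rw [sub_zero] at e
    change B.d (n - 1) n (by lia) α = a at e
    subst e
    refine PathObj.homotopic_zero_iff.2 ?_
    -- The contribution of `α` is split off, leaving `(b, h₁)` with `d h₁ = -b f` in the kernel.
    obtain ⟨h₁, rfl⟩ : ∃ h₁, h = B.comp (zero_add (n - 1)) y.f α + h₁ :=
      ⟨h - B.comp (zero_add (n - 1)) y.f α, by abel⟩
    rw [map_add, d_comp_of_closed_left_zero _ hf'] at hh
    replace hh : B.d (n - 1) n (by lia) h₁ = -B.comp (add_zero n) b x.f := by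
      rw [← sub_eq_zero] at hh ⊢
      rw [← hh]; abel
    -- Since `b = b f g - b (d r₂)`, and both terms are boundaries, so is `b`.
    obtain ⟨β₀, hβ₀⟩ : ∃ β₀ : B.Hom x.tgt y.tgt (n - 1), B.d (n - 1) n (by lia) β₀ = b := by
      refine ⟨-B.comp (add_zero (n - 1)) h₁ g -
        n.negOnePow • B.comp (show n + -1 = n - 1 by lia) b r₂, ?_⟩
      rw [map_sub, map_neg, Units.smul_def, map_zsmul, ← Units.smul_def,
        d_comp_of_closed_right (show n - 1 + 1 = n by lia) _ hg.closed', hh,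
        d_comp_of_closed_left (p' := 0) (by lia) _ hb, hr₂, smul_smul, Int.units_mul_self, one_smul,
        map_neg, LinearMap.neg_apply, map_sub,
        B.assoc (add_zero n) (add_zero 0) (add_zero n) (add_zero n), B.comp_id]
      abel
    -- The remaining error `c` of `β₀` is closed. Subtracting `c g` from `β₀` replaces it by `c - c
    -- g f`, a boundary by means of `r₁`.
    obtain ⟨c, rfl⟩ : ∃ c, h₁ = c - B.comp (add_zero (n - 1)) β₀ x.f :=
      ⟨h₁ + B.comp (add_zero (n - 1)) β₀ x.f, by abel⟩
    have hcc : B.Closed c := by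
      rw [map_sub, d_comp_of_closed_right (show n - 1 + 1 = n by lia) _ hf, hβ₀,
        sub_eq_neg_self] at hh
      exact closed_of_d_eq_zero hh
    refine ⟨α, β₀ - B.comp (add_zero (n - 1)) c g,
      (n - 1).negOnePow • B.comp (show n - 1 + -1 = n - 1 - 1 by lia) c r₁, rfl, ?_, ?_⟩
    · rw [map_sub, hβ₀, (hcc.comp (add_zero (n - 1)) hg.closed').d_eq_zero, sub_zero]
    · rw [Units.smul_def, map_zsmul, ← Units.smul_def,
        d_comp_of_closed_left (p' := 0) (by lia) _ hcc, hr₁, smul_smul, Int.units_mul_self,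
        one_smul, map_sub, map_sub, LinearMap.sub_apply,
        B.assoc (add_zero (n - 1)) (add_zero 0) (add_zero (n - 1)) (add_zero (n - 1)), B.comp_id]
      abel
  · intro n (a : B.Hom x.src y.src n) ha
    have ha' : B.Closed (B.comp (zero_add n) y.f a) := hf'.comp _ ha
    -- A cocycle `a` is extended by its conjugate `y.f a g`; the square commutes up to the homotopy
    -- obtained from `g f ∼ 1`.
    refine ⟨(a, B.comp (add_zero n) (B.comp (zero_add n) y.f a) g,
      -(n.negOnePow • B.comp (show n + -1 = n - 1 by lia) (B.comp (zero_add n) y.f a) r₁)),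
      PathObj.closed_iff.2 ⟨ha, ha'.comp _ hg.closed', ?_⟩, .refl _⟩
    rw [map_neg, Units.smul_def, map_zsmul, ← Units.smul_def,
      d_comp_of_closed_left (p' := 0) (by lia) _ ha', hr₁, smul_smul, Int.units_mul_self, one_smul,
      map_sub, B.comp_id, B.assoc (add_zero n) (add_zero 0) (add_zero n) (add_zero n), neg_sub]

theorem pathSrc_isQuasiEquivalence (B : DGCat k) : B.pathSrc.IsQuasiEquivalence :=
  (DGFunctor.isQuasiEquivalence_iff _).2
    ⟨pathSrc_quasiIsoAt, fun X => ⟨PathObj.const X, .refl X⟩⟩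

/-- Two-out-of-three, since the constant path followed by evaluation at the source is the identity;
the evaluation at the target is then handled in the same way. -/
theorem pathConst_isQuasiEquivalence (B : DGCat k) : B.pathConst.IsQuasiEquivalence :=
  DGFunctor.IsQuasiEquivalence.of_postcomp (F := B.pathConst) (pathSrc_isQuasiEquivalence B)
    (DGFunctor.isQuasiEquivalence_id B)

theorem pathTgt_isQuasiEquivalence (B : DGCat k) : B.pathTgt.IsQuasiEquivalence :=
  DGFunctor.IsQuasiEquivalence.of_precomp (F := B.pathConst) (pathConst_isQuasiEquivalence B)
    (DGFunctor.isQuasiEquivalence_id B)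

/-- Equivalences `u` and `v` at the two ends transport `x.f` to `v f u'`, and the square commutes up
to `v f s` with `d s = u' u - 1`. No inverse square has to be written down: evaluation at the source
is a quasi-isomorphism on morphisms, so it reflects homotopy equivalences. -/
theorem PathObj.exists_areInverse {x : B.PathObj} {X Y : B.Obj} {u : B.Hom x.src X 0}
    {u' : B.Hom X x.src 0} {v : B.Hom x.tgt Y 0} {v' : B.Hom Y x.tgt 0} (hu : B.AreInverse u u')
    (hv : B.AreInverse v v') : ∃ (f : B.Hom X Y 0) (hf : ∃ g, B.AreInverse f g)
      (h : B.Hom x.src Y (0 - 1)) (w : PathObj.Hom ⟨X, Y, f, hf⟩ x 0),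
        B.path.AreInverse (X := x) (Y := (⟨X, Y, f, hf⟩ : B.PathObj)) (u, v, h) w := by
  obtain ⟨g, hg⟩ := x.invertible
  obtain ⟨s, hs⟩ := hu.inv_comp.exists_d_eq (0 - 1) (by lia)
  have hvf : B.Closed (B.comp (add_zero 0) v x.f) := hv.closed.comp _ hg.closed
  have key : B.d (0 - 1) 0 (by lia) (B.comp (zero_add (0 - 1)) (B.comp (add_zero 0) v x.f) s) =
      B.comp (add_zero 0) (B.comp (add_zero 0) (B.comp (add_zero 0) v x.f) u') u -
        B.comp (add_zero 0) v x.f := by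
    rw [d_comp_of_closed_left (p' := 0) (by lia) _ hvf, hs, Int.negOnePow_zero, one_smul, map_sub,
      B.comp_id, ← B.assoc (add_zero 0) (add_zero 0) (add_zero 0) (add_zero 0)]
  exact ⟨B.comp (add_zero 0) (B.comp (add_zero 0) v x.f) u', ⟨_, hu.symm.comp (hg.comp hv)⟩,
    B.comp (zero_add (0 - 1)) (B.comp (add_zero 0) v x.f) s,
    DGFunctor.exists_areInverse_of_map (F := B.pathSrc) pathSrc_quasiIsoAt
      (PathObj.closed_iff.2 ⟨hu.closed, hv.closed, key⟩) hu⟩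

/-! ### The product of two dg categories -/

/-- The product of two dg categories. -/
def prod (C D : DGCat k) : DGCat k where
  Obj := C.Obj × D.Obj
  Hom X Y p := C.Hom X.1 Y.1 p × D.Hom X.2 Y.2 p
  d p q h := (C.d p q h).prodMap (D.d p q h)
  id X := (C.id X.1, D.id X.2)
  comp h := LinearMap.mk₂ k (fun g f => (C.comp h g.1 f.1, D.comp h g.2 f.2))
    (fun _ _ _ => by simp) (fun _ _ _ => by simp) (fun _ _ _ => by simp) (fun _ _ _ => by simp)
  d_d p q r h h' f := Prod.ext (C.d_d p q r h h' f.1) (D.d_d p q r h h' f.2)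
  leibniz h hq hp hn g f :=
    Prod.ext (C.leibniz h hq hp hn g.1 f.1) (D.leibniz h hq hp hn g.2 f.2)
  id_comp f := Prod.ext (C.id_comp f.1) (D.id_comp f.2)
  comp_id f := Prod.ext (C.comp_id f.1) (D.comp_id f.2)
  assoc h₁ h₂ h₃ h₄ c g f :=
    Prod.ext (C.assoc h₁ h₂ h₃ h₄ c.1 g.1 f.1) (D.assoc h₁ h₂ h₃ h₄ c.2 g.2 f.2)

/-- The first projection. -/
def prodFst (C D : DGCat k) : C.prod D ⟶ C where
  obj X := X.1
  map := LinearMap.fst k _ _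
  map_d _ _ _ _ := rfl
  map_id _ := rfl
  map_comp _ _ _ := rfl

/-- The second projection. -/
def prodSnd (C D : DGCat k) : C.prod D ⟶ D where
  obj X := X.2
  map := LinearMap.snd k _ _
  map_d _ _ _ _ := rfl
  map_id _ := rfl
  map_comp _ _ _ := rfl

/-- The dg functor to a product given by its components. -/
def prodLift {C D E : DGCat k} (F : E ⟶ C) (G : E ⟶ D) : E ⟶ C.prod D where
  obj X := (F.obj X, G.obj X)
  map := LinearMap.prod F.map G.map
  map_d p q h f := Prod.ext (F.map_d p q h f) (G.map_d p q h f)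
  map_id X := Prod.ext (F.map_id X) (G.map_id X)
  map_comp h g f := Prod.ext (F.map_comp h g f) (G.map_comp h g f)

theorem path_surjectiveOnHoms (B : DGCat k) :
    (prodLift B.pathSrc B.pathTgt).SurjectiveOnHoms :=
  fun e => ⟨(e.1, e.2, 0), rfl⟩

theorem path_liftsKData (B : DGCat k) : (prodLift B.pathSrc B.pathTgt).LiftsKData := by
  refine DGFunctor.SurjectiveOnHoms.liftsKData (path_surjectiveOnHoms B) ?_
  rintro x ⟨X', Y'⟩ ⟨u, v⟩ ⟨u', v'⟩ h
  have hu : B.AreInverse u u' := (prodFst B B).map_areInverse h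
  have hv : B.AreInverse v v' := (prodSnd B B).map_areInverse h
  obtain ⟨f, hf, e, g, h⟩ := PathObj.exists_areInverse (x := x) hu hv
  exact ⟨(⟨X', Y', f, hf⟩ : B.PathObj), rfl, _, g, h, rfl⟩

end DGCat

/-! ## Trivial cofibrations are quasi-equivalences -/

namespace DGCatp

/-- The unique dg functor to the zero object. -/
def toZero (C : DGCatp k) : C ⟶ initialDGCatp k where
  functor :=
    { obj := fun _ => PUnit.unit
      map := 0
      map_d := fun _ _ _ _ => rfl
      map_id := fun _ => rfl
      map_comp := fun _ _ _ => rfl }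
  obj_pt := rfl

theorem hom_zero_ext {C : DGCatp k} (F G : C ⟶ initialDGCatp k) : F = G :=
  hom_ext (DGFunctor.ext_of_castHom (fun _ => rfl) fun _ _ _ _ => rfl)

/-- Every object is `J`-fibrant; `K`-data in the zero dg category lift to identity data. -/
theorem rlp_toZero (C : DGCatp k) : (generatingTrivialCofibrations k).rlp (toZero C) := by
  refine (rlp_generatingTrivialCofibrations_iff _).2 ⟨fun e => ⟨0, rfl⟩, ?_⟩
  intro X Y' a
  exact ⟨X, rfl, KData.refl X, rfl⟩

/-- The path object of a dg category with a distinguished zero object. -/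
def path (B : DGCatp k) : DGCatp k where
  cat := B.cat.path
  pt := DGCat.PathObj.const B.pt
  isZeroObject _ _ :=
    ⟨⟨fun _ _ => Prod.ext (B.hom_zero_left rfl _ _)
        (Prod.ext (B.hom_zero_left rfl _ _) (B.hom_zero_left rfl _ _))⟩,
      ⟨fun _ _ => Prod.ext (B.hom_zero_right rfl _ _)
        (Prod.ext (B.hom_zero_right rfl _ _) (B.hom_zero_right rfl _ _))⟩⟩

/-- The product of two dg categories with distinguished zero objects. -/
def prod (C D : DGCatp k) : DGCatp k where
  cat := C.cat.prod D.cat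
  pt := (C.pt, D.pt)
  isZeroObject _ _ :=
    ⟨⟨fun _ _ => Prod.ext (C.hom_zero_left rfl _ _) (D.hom_zero_left rfl _ _)⟩,
      ⟨fun _ _ => Prod.ext (C.hom_zero_right rfl _ _) (D.hom_zero_right rfl _ _)⟩⟩

/-- The morphism to a product given by its components. -/
def prodLift {C D E : DGCatp k} (F : E ⟶ C) (G : E ⟶ D) : E ⟶ C.prod D :=
  ⟨DGCat.prodLift F.functor G.functor, Prod.ext F.obj_pt G.obj_pt⟩

theorem eq_of_prodLift_eq {C D E : DGCatp k} {F F' : E ⟶ C} {G G' : E ⟶ D}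
    (h : prodLift F G = prodLift F' G') : F = F' ∧ G = G' :=
  ⟨hom_ext (congrArg (fun K : E ⟶ C.prod D => (forget k).map K ≫ DGCat.prodFst C.cat D.cat) h),
    hom_ext (congrArg (fun K : E ⟶ C.prod D => (forget k).map K ≫ DGCat.prodSnd C.cat D.cat) h)⟩

/-- The evaluation of the path object at the source. -/
def pathSrc (B : DGCatp k) : B.path ⟶ B := ⟨B.cat.pathSrc, rfl⟩

/-- The evaluation of the path object at the target. -/
def pathTgt (B : DGCatp k) : B.path ⟶ B := ⟨B.cat.pathTgt, rfl⟩

/-- The constant paths. -/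
def pathConst (B : DGCatp k) : B ⟶ B.path := ⟨B.cat.pathConst, rfl⟩

theorem rlp_prodLift_pathSrc_pathTgt (B : DGCatp k) :
    (generatingTrivialCofibrations k).rlp (prodLift B.pathSrc B.pathTgt) :=
  (rlp_generatingTrivialCofibrations_iff _).2
    ⟨DGCat.path_surjectiveOnHoms B.cat, DGCat.path_liftsKData B.cat⟩

/-- Quillen's path object argument: a map with the left lifting property against `J`-injective maps
is the inclusion of a deformation retract, up to right homotopy. -/
theorem llp_rlp_generatingTrivialCofibrations_le_quasiEquivalences :
    (generatingTrivialCofibrations k).rlp.llp ≤ quasiEquivalences k := by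
  intro A B j hj
  have := hj _ (rlp_toZero A)
  -- Fibrancy of `A` yields a retraction `r` of `j`.
  have sq : CommSq (𝟙 A) j (toZero A) (toZero B) := ⟨hom_zero_ext _ _⟩
  have hr : j ≫ sq.lift = 𝟙 A := sq.fac_left
  set r := sq.lift
  have := hj _ (rlp_prodLift_pathSrc_pathTgt B)
  -- The lift in this square is a right homotopy from the identity of `B` to `r ≫ j`, constant along
  -- `j`.
  have sq' : CommSq (j ≫ B.pathConst) j (prodLift B.pathSrc B.pathTgt)
      (prodLift (𝟙 B) (r ≫ j)) := ⟨by
    change prodLift j j = prodLift j (j ≫ r ≫ j)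
    rw [← Category.assoc, hr, Category.id_comp]⟩
  obtain ⟨h₁, h₂⟩ := eq_of_prodLift_eq (F := sq'.lift ≫ B.pathSrc) (G := sq'.lift ≫ B.pathTgt)
    sq'.fac_right
  have hH : quasiEquivalences k sq'.lift :=
    MorphismProperty.of_postcomp (W' := quasiEquivalences k) _ _ (pathSrc B) (DGCat.pathSrc_isQuasiEquivalence B.cat)
      (by rw [h₁]; exact MorphismProperty.id_mem _ _)
  have hrj : quasiEquivalences k (r ≫ j) := by
    rw [← h₂]
    exact MorphismProperty.comp_mem _ _ _ hH (DGCat.pathTgt_isQuasiEquivalence B.cat)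
  -- The retract is taken over the identity of `B`, with `j` and `r` on the sources, because only `r
  -- ≫ j` is known to be a quasi-equivalence.
  have retract : RetractArrow j (r ≫ j) :=
    { i := Arrow.homMk j (𝟙 B) (by
        change j ≫ r ≫ j = j ≫ 𝟙 B
        rw [← Category.assoc, hr, Category.id_comp, Category.comp_id])
      r := Arrow.homMk r (𝟙 B) (Category.comp_id _).symm
      retract := Arrow.hom_ext _ _ hr (Category.comp_id _) }
  exact MorphismProperty.of_retract retract hrj

theorem llp_rlp_generatingTrivialCofibrations_le :
    (generatingTrivialCofibrations k).rlp.llp ≤ (generatingCofibrations k).rlp.llp :=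
  MorphismProperty.antitone_llp (by
    rw [rlp_generatingCofibrations]
    exact inf_le_right)

end DGCatp

/-! ## The small object argument -/

theorem relativeCells_le_llp_rlp {C : Type u} [Category.{v} C] (I : MorphismProperty C) :
    relativeCells.{w} I ≤ I.rlp.llp := by
  refine (I.pushouts.transfiniteCompositions_le_llp_rlp).trans ?_
  rw [MorphismProperty.rlp_pushouts]

theorem preservesColimit_of_generatingCofibrations {A B : DGCatp k} (i : A ⟶ B)
    (hi : generatingCofibrations k i) {l : Type u} [Preorder l] [IsDirectedOrder l] [Nonempty l]
    (G : l ⥤ DGCatp k) : PreservesColimit G (coyoneda.obj (Opposite.op A)) := by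
  obtain ⟨⟨⟩⟩ | ⟨@⟨n⟩⟩ := hi
  · exact preservesColimit_initialDGCatp G
  · exact (catC_isCompact n).preservesColimit G

theorem preservesColimit_of_generatingTrivialCofibrations {A B : DGCatp k} (i : A ⟶ B)
    (hi : generatingTrivialCofibrations k i) {l : Type u} [Preorder l] [IsDirectedOrder l]
    [Nonempty l] (G : l ⥤ DGCatp k) : PreservesColimit G (coyoneda.obj (Opposite.op A)) := by
  obtain ⟨⟨⟩⟩ | ⟨@⟨n⟩⟩ := hi
  · exact catA_isCompact.preservesColimit G
  · exact catB_isCompact.preservesColimit G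

/-- Sequences of length `ω` suffice when morphisms out of the domains commute with all directed
colimits. -/
theorem hasSmallObjectArgument_of_preservesColimit (I : MorphismProperty (DGCatp k))
    [MorphismProperty.IsSmall.{u} I]
    (h : ∀ {A B : DGCatp k} (i : A ⟶ B), I i → ∀ {l : Type u} [Preorder l] [IsDirectedOrder l]
      [Nonempty l] (X : l ⥤ DGCatp k), PreservesColimit X (coyoneda.obj (Opposite.op A))) :
    MorphismProperty.HasSmallObjectArgument.{u} I where
  exists_cardinal :=
    have := Cardinal.fact_isRegular_aleph0
    letI := Cardinal.orderBotAleph0OrdToType.{u}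
    ⟨Cardinal.aleph0, Cardinal.fact_isRegular_aleph0,
    Cardinal.orderBotAleph0OrdToType,
    { preservesColimit := fun i hi _ hf => h i hi hf.F }⟩

instance : MorphismProperty.HasSmallObjectArgument.{u} (generatingCofibrations k) :=
  hasSmallObjectArgument_of_preservesColimit _ preservesColimit_of_generatingCofibrations

instance : MorphismProperty.HasSmallObjectArgument.{u} (generatingTrivialCofibrations k) :=
  hasSmallObjectArgument_of_preservesColimit _ preservesColimit_of_generatingTrivialCofibrations

/-- The retract argument: in a factorization of a quasi-equivalence into a `J`-cofibration and a
`J`-injective map, the second map is in `W` by two-out-of-three, hence `I`-injective. An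
`I`-cofibration lifts against it and is therefore a retract of the first map. -/
theorem quasiEquivalences_inf_llp_rlp_generatingCofibrations (k : Type u) [CommRing k] :
    quasiEquivalences k ⊓ (generatingCofibrations k).rlp.llp =
      (generatingTrivialCofibrations k).rlp.llp := by
  refine le_antisymm ?_ (le_inf DGCatp.llp_rlp_generatingTrivialCofibrations_le_quasiEquivalences
    DGCatp.llp_rlp_generatingTrivialCofibrations_le)
  rintro A B f ⟨hf, hf'⟩
  have h := MorphismProperty.factorizationData (generatingTrivialCofibrations k).rlp.llp
    (generatingTrivialCofibrations k).rlp f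
  have hp : (generatingCofibrations k).rlp h.p := by
    rw [rlp_generatingCofibrations]
    refine ⟨MorphismProperty.of_precomp _ h.i _
      (DGCatp.llp_rlp_generatingTrivialCofibrations_le_quasiEquivalences _ h.hi) ?_, h.hp⟩
    rwa [h.fac]
  have := hf' _ hp
  exact MorphismProperty.of_retract (RetractArrow.ofLeftLiftingProperty h.fac) h.hi

/-! ## The theorem -/

theorem smallRelativeTo_generatingCofibrations {A B : DGCatp k} (i : A ⟶ B)
    (hi : generatingCofibrations k i) (D : MorphismProperty (DGCatp k)) :
    IsSmallRelativeTo.{u} A D :=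
  isSmallRelativeTo_of_preservesColimit (preservesColimit_of_generatingCofibrations i hi) D

theorem smallRelativeTo_generatingTrivialCofibrations {A B : DGCatp k} (i : A ⟶ B)
    (hi : generatingTrivialCofibrations k i) (D : MorphismProperty (DGCatp k)) :
    IsSmallRelativeTo.{u} A D :=
  isSmallRelativeTo_of_preservesColimit (preservesColimit_of_generatingTrivialCofibrations i hi) D

theorem recognitionConditions (k : Type u) [CommRing k] :
    RecognitionConditions.{u} (quasiEquivalences k) (generatingCofibrations k)
      (generatingTrivialCofibrations k) where
  hasLimits := inferInstance
  hasColimits := inferInstance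
  isSubcategory := inferInstance
  isSmall_I := inferInstance
  isSmall_J := inferInstance
  twoOutOfThree := inferInstance
  retracts := inferInstance
  small_I _ _ i hi := smallRelativeTo_generatingCofibrations i hi _
  small_J _ _ i hi := smallRelativeTo_generatingTrivialCofibrations i hi _
  cell_J := (relativeCells_le_llp_rlp _).trans
    (quasiEquivalences_inf_llp_rlp_generatingCofibrations k).ge
  inj_I := (rlp_generatingCofibrations k).le
  last := .inl (quasiEquivalences_inf_llp_rlp_generatingCofibrations k).le

variable (k) in
/-- The model structure on the category of small dg categories with a distinguished zero object. -/
@[reducible]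
def DGCatp.modelCategory : ModelCategory (DGCatp k) :=
  letI : CategoryWithFibrations (DGCatp k) := ⟨(generatingTrivialCofibrations k).rlp⟩
  letI : CategoryWithCofibrations (DGCatp k) := ⟨(generatingCofibrations k).rlp.llp⟩
  letI : CategoryWithWeakEquivalences (DGCatp k) := ⟨quasiEquivalences k⟩
  have h₁ : trivialFibrations (DGCatp k) = (generatingCofibrations k).rlp :=
    (inf_comm _ _).trans (rlp_generatingCofibrations k).symm
  have h₂ : trivialCofibrations (DGCatp k) = (generatingTrivialCofibrations k).rlp.llp :=
    (inf_comm _ _).trans (quasiEquivalences_inf_llp_rlp_generatingCofibrations k)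
  haveI : (weakEquivalences (DGCatp k)).HasTwoOutOfThreeProperty :=
    DGCatp.hasTwoOutOfThreeProperty_quasiEquivalences
  haveI : MorphismProperty.IsWeakFactorizationSystem (cofibrations (DGCatp k))
      (trivialFibrations (DGCatp k)) :=
    { rlp := (MorphismProperty.rlp_llp_rlp _).trans h₁.symm
      llp := by rw [h₁]; rfl
      hasFactorization := by
        rw [h₁]
        exact inferInstanceAs (MorphismProperty.HasFactorization
          (generatingCofibrations k).rlp.llp (generatingCofibrations k).rlp) }
  haveI : MorphismProperty.IsWeakFactorizationSystem (trivialCofibrations (DGCatp k))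
      (fibrations (DGCatp k)) :=
    { rlp := by rw [h₂]; exact MorphismProperty.rlp_llp_rlp _
      llp := h₂.symm
      hasFactorization := by
        rw [h₂]
        exact inferInstanceAs (MorphismProperty.HasFactorization
          (generatingTrivialCofibrations k).rlp.llp (generatingTrivialCofibrations k).rlp) }
  haveI : HasLimitsOfSize.{0, 0} (DGCatp k) := hasLimitsOfSizeShrink.{0, 0, u, u} _
  haveI : HasColimitsOfSize.{0, 0} (DGCatp k) := hasColimitsOfSizeShrink.{0, 0, u, u} _
  ModelCategory.mk' (DGCatp k)

theorem isCofibrantlyGeneratedBy_modelCategory (k : Type u) [CommRing k] :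
    letI := DGCatp.modelCategory k
    IsCofibrantlyGeneratedBy.{u} (DGCatp k) (generatingCofibrations k)
      (generatingTrivialCofibrations k) := by
  let _ := DGCatp.modelCategory k
  have h₁ : trivialFibrations (DGCatp k) = (generatingCofibrations k).rlp :=
    (inf_comm _ _).trans (rlp_generatingCofibrations k).symm
  have h₂ : trivialCofibrations (DGCatp k) = (generatingTrivialCofibrations k).rlp.llp :=
    (inf_comm _ _).trans (quasiEquivalences_inf_llp_rlp_generatingCofibrations k)
  exact
    { functorialFactorization₁ := by
        rw [h₁]
        exact inferInstanceAs (MorphismProperty.HasFunctorialFactorization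
          (generatingCofibrations k).rlp.llp (generatingCofibrations k).rlp)
      functorialFactorization₂ := by
        rw [h₂]
        exact inferInstanceAs (MorphismProperty.HasFunctorialFactorization
          (generatingTrivialCofibrations k).rlp.llp (generatingTrivialCofibrations k).rlp)
      isSmall_I := inferInstance
      isSmall_J := inferInstance
      small_I := fun _ _ i hi => smallRelativeTo_generatingCofibrations i hi _
      small_J := fun _ _ i hi => smallRelativeTo_generatingTrivialCofibrations i hi _
      fibrations_eq := rfl
      trivialFibrations_eq := h₁ }

end

theorem mainTheorem1 (k : Type u) [CommRing k] :
    RecognitionConditions.{u} (quasiEquivalences k) (generatingCofibrations k)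
      (generatingTrivialCofibrations k) ∧
    ∃ _ : ModelCategory (DGCatp k),
      weakEquivalences (DGCatp k) = quasiEquivalences k ∧
      IsCofibrantlyGeneratedBy.{u} (DGCatp k) (generatingCofibrations k)
        (generatingTrivialCofibrations k) :=
  ⟨recognitionConditions k, DGCatp.modelCategory k, rfl, isCofibrantlyGeneratedBy_modelCategory k⟩
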